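/- **Setting.** Let $\mathcal R$ be the $N=1$ Ramond algebra extended by the parity operator: it is generated by even $L_m$ ($m\in\mathbb Z$), odd $G_m$ ($m\in\mathbb Z$), a central element $C$ and $(-1)^F$, with $$[L_m,L_n]=(m-n)L_{m+n}+\tfrac{C}{12}(m^3-m)\delta_{m+n,0},\qquad [L_m,G_n]=(\tfrac m2-n)G_{m+n},$$ $$\{G_m,G_n\}=2L_{m+n}+\tfrac C3(m^2-\tfrac14)\delta_{m+n,0},\qquad [L_m,C]=[G_m,C]=0,$$ and $(-1)^F$ commuting with $L_m$, $C$ and anticommuting with $G_m$. Let $U(\mathcal R)$ be its universal enveloping algebra and $\mathcal R^+=\mathrm{span}\{L_m,G_m: m\ge 1\}$. For $c,\Delta\in\mathbb C$ the Verma module $\mathcal V_\Delta$ is the $U(\mathcal R)$-module induced from a highest weight vector $|\Delta\rangle$ with $\mathcal R^+|\Delta\rangle=0$, $L_0|\Delta\rangle=\Delta|\Delta\rangle$, $C|\Delta\rangle=c|\Delta\rangle$, $(-1)^F|\Delta\rangle=|\Delta\rangle$. The $G$-closed Verma module $\mathcal V^G_{c/24}$ is defined in the same way with $\Delta=\frac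 c{24}$ and the additional condition that $G_0$ annihilates the highest weight vector. For $l\in\mathbb N_0$ and $p\in\{\pm1\}$ let $\mathcal C^p_l$ be the set of formal monomials $$X=L_{-m_a}\cdots L_{-m_1}\,G_{-k_b}\cdots G_{-k_1}\,L_{-1}^{n}G_{-1}^{r_1}G_0^{r_2},$$ with $m_a\ge\dots\ge m_1\ge2$, $k_b>\dots>k_1\ge 2$, $n\ge0$, $r_1,r_2\in\{0,1\}$, of level $\sum m_i+\sum k_j+n+r_1=l$ and parity $(-1)^{b+r_1+r_2}=p$; let $\mathcal C^{pG}_l$ be the subset of those with $r_2=0$. The vectors $X|\Delta\rangle$, $X\in\bigcup_{l,p}\mathcal C^p_l$, form a basis of $\mathcal V_\Delta$ (the standard basis), and likewise those with $r_2=0$ form a basis of $\mathcal V^G_{c/24}$. The *non-trivial terms* of a vector are the monomials with non-zero coefficient in its expansion in this basis. *Ordering.* Two words $L_{-m_a}\cdots L_{-m_1}$ and $L_{-m'_{a'}}\cdots L_{-m'_1}$ are compared at the smallest $j\le\min(a,a')$ with $m_j\ne m'_j$, the word with the smaller $m_j$ being smaller; if there is no such $j$, the longer word is smaller. $G$-words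 are compared in the same way. On $\mathcal C^p_l$ let $\mathcal O$ be the ordering in which $X\ne X'$ are compared lexicographically: first, the monomial with larger $n$ is smaller; if $n=n'$, the one with larger $r_1$ is smaller; if also $r_1=r_1'$, the one with the smaller $G$-word is smaller; if also the $G$-words agree, the one with the smaller $L$-word is smaller. The same rule defines $\mathcal O$ on $\mathcal C^{pG}_l$. *Adaptedness and kernel.* Let $S$ be $\mathcal C^p_l$ (in $\mathcal V_\Delta$) or $\mathcal C^{pG}_l$ (in $\mathcal V^G_{c/24}$), and let $\mathcal K\subset U(\mathcal R)$ be a linear space of annihilation operators. A total ordering on $S$ is *adapted* to $A\subset S$ if for every $X\in A$ there is $\Gamma\in\mathcal K$ such that $\Gamma X$, applied to the highest weight vector, has a non-trivial term which is not a non-trivial term of $\Gamma Y$, applied to the highest weight vector, for any $Y\in S$ strictly larger than $X$. The complement $S\setminus A$ is then called an *ordering kernel* of this ordering with annihilation operators $\mathcal K$ (it depends on the choice of $A$). **Theorem.** For all $c\in\mathbb C$ and all $l\ge1$, $\mathcal O$ is a total ordering on $\mathcal C^p_l$ and on $\mathcal C^{pG}_l$ ($p=\pm$), and the following hold. 1.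 For every $\Delta\in\mathbb C$, with annihilation operators $\mathcal K=\mathcal R^+$, the set $\{L_{-1}^l,\ L_{-1}^{l-1}G_{-1}G_0\}$ is an ordering kernel of $\mathcal O$ on $\mathcal C^+_l$ in $\mathcal V_\Delta$, and $\{L_{-1}^lG_0,\ L_{-1}^{l-1}G_{-1}\}$ is an ordering kernel of $\mathcal O$ on $\mathcal C^-_l$ in $\mathcal V_\Delta$. 2. For every $\Delta\in\mathbb C$, with annihilation operators $\mathcal K=\mathcal R^+\oplus\mathbb C G_0$, the set $\{L_{-1}^l\}$ is an ordering kernel of $\mathcal O$ on $\mathcal C^+_l$ in $\mathcal V_\Delta$, and $\{L_{-1}^lG_0\}$ is an ordering kernel of $\mathcal O$ on $\mathcal C^-_l$ in $\mathcal V_\Delta$. 3. With annihilation operators $\mathcal K=\mathcal R^+$, the set $\{L_{-1}^l\}$ is an ordering kernel of $\mathcal O$ on $\mathcal C^{+G}_l$ in $\mathcal V^G_{c/24}$, and $\{L_{-1}^{l-1}G_{-1}\}$ is an ordering kernel of $\mathcal O$ on $\mathcal C^{-G}_l$ in $\mathcal V^G_{c/24}$. -/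

import Mathlib

namespace Ramond

/-- Generators of the (extended) Ramond algebra: the Virasoro modes `L m`, the fermionic modes
`G m` (both with integer index), the central element `C` and the parity operator `F = (-1)^F`. -/
inductive Gen : Type
  | L (m : ℤ)
  | G (m : ℤ)
  | C
  | F

/-- The generators as elements of the free associative algebra. -/
noncomputable abbrev gen (x : Gen) : FreeAlgebra ℂ Gen := FreeAlgebra.ι ℂ x

/-- The commutation and anticommutation relations of the (extended) Ramond algebra. -/
inductive Rel : FreeAlgebra ℂ Gen → FreeAlgebra ℂ Gen → Prop
  | LL (m n : ℤ) : Rel (gen (.L m) * gen (.L n) - gen (.L n) * gen (.L m))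
      (((m : ℂ) - n) • gen (.L (m + n)) +
        (if m + n = 0 then ((m : ℂ) ^ 3 - m) / 12 else 0) • gen .C)
  | LG (m n : ℤ) : Rel (gen (.L m) * gen (.G n) - gen (.G n) * gen (.L m))
      (((m : ℂ) / 2 - n) • gen (.G (m + n)))
  | GG (m n : ℤ) : Rel (gen (.G m) * gen (.G n) + gen (.G n) * gen (.G m))
      ((2 : ℂ) • gen (.L (m + n)) +
        (if m + n = 0 then ((m : ℂ) ^ 2 - 1 / 4) / 3 else 0) • gen .C)
  | LC (m : ℤ) : Rel (gen (.L m) * gen .C) (gen .C * gen (.L m))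
  | GC (m : ℤ) : Rel (gen (.G m) * gen .C) (gen .C * gen (.G m))
  | FL (m : ℤ) : Rel (gen .F * gen (.L m)) (gen (.L m) * gen .F)
  | FC : Rel (gen .F * gen .C) (gen .C * gen .F)
  | FG (m : ℤ) : Rel (gen .F * gen (.G m) + gen (.G m) * gen .F) 0

/-- The universal enveloping algebra of the Ramond algebra: the unital associative complex algebra
on the generators, subject to the (anti)commutation relations. (No relation `F ^ 2 = 1` is
needed: it holds automatically on the Verma modules below.) -/
abbrev U : Type := RingQuot Rel

/-- The image of a generator in the enveloping algebra. -/
noncomputable def toU (x : Gen) : U := RingQuot.mkAlgHom ℂ Rel (gen x)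

/-- The mode `L_m` in the enveloping algebra. -/
noncomputable def L (m : ℤ) : U := toU (.L m)

/-- The mode `G_m` in the enveloping algebra. -/
noncomputable def G (m : ℤ) : U := toU (.G m)

/-- The central element in the enveloping algebra. -/
noncomputable def C : U := toU .C

/-- The parity operator in the enveloping algebra. -/
noncomputable def F : U := toU .F

/-- The space of positive operators: the span of `L_m`, `G_m` with `m ≥ 1`. -/
noncomputable def positive : Submodule ℂ U :=
  Submodule.span ℂ {x | ∃ m : ℤ, 1 ≤ m ∧ (x = L m ∨ x = G m)}

/-- The positive operators together with `G_0`. -/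
noncomputable def positiveG : Submodule ℂ U := positive ⊔ Submodule.span ℂ {G 0}

/-- The left ideal of `U` annihilating a generic highest weight vector of conformal weight `Δ`,
central charge `c` and parity `+`. -/
noncomputable def vermaIdeal (c Δ : ℂ) : Submodule U U :=
  Submodule.span U ((positive : Set U) ∪
    {L 0 - algebraMap ℂ U Δ, C - algebraMap ℂ U c, F - 1})

/-- The Verma module `V_Δ`, i.e. the `U`-module induced from the one-dimensional module of the
Cartan subalgebra and the positive operators spanned by the highest weight vector. -/
abbrev Verma (c Δ : ℂ) : Type := U ⧸ vermaIdeal c Δ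

/-- The highest weight vector of the Verma module. -/
noncomputable def hwv (c Δ : ℂ) : Verma c Δ := Submodule.Quotient.mk 1

/-- The left ideal of `U` annihilating a generic `G`-closed highest weight vector (of conformal
weight `c / 24`). -/
noncomputable def vermaIdealG (c : ℂ) : Submodule U U :=
  Submodule.span U ((positiveG : Set U) ∪
    {L 0 - algebraMap ℂ U (c / 24), C - algebraMap ℂ U c, F - 1})

/-- The `G`-closed Verma module, in which also `G_0` annihilates the highest weight vector. -/
abbrev VermaG (c : ℂ) : Type := U ⧸ vermaIdealG c

/-- The highest weight vector of the `G`-closed Verma module. -/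
noncomputable def hwvG (c : ℂ) : VermaG c := Submodule.Quotient.mk 1

/-- A standard monomial
`L_{-m_a} ⋯ L_{-m_1} G_{-k_b} ⋯ G_{-k_1} L_{-1}^n G_{-1}^{r₁} G_0^{r₂}`
with `m_a ≥ ⋯ ≥ m_1 ≥ 2` and `k_b > ⋯ > k_1 ≥ 2`.
The lists are read from right to left: `ls = [m_1, …, m_a]` and `gs = [k_1, …, k_b]`. -/
@[ext] structure Mono : Type where
  ls : List ℕ
  gs : List ℕ
  n : ℕ
  r₁ : Fin 2
  r₂ : Fin 2
  ls_sorted : ls.Pairwise (· ≤ ·)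
  ls_two_le : ∀ m ∈ ls, 2 ≤ m
  gs_sorted : gs.Pairwise (· < ·)
  gs_two_le : ∀ k ∈ gs, 2 ≤ k

namespace Mono

/-- The element of the enveloping algebra given by a standard monomial. -/
noncomputable def toU (X : Mono) : U :=
  (X.ls.reverse.map fun m => L (-(m : ℤ))).prod * (X.gs.reverse.map fun k => G (-(k : ℤ))).prod *
    L (-1) ^ X.n * G (-1) ^ (X.r₁ : ℕ) * G 0 ^ (X.r₂ : ℕ)

/-- The level of a standard monomial. -/
def level (X : Mono) : ℕ := X.ls.sum + X.gs.sum + X.n + X.r₁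

/-- The parity of a standard monomial, `1` or `-1`. -/
def parity (X : Mono) : ℤˣ := (-1) ^ (X.gs.length + (X.r₁ : ℕ) + (X.r₂ : ℕ))

/-- The monomial `L_{-1}^n G_{-1}^{r₁} G_0^{r₂}`. -/
def pure (n : ℕ) (r₁ r₂ : Fin 2) : Mono where
  ls := []
  gs := []
  n := n
  r₁ := r₁
  r₂ := r₂
  ls_sorted := by simp
  ls_two_le := by simp
  gs_sorted := by simp
  gs_two_le := by simp

end Mono

/-- The set of standard monomials of level `l` and parity `p`. -/
def cset (p : ℤˣ) (l : ℕ) : Set Mono := {X | X.level = l ∧ X.parity = p}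

/-- The standard monomials without a factor `G_0`. -/
abbrev MonoG : Type := {X : Mono // X.r₂ = 0}

/-- The monomial `L_{-1}^n G_{-1}^{r₁}`. -/
def MonoG.pure (n : ℕ) (r₁ : Fin 2) : MonoG := ⟨Mono.pure n r₁ 0, rfl⟩

/-- The set of standard monomials without `G_0` of level `l` and parity `p`. -/
def csetG (p : ℤˣ) (l : ℕ) : Set MonoG := {X | X.1.level = l ∧ X.1.parity = p}

/-- The strict order on the words `L_{-m_a} ⋯ L_{-m_1}`, and on the words `G_{-k_b} ⋯ G_{-k_1}`,
both given by their lists of indices read from right to left: at the first index where the two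
words disagree the one with the smaller entry is smaller; if there is no such
index within the common length, the longer word is smaller. -/
def wordLT : List ℕ → List ℕ → Prop
  | [], _ => False
  | _ :: _, [] => True
  | a :: s, b :: t => a < b ∨ (a = b ∧ wordLT s t)

/-- The strict ordering on standard monomials: compare first the powers of `L_{-1}` (the larger
power is smaller), then those of `G_{-1}` (the larger power is smaller), then the `G`-words,
then the `L`-words. -/
def monoLT (X Y : Mono) : Prop :=
  X.n > Y.n ∨ (X.n = Y.n ∧ (X.r₁ > Y.r₁ ∨ (X.r₁ = Y.r₁ ∧
    (wordLT X.gs Y.gs ∨ (X.gs = Y.gs ∧ wordLT X.ls Y.ls)))))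

/-- The ordering on standard monomials. -/
def monoLE (X Y : Mono) : Prop := X = Y ∨ monoLT X Y

/-- The ordering on standard monomials without `G_0`. -/
def monoLEG (X Y : MonoG) : Prop := monoLE X.1 Y.1

section Adapted

variable {ι V : Type} [AddCommGroup V] [Module ℂ V] [Module U V]

/-- The set of non-trivial terms of a vector, with respect to a basis. -/
def terms (b : Module.Basis ι ℂ V) (v : V) : Set ι := {X | b.repr v X ≠ 0}

/-- `le` is a total ordering on the set `S`. -/
def IsTotalOrderOn (le : ι → ι → Prop) (S : Set ι) : Prop :=
  (∀ X ∈ S, le X X) ∧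
  (∀ X ∈ S, ∀ Y ∈ S, le X Y → le Y X → X = Y) ∧
  (∀ X ∈ S, ∀ Y ∈ S, ∀ Z ∈ S, le X Y → le Y Z → le X Z) ∧
  (∀ X ∈ S, ∀ Y ∈ S, le X Y ∨ le Y X)

/-- The total ordering `le` on the set `S` of basis labels is adapted to the subset `A`, with
annihilation operators `K`: for every `X ∈ A` there is `Γ ∈ K` such that `Γ X` has a non-trivial
term that is not a term of `Γ Y` for any `Y ∈ S` strictly larger than `X`. -/
def IsAdapted (b : Module.Basis ι ℂ V) (le : ι → ι → Prop) (S : Set ι) (K : Submodule ℂ U)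
    (A : Set ι) : Prop :=
  IsTotalOrderOn le S ∧ A ⊆ S ∧
  ∀ X ∈ A, ∃ Γ ∈ K,
    ¬ terms b (Γ • b X) ⊆ ⋃ Y ∈ {Y | Y ∈ S ∧ le X Y ∧ Y ≠ X}, terms b (Γ • b Y)

/-- `N` is an ordering kernel of the ordering `le` on `S`: the complement in `S` of a
subset to which the ordering is adapted. -/
def IsOrderingKernel (b : Module.Basis ι ℂ V) (le : ι → ι → Prop) (S : Set ι)
    (K : Submodule ℂ U) (N : Set ι) : Prop :=
  ∃ A : Set ι, IsAdapted b le S K A ∧ N = S \ A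

end Adapted

end Ramond

/-! The theorem has two halves: the standard monomials must be shown to give bases of the two
modules, and every monomial outside the stated kernel needs an operator that detects it.

Bases. Since $(-1)^F$ anticommutes with the odd $G_m$ but commutes with itself, the extended algebra
is treated as a colour Lie algebra with commutation signs `Gen.eps`. A highest weight module is
induced from a character of the subalgebra spanned by the letters in `hwSet`. A PBW theorem for such
induced modules follows from the diamond lemma: an inversion of adjacent letters is swapped at the
cost of a bracket, the square of an odd letter is replaced by half its bracket, and a last letter in
`hwSet` acts by its scalar. Overlapping pairs are resolved by the Jacobi identity, and a pair
meeting the last letter is resolved by the character property. For $G_0$ to belong to the character,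
$\{G_0,G_0\}=2L_0-C/12$ must go to $0$, which is the condition $\Delta=c/24$. The letters are
ordered so that the irreducible words are exactly the standard monomials (`exists_pbw_normalForm`,
`exists_standard_basis`).

Detection. Everything is measured by the powers of $L_{-1}$ and $G_{-1}$. If the rightmost letter of
a nonempty $G$-word is $G_{-k}$, apply $G_{k-1}$: the relation $\{G_{k-1},G_{-k}\}=2L_{-1}$ (up to a
vanishing central term) trades that letter for $L_{-1}$. If the $G$-word is empty and the rightmost
letter of the $L$-word is $L_{-m}$, apply $L_{m-1}$, using $[L_{m-1},L_{-m}]=(2m-1)L_{-1}$. The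
resulting monomial (`Mono.tailG`, `Mono.tailL`) has one more $L_{-1}$ and the same $r_1$.

A larger monomial cannot produce it. A mode raises the power of $L_{-1}$ by at most one, and never
raises $r_1$ while doing so; this settles smaller $n$ or smaller $r_1$. Letters of larger index only
create modes of index at most $-2$. A monomial with the same rightmost letter produces its own
shortened monomial, which is a different one. These facts are combined in
`IsHighestWeight.exists_leading`.

What remains is $L_{-1}^nG_{-1}^{r_1}G_0^{r_2}$, of which level and parity leave at most two. When
$G_0$ is available, $\{G_0,G_{-1}\}=2L_{-1}$ also detects the one with $r_1=1$. -/

namespace Ramond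

/-! ### Linear rewriting systems -/

/-- The diamond lemma for linear rewriting: a terminating system of linear rewriting rules on the
vectors of a basis whose ambiguities are resolvable has a linear normal form map. -/
theorem exists_normalForm {W A : Type*} [AddCommGroup A] [Module ℂ A] (β : Module.Basis W ℂ A)
    {prec : W → W → Prop} (wf : WellFounded prec) (red : W → A → Prop)
    (hlow : ∀ w m, red w m → m ∈ Submodule.span ℂ (β '' {u | prec u w}))
    (hconf : ∀ w m m', red w m → red w m' →
      m - m' ∈ Submodule.span ℂ {z | ∃ u n, prec u w ∧ red u n ∧ z = β u - n}) :
    ∃ NF : A →ₗ[ℂ] (W →₀ ℂ), (∀ w m, red w m → NF (β w) = NF m) ∧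
      ∀ w, (∀ m, ¬ red w m) → NF (β w) = Finsupp.single w 1 := by
  classical
  -- A reducible `w` gets the normal form of one chosen reduction. The default `0` is never used on
  -- it, because `hlow` keeps the reduction below `w`.
  let step : ∀ w, (∀ u, prec u w → (W →₀ ℂ)) → (W →₀ ℂ) := fun w rec =>
    if h : ∃ m, red w m then
      β.constr ℂ (fun u => if hu : prec u w then rec u hu else 0) h.choose
    else Finsupp.single w 1
  let f := wf.fix step
  have hf : ∀ w, f w = step w (fun u _ => f u) := wf.fix_eq step
  let NF : A →ₗ[ℂ] (W →₀ ℂ) := β.constr ℂ f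
  have hNF : ∀ w, NF (β w) = f w := fun w => β.constr_basis ℂ f w
  have key : ∀ w m, m ∈ Submodule.span ℂ (β '' {u | prec u w}) →
      β.constr ℂ (fun u => if prec u w then f u else 0) m = NF m := by
    intro w m hm
    refine LinearMap.eqOn_span ?_ hm
    rintro _ ⟨u, hu, rfl⟩
    rw [Module.Basis.constr_basis, hNF, if_pos (show prec u w from hu)]
  have hchosen : ∀ w, ∀ h : ∃ m, red w m, NF (β w) = NF h.choose := by
    intro w h
    rw [hNF, hf]
    simp only [step, dif_pos h]
    simp only [dite_eq_ite]
    exact key w _ (hlow _ _ h.choose_spec)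
  refine ⟨NF, ?_, ?_⟩
  · intro w
    induction w using wf.induction with
    | _ w ih =>
      intro m hm
      have h : ∃ m, red w m := ⟨m, hm⟩
      rw [hchosen w h, ← sub_eq_zero, ← map_sub]
      -- By induction `NF` kills all relations coming from smaller words, hence by `hconf` it cannot
      -- distinguish two reductions of `w`.
      have hker : Submodule.span ℂ {z | ∃ u n, prec u w ∧ red u n ∧ z = β u - n} ≤
          LinearMap.ker NF := by
        rw [Submodule.span_le]
        rintro _ ⟨u, n, hu, hn, rfl⟩
        simp [ih u hu n hn]
      exact hker (hconf w _ _ h.choose_spec hm)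
  · intro w hw
    rw [hNF, hf]
    simp only [step]
    rw [dif_neg]
    rintro ⟨m, hm⟩
    exact hw m hm

/-! ### Words and inversions -/

section Inversions

variable {X : Type} [LinearOrder X]

/-- The number of inversions of a word. -/
def inversions : List X → ℕ
  | [] => 0
  | x :: w => w.countP (· < x) + inversions w

/-- A word precedes another one if it is shorter, or is a permutation of it with fewer
inversions. -/
def Prec (u w : List X) : Prop :=
  u.length < w.length ∨ (u.Perm w ∧ inversions u < inversions w)

theorem Prec.wf : WellFounded (Prec (X := X)) := by
  refine Subrelation.wf (r := InvImage (Prod.Lex (· < ·) (· < ·))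
    (fun w : List X => (w.length, inversions w))) ?_
    (InvImage.wf _ (WellFounded.prod_lex wellFounded_lt wellFounded_lt))
  rintro u w (h | ⟨h, h'⟩)
  · exact Prod.Lex.left _ _ h
  · simp only [InvImage, h.length_eq]
    exact Prod.Lex.right _ h'

/-- The cross term depends on `u` and `b` only through their multisets of letters. This is why
`Prec` is stable under putting words into a context. -/
theorem inversions_append (u b : List X) :
    inversions (u ++ b) = inversions u + inversions b + (u.map fun x => b.countP (· < x)).sum := by
  induction u with
  | nil => simp [inversions]
  | cons x u ih =>
    simp only [List.cons_append, inversions, List.countP_append, ih, List.map_cons, List.sum_cons]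
    ring

theorem Prec.append {u v : List X} (h : Prec u v) (a b : List X) :
    Prec (a ++ u ++ b) (a ++ v ++ b) := by
  rcases h with h | ⟨h, h'⟩
  · left; simp; omega
  · right
    refine ⟨(h.append_left a).append_right b, ?_⟩
    have h1 : ∀ x, u.countP (· < x) = v.countP (· < x) := fun x => h.countP_eq _
    have h2 : (u.map fun x => b.countP (· < x)).sum = (v.map fun x => b.countP (· < x)).sum :=
      (h.map _).sum_eq
    simp only [inversions_append, List.map_append, List.sum_append, h1, h2]
    omega

theorem prec_swap {x y : X} (h : y < x) (a b : List X) :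
    Prec (a ++ y :: x :: b) (a ++ x :: y :: b) := by
  have h0 : Prec [y, x] [x, y] := by
    right
    refine ⟨List.Perm.swap _ _ _, ?_⟩
    simp [inversions, h, h.not_gt]
  simpa using h0.append a b

theorem prec_of_length {u v : List X} (h : u.length < v.length) : Prec u v := Or.inl h

theorem Prec.trans {u v w : List X} (h : Prec u v) (h' : Prec v w) : Prec u w := by
  rcases h with h | ⟨h, h1⟩ <;> rcases h' with h' | ⟨h', h1'⟩
  · exact Or.inl (h.trans h')
  · exact Or.inl (h.trans_eq h'.length_eq)
  · exact Or.inl (h.length_eq.trans_lt h')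
  · exact Or.inr ⟨h.trans h', h1.trans h1'⟩

end Inversions

/-! ### Colour Lie algebras given by structure constants -/

/-- The bracket of a colour Lie algebra with basis `X`, given on the basis. -/
structure ColourBracket (X : Type) where
  eps : X → X → ℂ
  br : X → X → X →₀ ℂ
  eps_eq : ∀ x y, eps x y = 1 ∨ eps x y = -1
  eps_symm : ∀ x y, eps x y = eps y x
  br_symm : ∀ x y, br x y = -(eps x y) • br y x
  eps_br : ∀ x y z, ∀ s ∈ (br x y).support, eps s z = eps x z * eps y z
  jacobi : ∀ x y z, Finsupp.linearCombination ℂ (fun s => br s z) (br x y)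
    - Finsupp.linearCombination ℂ (fun s => br x s) (br y z)
    + eps x y • Finsupp.linearCombination ℂ (fun s => br y s) (br x z) = 0

namespace ColourBracket

variable {X : Type} (𝔤 : ColourBracket X)

theorem eps_mul_self (x y : X) : 𝔤.eps x y * 𝔤.eps x y = 1 := by
  rcases 𝔤.eps_eq x y with h | h <;> simp [h]

theorem br_self {x : X} (h : 𝔤.eps x x = 1) : 𝔤.br x x = 0 := by
  have := 𝔤.br_symm x x
  rw [h, neg_smul, one_smul] at this
  exact self_eq_neg.mp this

variable {R : Type*} [Ring R]

/-- A map from the basis of a colour Lie algebra to an associative algebra which respects the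
brackets. -/
def Respects [Algebra ℂ R] (g : X → R) : Prop :=
  ∀ x y, g x * g y - 𝔤.eps x y • (g y * g x) = Finsupp.linearCombination ℂ g (𝔤.br x y)

/-- The monomial of a word. -/
def wd (g : X → R) (w : List X) : R := (w.map g).prod

@[simp] theorem wd_nil (g : X → R) : wd g [] = 1 := rfl

@[simp] theorem wd_cons (g : X → R) (x : X) (w : List X) : wd g (x :: w) = g x * wd g w := by
  simp [wd]

@[simp] theorem wd_append (g : X → R) (u w : List X) : wd g (u ++ w) = wd g u * wd g w := by
  simp [wd]

theorem wd_mul_linearCombination_mem [Algebra ℂ R] (g : X → R) (p : Submodule ℂ R) (a b : List X)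
    (f : X →₀ ℂ) (h : ∀ s ∈ f.support, wd g (a ++ s :: b) ∈ p) :
    wd g a * Finsupp.linearCombination ℂ g f * wd g b ∈ p := by
  rw [Finsupp.linearCombination_apply, Finsupp.sum, Finset.mul_sum, Finset.sum_mul]
  refine Submodule.sum_mem _ fun s hs => ?_
  rw [mul_smul_comm, smul_mul_assoc]
  refine Submodule.smul_mem _ _ ?_
  simpa [mul_assoc] using h s hs

variable [LinearOrder X] [Algebra ℂ R]

/-- Adjacent letters which are admissible in a normal word. -/
def Good (x y : X) : Prop := x < y ∨ (x = y ∧ 𝔤.eps x x = 1)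

theorem good_trans {x y z : X} (h : 𝔤.Good x y) (h' : 𝔤.Good y z) : 𝔤.Good x z := by
  rcases h with h | ⟨rfl, h⟩
  · rcases h' with h' | ⟨rfl, _⟩
    · exact Or.inl (h.trans h')
    · exact Or.inl h
  · exact h'

/-- Normal words. -/
def Normal (w : List X) : Prop := w.Pairwise 𝔤.Good

theorem not_good {x y : X} : ¬ 𝔤.Good x y ↔ y < x ∨ (x = y ∧ 𝔤.eps x x = -1) := by
  unfold Good
  rcases lt_trichotomy x y with h | rfl | h
  · simp [h, h.ne, h.not_gt]
  · rcases 𝔤.eps_eq x x with h | h <;> norm_num [h]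
  · simp [h, h.ne', h.not_gt]

/-- The replacement of an inadmissible pair of adjacent letters. -/
noncomputable def repl (g : X → R) (x y : X) : R :=
  if y < x then 𝔤.eps x y • (g y * g x) + Finsupp.linearCombination ℂ g (𝔤.br x y)
  else (1 / 2 : ℂ) • Finsupp.linearCombination ℂ g (𝔤.br x x)

theorem exists_bad_pair {w : List X} (h : ¬ 𝔤.Normal w) :
    ∃ a x y b, w = a ++ x :: y :: b ∧ ¬ 𝔤.Good x y := by
  have : Trans 𝔤.Good 𝔤.Good 𝔤.Good := ⟨𝔤.good_trans⟩
  rw [Normal, ← List.isChain_iff_pairwise, List.isChain_iff_forall_rel_of_append_cons_cons] at h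
  push Not at h
  obtain ⟨x, y, a, b, h, h'⟩ := h
  exact ⟨a, x, y, b, h, h'⟩

variable {𝔤}

theorem Respects.mul_eq_repl {g : X → R} (hg : 𝔤.Respects g) {x y : X} (h : ¬ 𝔤.Good x y) :
    g x * g y = 𝔤.repl g x y := by
  have h1 := hg x y
  rcases 𝔤.not_good.mp h with h' | ⟨rfl, h'⟩
  · rw [repl, if_pos h', ← h1]; abel
  · rw [repl, if_neg (lt_irrefl x), ← h1, h']
    module

/-- A replacement is a combination of preceding words. -/
theorem repl_mem (g : X → R) (p : Submodule ℂ R) {x y : X} (a b : List X) (hxy : ¬ 𝔤.Good x y)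
    (hp : Prec [y, x] [x, y] → wd g (a ++ y :: x :: b) ∈ p)
    (hs : ∀ s ∈ (𝔤.br x y).support, wd g (a ++ s :: b) ∈ p) :
    wd g a * 𝔤.repl g x y * wd g b ∈ p := by
  rcases 𝔤.not_good.mp hxy with h | ⟨rfl, h⟩
  · rw [repl, if_pos h, mul_add, add_mul]
    refine add_mem ?_ (wd_mul_linearCombination_mem g p a b _ hs)
    rw [mul_smul_comm, smul_mul_assoc]
    refine Submodule.smul_mem _ _ ?_
    simpa [mul_assoc] using hp (prec_swap h [] [])
  · rw [repl, if_neg (lt_irrefl x), mul_smul_comm, smul_mul_assoc]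
    exact Submodule.smul_mem _ _ (wd_mul_linearCombination_mem g p a b _ hs)

/-- Products of elements from a set of letters closed under the bracket are combinations of
normal products from this set. -/
theorem Respects.wd_mem_span {g : X → R} (hg : 𝔤.Respects g) {K : Set X}
    (hK : ∀ x ∈ K, ∀ y ∈ K, ∀ s ∈ (𝔤.br x y).support, s ∈ K) (w : List X) (hw : ∀ x ∈ w, x ∈ K) :
    wd g w ∈ Submodule.span ℂ (wd g '' {u | 𝔤.Normal u ∧ ∀ x ∈ u, x ∈ K}) := by
  induction w using (Prec.wf (X := X)).induction with
  | _ w ih =>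
    by_cases hn : 𝔤.Normal w
    · exact Submodule.subset_span ⟨w, ⟨hn, hw⟩, rfl⟩
    · obtain ⟨a, x, y, b, rfl, hxy⟩ := 𝔤.exists_bad_pair hn
      have hx : x ∈ K := hw x (by simp)
      have hy : y ∈ K := hw y (by simp)
      have ha : ∀ z ∈ a, z ∈ K := fun z hz => hw z (by simp [hz])
      have hb : ∀ z ∈ b, z ∈ K := fun z hz => hw z (by simp [hz])
      have e : wd g (a ++ x :: y :: b) = wd g a * 𝔤.repl g x y * wd g b := by
        rw [← hg.mul_eq_repl hxy]; simp [mul_assoc]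
      rw [e]
      refine repl_mem g _ a b hxy (fun h => ih _ ?_ ?_) fun s hs => ih _ ?_ ?_
      · simpa using h.append a b
      · simp only [List.mem_append, List.mem_cons]
        rintro z (h | rfl | rfl | h) <;> solve_by_elim
      · exact prec_of_length (by simp)
      · have := hK x hx y hy s hs
        simp only [List.mem_append, List.mem_cons]
        rintro z (h | rfl | h) <;> solve_by_elim

end ColourBracket

/-! ### A PBW theorem for modules induced from a character -/

namespace ColourBracket

variable {X : Type} [LinearOrder X] {𝔤 : ColourBracket X}

local notation "ι" => FreeAlgebra.ι ℂ

/-- A character of the subalgebra spanned by an upper set `B` of letters. -/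
structure IsCharacter (𝔤 : ColourBracket X) (B : Set X) (χ : X → ℂ) : Prop where
  upper : ∀ x ∈ B, ∀ y, x ≤ y → y ∈ B
  closed : ∀ x ∈ B, ∀ y ∈ B, ∀ s ∈ (𝔤.br x y).support, s ∈ B
  map_br : ∀ x ∈ B, ∀ y ∈ B, Finsupp.linearCombination ℂ χ (𝔤.br x y) =
    (1 - 𝔤.eps x y) * (χ x * χ y)

/-- The rewriting rules of the induced module: inadmissible pairs of letters are replaced, and a
last letter in `B` acts by the character. -/
inductive Rule (𝔤 : ColourBracket X) (B : Set X) (χ : X → ℂ) : List X → FreeAlgebra ℂ X → Prop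
  | pair (a : List X) (x y : X) (b : List X) (h : ¬ 𝔤.Good x y) :
      Rule 𝔤 B χ (a ++ x :: y :: b) (wd ι a * 𝔤.repl ι x y * wd ι b)
  | last (a : List X) (x : X) (h : x ∈ B) : Rule 𝔤 B χ (a ++ [x]) (χ x • wd ι a)

theorem rule_iff {B : Set X} {χ : X → ℂ} {w : List X} {m : FreeAlgebra ℂ X} :
    Rule 𝔤 B χ w m ↔ (∃ a x y b, ¬ 𝔤.Good x y ∧ w = a ++ x :: y :: b ∧
      m = wd ι a * 𝔤.repl ι x y * wd ι b) ∨ ∃ a x, x ∈ B ∧ w = a ++ [x] ∧ m = χ x • wd ι a := by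
  constructor
  · rintro (⟨a, x, y, b, h⟩ | ⟨a, x, h⟩)
    · exact Or.inl ⟨a, x, y, b, h, rfl, rfl⟩
    · exact Or.inr ⟨a, x, h, rfl, rfl⟩
  · rintro (⟨a, x, y, b, h, rfl, rfl⟩ | ⟨a, x, h, rfl, rfl⟩)
    · exact .pair a x y b h
    · exact .last a x h

/-- The span of the relations coming from rewriting words that precede `w`. -/
noncomputable def below (𝔤 : ColourBracket X) (B : Set X) (χ : X → ℂ) (w : List X) :
    Submodule ℂ (FreeAlgebra ℂ X) :=
  Submodule.span ℂ {z | ∃ u n, Prec u w ∧ Rule 𝔤 B χ u n ∧ z = wd ι u - n}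

variable {B : Set X} {χ : X → ℂ} {w : List X}

theorem pair_mem_below (a : List X) {x y : X} (b : List X) (h : ¬ 𝔤.Good x y)
    (hw : Prec (a ++ x :: y :: b) w) :
    wd ι a * (ι x * ι y - 𝔤.repl ι x y) * wd ι b ∈ below 𝔤 B χ w := by
  refine Submodule.subset_span ⟨_, _, hw, .pair a x y b h, ?_⟩
  simp [mul_sub, sub_mul, mul_assoc]

theorem last_mem_below (a : List X) {x : X} (h : x ∈ B) (hw : Prec (a ++ [x]) w) :
    wd ι a * ι x - χ x • wd ι a ∈ below 𝔤 B χ w := by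
  refine Submodule.subset_span ⟨_, _, hw, .last a x h, ?_⟩
  simp

/-- The rules only rewrite inadmissible pairs, but up to the factors $2$ and $-\epsilon(x,y)$ they
give the commutation relation for any two letters. The ambiguities can then be resolved without
regard to the order of the letters inside a bracket. -/
theorem commutator_mem_below (a : List X) (x y : X) (b : List X)
    (hw : Prec (a ++ x :: y :: b) w) (hw' : Prec (a ++ y :: x :: b) w) :
    wd ι a * (ι x * ι y - 𝔤.eps x y • (ι y * ι x) - Finsupp.linearCombination ℂ ι (𝔤.br x y)) *
      wd ι b ∈ below 𝔤 B χ w := by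
  rcases lt_trichotomy y x with h | rfl | h
  · have := pair_mem_below (B := B) (χ := χ) a b (𝔤.not_good.mpr (Or.inl h)) hw
    rw [repl, if_pos h] at this
    rwa [sub_sub]
  · rcases 𝔤.eps_eq y y with h | h
    · simp [h, 𝔤.br_self h]
    · have := pair_mem_below (B := B) (χ := χ) a b (𝔤.not_good.mpr (Or.inr ⟨rfl, h⟩)) hw
      rw [repl, if_neg (lt_irrefl y)] at this
      have h2 := Submodule.smul_mem _ (2 : ℂ) this
      rw [← smul_mul_assoc, ← mul_smul_comm] at h2
      convert h2 using 3
      rw [h]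
      module
  · have := pair_mem_below (B := B) (χ := χ) a b (𝔤.not_good.mpr (Or.inl h)) hw'
    rw [repl, if_pos h] at this
    have h2 := Submodule.smul_mem _ (-𝔤.eps x y) this
    rw [← smul_mul_assoc, ← mul_smul_comm] at h2
    convert h2 using 3
    rw [𝔤.br_symm x y, map_smul, 𝔤.eps_symm y x]
    have := 𝔤.eps_mul_self x y
    rcases 𝔤.eps_eq x y with h | h <;> rw [h] <;> module

/-- Used with `f` a bracket: all its letters have the same sign against `z`, so the relation is
linear in `f`. Words of two letters between `a` and `b` precede `w` by length alone. -/
theorem linearCombination_commutator_mem_below (a b : List X) (f : X →₀ ℂ) (z : X) (e : ℂ)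
    (he : ∀ s ∈ f.support, 𝔤.eps s z = e) (hw : a.length + b.length + 2 < w.length) :
    wd ι a * (Finsupp.linearCombination ℂ ι f * ι z -
      e • (ι z * Finsupp.linearCombination ℂ ι f) -
      Finsupp.linearCombination ℂ ι (Finsupp.linearCombination ℂ (fun s => 𝔤.br s z) f)) *
      wd ι b ∈ below 𝔤 B χ w := by
  have : wd ι a * (Finsupp.linearCombination ℂ ι f * ι z -
      e • (ι z * Finsupp.linearCombination ℂ ι f) -
      Finsupp.linearCombination ℂ ι (Finsupp.linearCombination ℂ (fun s => 𝔤.br s z) f)) *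
      wd ι b = ∑ s ∈ f.support, f s • (wd ι a * (ι s * ι z - 𝔤.eps s z • (ι z * ι s) -
        Finsupp.linearCombination ℂ ι (𝔤.br s z)) * wd ι b) := by
    have h : Finsupp.linearCombination ℂ ι (Finsupp.linearCombination ℂ (fun s => 𝔤.br s z) f) =
        ∑ s ∈ f.support, f s • Finsupp.linearCombination ℂ ι (𝔤.br s z) := by
      rw [Finsupp.linearCombination_apply ℂ f, Finsupp.sum, map_sum]
      simp only [map_smul]
    rw [h, Finsupp.linearCombination_apply, Finsupp.sum]
    simp only [Finset.sum_mul, Finset.mul_sum, Finset.smul_sum, ← Finset.sum_sub_distrib]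
    refine Finset.sum_congr rfl fun s hs => ?_
    simp only [he s hs, smul_mul_assoc, mul_smul_comm, mul_sub, sub_mul, mul_assoc]
    module
  rw [this]
  refine Submodule.sum_mem _ fun s _ => Submodule.smul_mem _ _ (commutator_mem_below a s z b ?_ ?_)
    <;> exact prec_of_length (by simp; omega)

theorem commutator_linearCombination_mem_below (a b : List X) (f : X →₀ ℂ) (z : X) (e : ℂ)
    (he : ∀ s ∈ f.support, 𝔤.eps z s = e) (hw : a.length + b.length + 2 < w.length) :
    wd ι a * (ι z * Finsupp.linearCombination ℂ ι f -
      e • (Finsupp.linearCombination ℂ ι f * ι z) -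
      Finsupp.linearCombination ℂ ι (Finsupp.linearCombination ℂ (fun s => 𝔤.br z s) f)) *
      wd ι b ∈ below 𝔤 B χ w := by
  have : wd ι a * (ι z * Finsupp.linearCombination ℂ ι f -
      e • (Finsupp.linearCombination ℂ ι f * ι z) -
      Finsupp.linearCombination ℂ ι (Finsupp.linearCombination ℂ (fun s => 𝔤.br z s) f)) *
      wd ι b = ∑ s ∈ f.support, f s • (wd ι a * (ι z * ι s - 𝔤.eps z s • (ι s * ι z) -
        Finsupp.linearCombination ℂ ι (𝔤.br z s)) * wd ι b) := by
    have h : Finsupp.linearCombination ℂ ι (Finsupp.linearCombination ℂ (fun s => 𝔤.br z s) f) =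
        ∑ s ∈ f.support, f s • Finsupp.linearCombination ℂ ι (𝔤.br z s) := by
      rw [Finsupp.linearCombination_apply ℂ f, Finsupp.sum, map_sum]
      simp only [map_smul]
    rw [h, Finsupp.linearCombination_apply, Finsupp.sum]
    simp only [Finset.sum_mul, Finset.mul_sum, Finset.smul_sum, ← Finset.sum_sub_distrib]
    refine Finset.sum_congr rfl fun s hs => ?_
    simp only [he s hs, smul_mul_assoc, mul_smul_comm, mul_sub, sub_mul, mul_assoc]
    module
  rw [this]
  refine Submodule.sum_mem _ fun s _ => Submodule.smul_mem _ _ (commutator_mem_below a z s b ?_ ?_)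
    <;> exact prec_of_length (by simp; omega)

/-- Resolution of the ambiguity between two overlapping inadmissible pairs. -/
theorem overlap_mem_below (a : List X) {x y z : X} (b : List X) (hxy : ¬ 𝔤.Good x y)
    (hyz : ¬ 𝔤.Good y z) :
    wd ι a * 𝔤.repl ι x y * (ι z * wd ι b) - wd ι a * ι x * 𝔤.repl ι y z * wd ι b ∈
      below 𝔤 B χ (a ++ x :: y :: z :: b) := by
  -- The three double brackets of the Jacobi identity, written as commutators with a single bracket;
  -- one letter has been lost, so they are below the word.
  have l1 := linearCombination_commutator_mem_below (𝔤 := 𝔤) (B := B) (χ := χ)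
    (w := a ++ x :: y :: z :: b) a b (𝔤.br x y) z (𝔤.eps x z * 𝔤.eps y z)
    (𝔤.eps_br x y z) (by simp; omega)
  have l2 := commutator_linearCombination_mem_below (𝔤 := 𝔤) (B := B) (χ := χ)
    (w := a ++ x :: y :: z :: b) a b (𝔤.br y z) x (𝔤.eps x y * 𝔤.eps x z)
    (fun s hs => by rw [𝔤.eps_symm, 𝔤.eps_br y z x s hs, 𝔤.eps_symm y, 𝔤.eps_symm z])
    (by simp; omega)
  have l3 := commutator_linearCombination_mem_below (𝔤 := 𝔤) (B := B) (χ := χ)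
    (w := a ++ x :: y :: z :: b) a b (𝔤.br x z) y (𝔤.eps x y * 𝔤.eps y z)
    (fun s hs => by rw [𝔤.eps_symm, 𝔤.eps_br x z y s hs, 𝔤.eps_symm z])
    (by simp; omega)
  have J := congrArg (Finsupp.linearCombination ℂ ι) (𝔤.jacobi x y z)
  simp only [map_add, map_sub, map_smul, map_zero] at J
  have J' := congrArg (fun t => wd ι a * t * wd ι b) J
  simp only [mul_zero, zero_mul] at J'
  simp only [mul_add, add_mul, mul_sub, sub_mul, smul_mul_assoc, mul_smul_comm, mul_assoc]
    at l1 l2 l3 J' ⊢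
  rcases 𝔤.not_good.mp hxy with h1 | ⟨rfl, h1⟩ <;> rcases 𝔤.not_good.mp hyz with h2 | ⟨rfl, h2⟩
  -- For `x > y > z` the five other arrangements all precede `x y z`. Both reductions are sorted
  -- down to `z y x`, and their difference is the Jacobi identity.
  · have p1 : Prec (a ++ y :: x :: z :: b) (a ++ x :: y :: z :: b) := prec_swap h1 a (z :: b)
    have p2 : Prec (a ++ x :: z :: y :: b) (a ++ x :: y :: z :: b) := by
      simpa using prec_swap h2 (a ++ [x]) b
    have p3 : Prec (a ++ y :: z :: x :: b) (a ++ x :: y :: z :: b) :=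
      Prec.trans (by simpa using prec_swap (h2.trans h1) (a ++ [y]) b) p1
    have p4 : Prec (a ++ z :: x :: y :: b) (a ++ x :: y :: z :: b) :=
      Prec.trans (by simpa using prec_swap (h2.trans h1) a (y :: b)) p2
    have p5 : Prec (a ++ z :: y :: x :: b) (a ++ x :: y :: z :: b) :=
      Prec.trans (by simpa using prec_swap h1 (a ++ [z]) b) p4
    have e1 := commutator_mem_below (𝔤 := 𝔤) (B := B) (χ := χ) (a ++ [y]) x z b
      (by simpa using p1) (by simpa using p3)
    have e2 := commutator_mem_below (𝔤 := 𝔤) (B := B) (χ := χ) a y z (x :: b) p3 p5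
    have e3 := commutator_mem_below (𝔤 := 𝔤) (B := B) (χ := χ) (a ++ [z]) x y b
      (by simpa using p4) (by simpa using p5)
    have e4 := commutator_mem_below (𝔤 := 𝔤) (B := B) (χ := χ) a x z (y :: b) p2 p4
    have D := add_mem (add_mem (sub_mem (sub_mem
      (add_mem (Submodule.smul_mem _ (𝔤.eps x y) e1)
        (Submodule.smul_mem _ (𝔤.eps x y * 𝔤.eps x z) e2))
      (Submodule.smul_mem _ (𝔤.eps y z) e4))
      (Submodule.smul_mem _ (𝔤.eps y z * 𝔤.eps x z) e3)) (sub_mem l1 l2))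
      (Submodule.smul_mem _ (𝔤.eps x y) l3)
    convert D using 1
    simp only [repl, if_pos h1, if_pos h2, wd_append, wd_cons, wd_nil, mul_one, mul_add, add_mul,
      mul_sub, sub_mul, smul_mul_assoc, mul_smul_comm, mul_assoc]
    rcases 𝔤.eps_eq x y with h | h <;> rcases 𝔤.eps_eq x z with h' | h' <;>
    rcases 𝔤.eps_eq y z with h'' | h'' <;> simp only [h, h', h''] at J' ⊢ <;>
    linear_combination (norm := module) (1 : ℂ) • J'
  · have p1 : Prec (a ++ y :: x :: y :: b) (a ++ x :: y :: y :: b) := prec_swap h1 a (y :: b)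
    have p2 : Prec (a ++ y :: y :: x :: b) (a ++ x :: y :: y :: b) :=
      Prec.trans (by simpa using prec_swap h1 (a ++ [y]) b) p1
    have e1 := commutator_mem_below (𝔤 := 𝔤) (B := B) (χ := χ) (a ++ [y]) x y b
      (by simpa using p1) (by simpa using p2)
    have e2 := commutator_mem_below (𝔤 := 𝔤) (B := B) (χ := χ) a y y (x :: b) p2 p2
    have D := add_mem (add_mem (Submodule.smul_mem _ (𝔤.eps x y) e1)
      (Submodule.smul_mem _ (1 / 2 : ℂ) (sub_mem (add_mem e2 l1) l2)))
      (Submodule.smul_mem _ (1 / 2 * 𝔤.eps x y : ℂ) l3)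
    convert D using 1
    simp only [repl, if_pos h1, if_neg (lt_irrefl y), wd_append, wd_cons, wd_nil, mul_one, mul_add,
      add_mul, mul_sub, sub_mul, smul_mul_assoc, mul_smul_comm, mul_assoc]
    rcases 𝔤.eps_eq x y with h' | h' <;> simp only [h2, h'] at J' ⊢ <;>
    linear_combination (norm := module) (1 / 2 : ℂ) • J'
  · have p1 : Prec (a ++ x :: z :: x :: b) (a ++ x :: x :: z :: b) := by
      simpa using prec_swap h2 (a ++ [x]) b
    have p2 : Prec (a ++ z :: x :: x :: b) (a ++ x :: x :: z :: b) :=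
      (prec_swap h2 a (x :: b)).trans p1
    have e1 := commutator_mem_below (𝔤 := 𝔤) (B := B) (χ := χ) a x z (x :: b) p1 p2
    have e2 := commutator_mem_below (𝔤 := 𝔤) (B := B) (χ := χ) (a ++ [z]) x x b
      (by simpa using p2) (by simpa using p2)
    have D := sub_mem (sub_mem (sub_mem (Submodule.smul_mem _ (1 / 2 : ℂ) l1)
      (Submodule.smul_mem _ (1 / 2 : ℂ) e2)) (Submodule.smul_mem _ (𝔤.eps x z) e1)) l3
    convert D using 1
    simp only [repl, if_neg (lt_irrefl x), if_pos h2, wd_append, wd_cons, wd_nil, mul_one, mul_add,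
      add_mul, mul_sub, sub_mul, smul_mul_assoc, mul_smul_comm, mul_assoc]
    rcases 𝔤.eps_eq x z with h' | h' <;> simp only [h1, h'] at J' ⊢ <;>
    linear_combination (norm := module) (1 / 2 : ℂ) • J'
  -- For a cubed odd letter the claim is that $\frac12([x,x]x-x[x,x])$ is below. Since
  -- $[[x,x],x]-2[x,[x,x]]=0$ by Jacobi, `l1 - 2 • l2` is three times the commutator, whence
  -- $1/6=\frac12\cdot\frac13$.
  · have D := Submodule.smul_mem _ (1 / 6 : ℂ) (sub_mem l1 (Submodule.smul_mem _ (2 : ℂ) l2))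
    convert D using 1
    simp only [repl, if_neg (lt_irrefl x), smul_mul_assoc, mul_smul_comm]
    simp only [h1] at J' ⊢
    linear_combination (norm := module) (1 / 6 : ℂ) • J'

/-- Resolution of the ambiguity between an inadmissible pair and the last letter. -/
theorem overlap_last_mem_below (hχ : IsCharacter 𝔤 B χ) (a : List X) {x y : X}
    (hxy : ¬ 𝔤.Good x y) (hy : y ∈ B) :
    wd ι a * 𝔤.repl ι x y - χ y • (wd ι a * ι x) ∈ below 𝔤 B χ (a ++ [x, y]) := by
  -- An inadmissible pair has `y ≤ x`, so an upper set containing the last letter contains both. The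
  -- subalgebra and its character can then resolve the ambiguity.
  have hx : x ∈ B := by
    rcases 𝔤.not_good.mp hxy with h | ⟨rfl, h⟩
    · exact hχ.upper y hy x h.le
    · exact hy
  have hbr : wd ι a * Finsupp.linearCombination ℂ ι (𝔤.br x y) -
      Finsupp.linearCombination ℂ χ (𝔤.br x y) • wd ι a ∈ below 𝔤 B χ (a ++ [x, y]) := by
    rw [Finsupp.linearCombination_apply, Finsupp.linearCombination_apply, Finsupp.sum, Finsupp.sum,
      Finset.mul_sum, Finset.sum_smul, ← Finset.sum_sub_distrib]
    refine Submodule.sum_mem _ fun s hs => ?_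
    rw [mul_smul_comm, smul_assoc, ← smul_sub]
    exact Submodule.smul_mem _ _
      (last_mem_below a (hχ.closed x hx y hy s hs) (prec_of_length (by simp)))
  rw [hχ.map_br x hx y hy] at hbr
  have ex := last_mem_below (𝔤 := 𝔤) (χ := χ) (w := a ++ [x, y]) a hx (prec_of_length (by simp))
  rcases 𝔤.not_good.mp hxy with h | ⟨rfl, h⟩
  · have ey := last_mem_below (𝔤 := 𝔤) (χ := χ) (w := a ++ [x, y]) a hy (prec_of_length (by simp))
    have eyx := last_mem_below (𝔤 := 𝔤) (χ := χ) (w := a ++ [x, y]) (a ++ [y]) hx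
      (by simpa using prec_swap h a [])
    have D := add_mem hbr (sub_mem (Submodule.smul_mem _ (𝔤.eps x y)
      (add_mem eyx (Submodule.smul_mem _ (χ x) ey))) (Submodule.smul_mem _ (χ y) ex))
    convert D using 1
    simp only [repl, if_pos h, wd_append, wd_cons, wd_nil, mul_one, mul_add, mul_smul_comm,
      mul_assoc]
    module
  · have D := sub_mem (Submodule.smul_mem _ (1 / 2 : ℂ) hbr) (Submodule.smul_mem _ (χ x) ex)
    convert D using 1
    simp only [repl, if_neg (lt_irrefl x), mul_smul_comm, h]
    module

/-- Resolution of the ambiguity between two disjoint inadmissible pairs. -/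
theorem disjoint_mem_below (a : List X) {x y : X} (m : List X) {z t : X} (b : List X)
    (hxy : ¬ 𝔤.Good x y) (hzt : ¬ 𝔤.Good z t) :
    wd ι a * 𝔤.repl ι x y * wd ι (m ++ z :: t :: b) -
      wd ι (a ++ x :: y :: m) * 𝔤.repl ι z t * wd ι b ∈
      below 𝔤 B χ (a ++ x :: y :: (m ++ z :: t :: b)) := by
  -- With $r,r'$ the two replacements and the context suppressed,
  -- $r\,(zt)-(xy)\,r'=r\,(zt-r')-(xy-r)\,r'$. In each product one pair has already been replaced,
  -- so the words involved precede the original.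
  have h1 : wd ι a * 𝔤.repl ι x y * (wd ι m * (ι z * ι t - 𝔤.repl ι z t) * wd ι b) ∈
      below 𝔤 B χ (a ++ x :: y :: (m ++ z :: t :: b)) := by
    let φ := LinearMap.mulRight ℂ ((ι z * ι t - 𝔤.repl ι z t) * wd ι b)
    have := repl_mem (𝔤 := 𝔤) ι (Submodule.comap φ (below 𝔤 B χ (a ++ x :: y :: (m ++ z :: t :: b))))
      a m hxy (fun h => ?_) (fun s _ => ?_)
    · simpa [φ, mul_assoc] using this
    · simp only [φ, Submodule.mem_comap, LinearMap.mulRight_apply, ← mul_assoc]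
      exact pair_mem_below _ b hzt (by simpa using h.append a (m ++ z :: t :: b))
    · simp only [φ, Submodule.mem_comap, LinearMap.mulRight_apply, ← mul_assoc]
      exact pair_mem_below _ b hzt (prec_of_length (by simp))
  have h2 : wd ι a * (ι x * ι y - 𝔤.repl ι x y) * (wd ι m * 𝔤.repl ι z t * wd ι b) ∈
      below 𝔤 B χ (a ++ x :: y :: (m ++ z :: t :: b)) := by
    let φ := LinearMap.mulLeft ℂ (wd ι a * (ι x * ι y - 𝔤.repl ι x y))
    have := repl_mem (𝔤 := 𝔤) ι (Submodule.comap φ (below 𝔤 B χ (a ++ x :: y :: (m ++ z :: t :: b))))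
      m b hzt (fun h => ?_) (fun s _ => ?_)
    · simpa [φ, mul_assoc] using this
    · simp only [φ, Submodule.mem_comap, LinearMap.mulLeft_apply]
      exact pair_mem_below _ _ hxy (by simpa using h.append (a ++ x :: y :: m) b)
    · simp only [φ, Submodule.mem_comap, LinearMap.mulLeft_apply]
      exact pair_mem_below _ _ hxy (prec_of_length (by simp))
  convert sub_mem h1 h2 using 1
  simp only [wd_append, wd_cons, mul_sub, sub_mul, mul_assoc]
  abel

/-- Resolution of the ambiguity between an inadmissible pair and a later last letter. -/
theorem disjoint_last_mem_below (a : List X) {x y : X} (m : List X) {z : X}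
    (hxy : ¬ 𝔤.Good x y) (hz : z ∈ B) :
    wd ι a * 𝔤.repl ι x y * wd ι (m ++ [z]) - χ z • wd ι (a ++ x :: y :: m) ∈
      below 𝔤 B χ (a ++ x :: y :: (m ++ [z])) := by
  have h1 : wd ι a * 𝔤.repl ι x y * (wd ι m * ι z - χ z • wd ι m) ∈
      below 𝔤 B χ (a ++ x :: y :: (m ++ [z])) := by
    let φ := LinearMap.mulRight ℂ (ι z) - χ z • LinearMap.id
    have := repl_mem (𝔤 := 𝔤) ι (Submodule.comap φ (below 𝔤 B χ (a ++ x :: y :: (m ++ [z]))))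
      a m hxy (fun h => ?_) (fun s _ => ?_)
    · simpa [φ, mul_assoc, mul_sub] using this
    · exact last_mem_below _ hz (by simpa using h.append a (m ++ [z]))
    · exact last_mem_below _ hz (prec_of_length (by simp))
  have h2 := Submodule.smul_mem _ (χ z) (pair_mem_below (𝔤 := 𝔤) (B := B) (χ := χ)
    (w := a ++ x :: y :: (m ++ [z])) a m hxy (prec_of_length (by simp)))
  convert sub_mem h1 h2 using 1
  simp only [wd_append, wd_cons, wd_nil, mul_one, mul_sub, sub_mul, mul_assoc, mul_smul_comm]
  module

/-- The word `c` is the offset between the two pairs: empty means the same pair, one letter an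
overlap, two or more letters disjoint pairs. -/
theorem rule_pair_pair {a a' : List X} {x y x' y' : X} {b b' : List X} (c : List X)
    (hxy : ¬ 𝔤.Good x y) (hxy' : ¬ 𝔤.Good x' y') (ha : a' = a ++ c)
    (h : x :: y :: b = c ++ x' :: y' :: b') :
    wd ι a * 𝔤.repl ι x y * wd ι b - wd ι a' * 𝔤.repl ι x' y' * wd ι b' ∈
      below 𝔤 B χ (a ++ x :: y :: b) := by
  subst ha
  rcases c with - | ⟨p, - | ⟨q, c⟩⟩
  · simp only [List.nil_append, List.cons.injEq] at h
    obtain ⟨rfl, rfl, rfl⟩ := h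
    simp
  · simp only [List.cons_append, List.nil_append, List.cons.injEq] at h
    obtain ⟨rfl, rfl, rfl⟩ := h
    simpa using overlap_mem_below a b' hxy hxy'
  · simp only [List.cons_append, List.cons.injEq] at h
    obtain ⟨rfl, rfl, rfl⟩ := h
    exact disjoint_mem_below a c b' hxy hxy'

theorem rule_pair_last (hχ : IsCharacter 𝔤 B χ) {a a' : List X} {x y z : X} {b : List X}
    (hxy : ¬ 𝔤.Good x y) (hz : z ∈ B) (h : a ++ x :: y :: b = a' ++ [z]) :
    wd ι a * 𝔤.repl ι x y * wd ι b - χ z • wd ι a' ∈ below 𝔤 B χ (a ++ x :: y :: b) := by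
  rcases List.eq_nil_or_concat b with rfl | ⟨m, t, rfl⟩
  · have : a ++ x :: y :: [] = (a ++ [x]) ++ [y] := by simp
    rw [this] at h
    obtain ⟨rfl, h2⟩ := List.append_inj' h rfl
    obtain rfl : y = z := by simpa using h2
    simpa using overlap_last_mem_below hχ a hxy hz
  · rw [List.concat_eq_append] at h ⊢
    have : a ++ x :: y :: (m ++ [t]) = (a ++ x :: y :: m) ++ [t] := by simp
    rw [this] at h
    obtain ⟨rfl, h2⟩ := List.append_inj' h rfl
    obtain rfl : t = z := by simpa using h2
    exact disjoint_last_mem_below a m hxy hz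

theorem rule_confluent (hχ : IsCharacter 𝔤 B χ) (w : List X) (m m' : FreeAlgebra ℂ X)
    (h : Rule 𝔤 B χ w m) (h' : Rule 𝔤 B χ w m') : m - m' ∈ below 𝔤 B χ w := by
  rcases rule_iff.mp h with ⟨a, x, y, b, hxy, rfl, rfl⟩ | ⟨a, z, hz, rfl, rfl⟩ <;>
  rcases rule_iff.mp h' with ⟨a', x', y', b', hxy', hw, rfl⟩ | ⟨a', z', hz', hw, rfl⟩
  · rcases List.append_eq_append_iff.mp hw with ⟨c, hc, hc'⟩ | ⟨c, hc, hc'⟩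
    · exact rule_pair_pair c hxy hxy' hc hc'
    · rw [hw, ← neg_sub, neg_mem_iff]
      exact rule_pair_pair c hxy' hxy hc hc'
  · exact rule_pair_last hχ hxy hz' hw
  · rw [hw, ← neg_sub, neg_mem_iff]
    exact rule_pair_last hχ hxy' hz hw.symm
  · obtain ⟨rfl, h2⟩ := List.append_inj' hw rfl
    obtain rfl : z = z' := by simpa using h2
    simp

/-- The basis of the free algebra consisting of words. -/
noncomputable def wordBasis (X : Type) : Module.Basis (List X) ℂ (FreeAlgebra ℂ X) :=
  (FreeAlgebra.basisFreeMonoid ℂ X).reindex FreeMonoid.toList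

omit [LinearOrder X] in
theorem wordBasis_apply (w : List X) : wordBasis X w = wd ι w := by
  simp only [wordBasis, Module.Basis.coe_reindex, Function.comp_apply, FreeAlgebra.basisFreeMonoid,
    Module.Basis.map_apply, Finsupp.coe_basisSingleOne]
  simp [FreeAlgebra.equivMonoidAlgebraFreeMonoid, wd]

/-- The normal form in the induced module: a linear map on the free algebra which respects the
commutation relations and the character, and fixes the normal words without letters in `B`. -/
theorem exists_pbw_normalForm (hχ : IsCharacter 𝔤 B χ) :
    ∃ NF : FreeAlgebra ℂ X →ₗ[ℂ] (List X →₀ ℂ),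
      (∀ a x y b, NF (wd ι a * (ι x * ι y - 𝔤.eps x y • (ι y * ι x) -
        Finsupp.linearCombination ℂ ι (𝔤.br x y)) * wd ι b) = 0) ∧
      (∀ a, ∀ x ∈ B, NF (wd ι a * ι x) = χ x • NF (wd ι a)) ∧
      ∀ w, 𝔤.Normal w → (∀ x ∈ w, x ∉ B) → NF (wd ι w) = Finsupp.single w 1 := by
  obtain ⟨NF, h1, h2⟩ := exists_normalForm (wordBasis X) (Prec.wf (X := X)) (Rule 𝔤 B χ)
    (by
      rintro _ _ (⟨a, x, y, b, h⟩ | ⟨a, x, h⟩)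
      · refine repl_mem _ _ a b h (fun h' => ?_) (fun s _ => ?_)
        · refine Submodule.subset_span ⟨_, ?_, wordBasis_apply _⟩
          simpa using h'.append a b
        · exact Submodule.subset_span ⟨_, prec_of_length (by simp), wordBasis_apply _⟩
      · exact Submodule.smul_mem _ _
          (Submodule.subset_span ⟨_, prec_of_length (by simp), wordBasis_apply _⟩))
    (by
      intro w m m' h h'
      simpa only [wordBasis_apply, below] using rule_confluent hχ w m m' h h')
  simp only [wordBasis_apply] at h1 h2
  refine ⟨NF, ?_, ?_, ?_⟩
  · intro a x y b
    -- Any sufficiently large bound on the words would do; one extra letter puts both arrangements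
    -- below it by length.
    have hle : below 𝔤 B χ (x :: (a ++ x :: y :: b)) ≤ LinearMap.ker NF := by
      rw [below, Submodule.span_le]
      rintro _ ⟨u, n, -, hn, rfl⟩
      simp [h1 u n hn]
    exact hle (commutator_mem_below a x y b (prec_of_length (by simp)) (prec_of_length (by simp)))
  · intro a x hx
    have := h1 _ _ (.last a x hx)
    simpa using this
  · intro w hw hB
    refine h2 w fun m hm => ?_
    rcases rule_iff.mp hm with ⟨a, x, y, b, hxy, rfl, -⟩ | ⟨a, x, hx, rfl, -⟩
    · refine hxy ?_
      simp only [Normal, List.pairwise_append, List.pairwise_cons] at hw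
      exact hw.2.1.1 y (by simp)
    · exact hB x (by simp) hx

end ColourBracket

/-! ### The Ramond algebra as a colour Lie algebra -/

/-- The commutation sign of two generators. -/
def Gen.eps : Gen → Gen → ℂ
  | .G _, .G _ => -1
  | .F, .G _ => -1
  | .G _, .F => -1
  | _, _ => 1

/-- The bracket of two generators. -/
noncomputable def Gen.br : Gen → Gen → Gen →₀ ℂ
  | .L m, .L n => Finsupp.single (.L (m + n)) ((m : ℂ) - n) +
      Finsupp.single .C (if m + n = 0 then ((m : ℂ) ^ 3 - m) / 12 else 0)
  | .L m, .G n => Finsupp.single (.G (m + n)) ((m : ℂ) / 2 - n)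
  | .G n, .L m => Finsupp.single (.G (m + n)) (n - (m : ℂ) / 2)
  | .G m, .G n => Finsupp.single (.L (m + n)) 2 +
      Finsupp.single .C (if m + n = 0 then ((m : ℂ) ^ 2 - 1 / 4) / 3 else 0)
  | _, _ => 0

theorem single_alternating_eq_zero {s : Gen} {x x' x'' : ℂ} (h : x - x' + x'' = 0) :
    Finsupp.single s x - Finsupp.single s x' + Finsupp.single s x'' = 0 := by
  rw [← Finsupp.single_sub, ← Finsupp.single_add, h, Finsupp.single_zero]

theorem single_add_single_alternating_eq_zero {s t : Gen} {x x' x'' y y' y'' : ℂ}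
    (h : x - x' + x'' = 0) (h' : y - y' + y'' = 0) :
    Finsupp.single s x + Finsupp.single t y - (Finsupp.single s x' + Finsupp.single t y') +
      (Finsupp.single s x'' + Finsupp.single t y'') = 0 := by
  rw [add_sub_add_comm, add_add_add_comm, single_alternating_eq_zero h,
    single_alternating_eq_zero h', add_zero]

-- Both sides of each case are combinations of one mode of total index and possibly $C$, so the
-- identity is one or two polynomial identities in the indices. The central one matters only when
-- the total index is zero.
set_option linter.unusedSimpArgs false in
theorem Gen.br_jacobi (x y z : Gen) :
    Finsupp.linearCombination ℂ (fun s => Gen.br s z) (Gen.br x y)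
    - Finsupp.linearCombination ℂ (fun s => Gen.br x s) (Gen.br y z)
    + Gen.eps x y • Finsupp.linearCombination ℂ (fun s => Gen.br y s) (Gen.br x z) = 0 := by
  rcases x with m | m | _ | _ <;> rcases y with n | n | _ | _ <;> rcases z with k | k | _ | _ <;>
    simp only [map_zero, Gen.br, Gen.eps, map_add, Finsupp.linearCombination_single, smul_zero,
      add_zero, sub_zero, smul_add, Finsupp.smul_single, smul_eq_mul]
  all_goals
    -- All total indices are brought to one form, so that the three terms sit on the same basis
    -- elements.
    have e1 : n + (m + k) = m + n + k := by ring
    have e2 : n + (k + m) = m + n + k := by ring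
    have e3 : m + (n + k) = m + n + k := by ring
    have e4 : m + (k + n) = m + n + k := by ring
    have e5 : k + (m + n) = m + n + k := by ring
    have e6 : k + (n + m) = m + n + k := by ring
    have e7 : m + k + n = m + n + k := by ring
    have e8 : n + k + m = m + n + k := by ring
    have e9 : n + m + k = m + n + k := by ring
    simp only [e1, e2, e3, e4, e5, e6, e7, e8, e9]
    first
      | with_reducible refine single_alternating_eq_zero ?_
        push_cast
        ring
      | with_reducible refine single_add_single_alternating_eq_zero ?_ ?_
        · push_cast
          ring
        · by_cases h : m + n + k = 0
          · have hk : (k : ℂ) = -m - n := by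
              have := congrArg (Int.cast (R := ℂ)) h
              push_cast at this
              linear_combination this
            simp only [if_pos h]
            push_cast
            rw [hk]
            ring
          · simp only [if_neg h]
            ring

/-- The Ramond algebra, extended by the parity operator, as a colour Lie algebra. -/
noncomputable def ramondBracket : ColourBracket Gen where
  eps := Gen.eps
  br := Gen.br
  eps_eq := by rintro (_ | _ | _ | _) (_ | _ | _ | _) <;> simp [Gen.eps]
  eps_symm := by rintro (_ | _ | _ | _) (_ | _ | _ | _) <;> rfl
  br_symm := by
    rintro (m | m | _ | _) (n | n | _ | _) <;>
      simp only [Gen.eps, Gen.br, smul_zero, smul_add, Finsupp.smul_single, smul_eq_mul]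
    · rw [add_comm n m]
      by_cases h : m + n = 0
      · obtain rfl : n = -m := by omega
        simp only [if_pos h]
        push_cast
        congr 2 <;> ring
      · simp only [if_neg h, mul_zero]
        congr 2; ring
    · congr 1; ring
    · congr 1; ring
    · rw [add_comm n m]
      by_cases h : m + n = 0
      · obtain rfl : n = -m := by omega
        simp only [if_pos h]
        push_cast
        congr 2 <;> ring
      · simp only [if_neg h, mul_zero]
        congr 2; ring
  eps_br := by
    classical
    intro x y z s hs
    -- Signs are a bicharacter of a grading: a bracket contains $L$ or $C$ only when the two signs
    -- cancel, and $G$ only when their product is the sign of $G$.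
    have key : (∃ m, s = .L m ∧ Gen.eps x z * Gen.eps y z = 1) ∨
        (∃ m, s = .G m ∧ Gen.eps x z * Gen.eps y z = Gen.eps (.G 0) z) ∨
        (s = .C ∧ Gen.eps x z * Gen.eps y z = 1) := by
      rcases x with m | m | _ | _ <;> rcases y with n | n | _ | _ <;> simp only [Gen.br] at hs
      all_goals first
        | simp at hs; done
        | rcases Finset.mem_union.mp (Finsupp.support_add hs) with h | h <;>
          have := Finsupp.support_single_subset h <;> simp only [Finset.mem_singleton] at this <;>
          subst this <;> rcases z with _ | _ | _ | _ <;> simp [Gen.eps]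
        | have := Finsupp.support_single_subset hs
          simp only [Finset.mem_singleton] at this
          subst this; rcases z with _ | _ | _ | _ <;> simp [Gen.eps]
    rcases key with ⟨m, rfl, h⟩ | ⟨m, rfl, h⟩ | ⟨rfl, h⟩ <;> rw [h] <;>
      rcases z with _ | _ | _ | _ <;> rfl
  jacobi := Gen.br_jacobi

/-- The presentation lists each relation in one order of its two generators only; the opposite
orders follow from the symmetry of signs and brackets. -/
theorem respects_toU : ramondBracket.Respects toU := by
  have rel : ∀ {a b}, Rel a b → RingQuot.mkAlgHom ℂ Rel a = RingQuot.mkAlgHom ℂ Rel b :=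
    fun h => RingQuot.mkAlgHom_rel ℂ h
  have LG : ∀ m n, toU (.L m) * toU (.G n) - toU (.G n) * toU (.L m) =
      ((m : ℂ) / 2 - n) • toU (.G (m + n)) := fun m n => by
    simpa only [toU, map_sub, map_mul, map_smul] using rel (Rel.LG m n)
  have LC : ∀ m, toU (.L m) * toU .C = toU .C * toU (.L m) := fun m => by
    simpa only [toU, map_mul] using rel (Rel.LC m)
  have GC : ∀ m, toU (.G m) * toU .C = toU .C * toU (.G m) := fun m => by
    simpa only [toU, map_mul] using rel (Rel.GC m)
  have FL : ∀ m, toU .F * toU (.L m) = toU (.L m) * toU .F := fun m => by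
    simpa only [toU, map_mul] using rel (Rel.FL m)
  have FC : toU .F * toU .C = toU .C * toU .F := by
    simpa only [toU, map_mul] using rel Rel.FC
  have FG : ∀ m, toU .F * toU (.G m) + toU (.G m) * toU .F = 0 := fun m => by
    simpa only [toU, map_mul, map_add, map_zero] using rel (Rel.FG m)
  have GG : ∀ m n, toU (.G m) * toU (.G n) + toU (.G n) * toU (.G m) = (2 : ℂ) • toU (.L (m + n)) +
      (if m + n = 0 then ((m : ℂ) ^ 2 - 1 / 4) / 3 else 0) • toU .C := fun m n => by
    simpa only [toU, map_sub, map_mul, map_smul, map_add] using rel (Rel.GG m n)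
  rintro (m | m | _ | _) (n | n | _ | _) <;>
    simp only [ramondBracket, Gen.eps, Gen.br, one_smul, map_zero, map_add,
      Finsupp.linearCombination_single]
  · simpa only [toU, map_sub, map_mul, map_smul, map_add] using rel (Rel.LL m n)
  · exact LG m n
  · rw [LC, sub_self]
  · rw [FL, sub_self]
  · have := LG n m
    linear_combination (norm := module) (-1 : ℂ) • this
  · rw [← GG]
    module
  · rw [GC, sub_self]
  · linear_combination (norm := module) FG m
  · rw [LC, sub_self]
  · rw [GC, sub_self]
  · rw [sub_self]
  · rw [FC, sub_self]
  · rw [FL, sub_self]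
  · linear_combination (norm := module) FG n
  · rw [FC, sub_self]
  · rw [sub_self]

/-- The position of a generator in the ordering of the letters of a standard monomial. -/
def Gen.key : Gen → ℕ ×ₗ ℤ
  -- Classes 0 to 4 follow the factors of a standard monomial from left to right. The letters acting
  -- by scalars come last, from class 5 on, or from class 4 on when $G_0$ is one of them, so they
  -- form an upper set.
  | .L m => if m ≤ -2 then toLex (0, m) else if m = -1 then toLex (2, 0) else toLex (5, m)
  | .G m => if m ≤ -2 then toLex (1, m) else if m = -1 then toLex (3, 0) else
      if m = 0 then toLex (4, 0) else toLex (6, m)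
  | .C => toLex (7, 0)
  | .F => toLex (8, 0)

theorem Gen.key_injective : Function.Injective Gen.key := by
  intro x y h
  rcases x with m | m | _ | _ <;> rcases y with n | n | _ | _ <;> simp only [Gen.key] at h <;>
    (try split_ifs at h) <;> simp_all

noncomputable instance : LinearOrder Gen := LinearOrder.lift' Gen.key Gen.key_injective

theorem Gen.lt_iff {x y : Gen} : x < y ↔ (ofLex x.key).1 < (ofLex y.key).1 ∨
    (ofLex x.key).1 = (ofLex y.key).1 ∧ (ofLex x.key).2 < (ofLex y.key).2 := by
  change x.key < y.key ↔ _
  exact Prod.Lex.lt_iff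

open ColourBracket

theorem exists_factor {A B C : Type*} [AddCommGroup A] [Module ℂ A] [AddCommGroup B] [Module ℂ B]
    [AddCommGroup C] [Module ℂ C] (f : A →ₗ[ℂ] B) (hf : Function.Surjective f) (g : A →ₗ[ℂ] C)
    (h : ∀ x, f x = 0 → g x = 0) : ∃ t : B →ₗ[ℂ] C, ∀ x, t (f x) = g x := by
  obtain ⟨s, hs⟩ := f.exists_rightInverse_of_surjective (LinearMap.range_eq_top.mpr hf)
  refine ⟨g ∘ₗ s, fun x => ?_⟩
  rw [← sub_eq_zero, LinearMap.comp_apply, ← map_sub]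
  refine h _ ?_
  rw [map_sub, ← LinearMap.comp_apply, hs, LinearMap.id_apply, sub_self]

/-- Here `f` is only linear, so the universal property does not apply to it directly. Let `J` be the
largest left ideal in its kernel. Related elements act equally on `A ⧸ J`, so the quotient ring acts
there; an element that is zero in the quotient kills the class of $1$ and thus lies in `J`. -/
theorem exists_factor_ringQuot {A V : Type*} [Ring A] [Algebra ℂ A] [AddCommGroup V] [Module ℂ V]
    (r : A → A → Prop) (f : A →ₗ[ℂ] V) (h : ∀ p q, r p q → ∀ a b, f (a * (p - q) * b) = 0) :
    ∃ t : RingQuot r →ₗ[ℂ] V, ∀ a, t (RingQuot.mkAlgHom ℂ r a) = f a := by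
  obtain ⟨J, hJ⟩ : ∃ J : Submodule A A, ∀ p, p ∈ J ↔ ∀ a, f (a * p) = 0 :=
    ⟨{ carrier := {p | ∀ a, f (a * p) = 0}
       zero_mem' := by simp
       add_mem' := fun {p q} hp hq a => by rw [mul_add, map_add, hp a, hq a, add_zero]
       smul_mem' := fun r p hp a => by rw [smul_eq_mul, ← mul_assoc]; exact hp (a * r) },
      fun _ => Iff.rfl⟩
  have hφ : ∀ p q, r p q → Algebra.lsmul ℂ ℂ (A ⧸ J) p = Algebra.lsmul ℂ ℂ (A ⧸ J) q := by
    intro p q hpq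
    refine LinearMap.ext fun t => ?_
    obtain ⟨t, rfl⟩ := Submodule.Quotient.mk_surjective J t
    simp only [Algebra.lsmul_coe]
    rw [← Submodule.Quotient.mk_smul,
      ← Submodule.Quotient.mk_smul, Submodule.Quotient.eq, hJ]
    intro a
    rw [smul_eq_mul, smul_eq_mul, ← sub_mul, ← mul_assoc]
    exact h p q hpq a t
  refine exists_factor (RingQuot.mkAlgHom ℂ r).toLinearMap (RingQuot.mkAlgHom_surjective ℂ r) f ?_
  intro p hp
  have e := RingQuot.liftAlgHom_mkAlgHom_apply ℂ (Algebra.lsmul ℂ ℂ (A ⧸ J)) hφ p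
  rw [show RingQuot.mkAlgHom ℂ r p = 0 from hp, map_zero] at e
  have h4 := LinearMap.congr_fun e.symm (Submodule.Quotient.mk 1)
  simp only [Algebra.lsmul_coe, LinearMap.zero_apply] at h4
  rw [← Submodule.Quotient.mk_smul,
    Submodule.Quotient.mk_eq_zero, hJ] at h4
  simpa using h4 1

theorem map_wd (w : List Gen) : RingQuot.mkAlgHom ℂ Rel (wd (FreeAlgebra.ι ℂ) w) = wd toU w := by
  induction w with
  | nil => simp
  | cons x w ih => simp [ih, toU]

theorem linearMap_mul_eq_zero {V : Type*} [AddCommGroup V] [Module ℂ V]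
    (f : FreeAlgebra ℂ Gen →ₗ[ℂ] V) (r : FreeAlgebra ℂ Gen)
    (h : ∀ a b, f (wd (FreeAlgebra.ι ℂ) a * r * wd (FreeAlgebra.ι ℂ) b) = 0)
    (p q : FreeAlgebra ℂ Gen) : f (p * r * q) = 0 := by
  have h1 : ∀ a q, f (wd (FreeAlgebra.ι ℂ) a * r * q) = 0 := by
    intro a q
    have : f ∘ₗ LinearMap.mulLeft ℂ (wd (FreeAlgebra.ι ℂ) a * r) = 0 :=
      (wordBasis Gen).ext fun b => by simpa [wordBasis_apply, mul_assoc] using h a b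
    exact LinearMap.congr_fun this q
  have : f ∘ₗ LinearMap.mulRight ℂ (r * q) = 0 :=
    (wordBasis Gen).ext fun a => by simpa [wordBasis_apply, mul_assoc] using h1 a q
  simpa [mul_assoc] using LinearMap.congr_fun this p

theorem rel_eq_commutator {p q : FreeAlgebra ℂ Gen} (h : Rel p q) : ∃ x y, p - q =
    FreeAlgebra.ι ℂ x * FreeAlgebra.ι ℂ y - ramondBracket.eps x y • (FreeAlgebra.ι ℂ y * FreeAlgebra.ι ℂ x) -
      Finsupp.linearCombination ℂ (FreeAlgebra.ι ℂ) (ramondBracket.br x y) := by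
  rcases h with ⟨m, n⟩ | ⟨m, n⟩ | ⟨m, n⟩ | m | m | m | _ | m
  · exact ⟨.L m, .L n, by simp [ramondBracket, Gen.eps, Gen.br, sub_smul]⟩
  · exact ⟨.L m, .G n, by simp [ramondBracket, Gen.eps, Gen.br, sub_smul]⟩
  · exact ⟨.G m, .G n, by simp [ramondBracket, Gen.eps, Gen.br]⟩
  · exact ⟨.L m, .C, by simp [ramondBracket, Gen.eps, Gen.br]⟩
  · exact ⟨.G m, .C, by simp [ramondBracket, Gen.eps, Gen.br]⟩
  · exact ⟨.F, .L m, by simp [ramondBracket, Gen.eps, Gen.br]⟩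
  · exact ⟨.F, .C, by simp [ramondBracket, Gen.eps, Gen.br]⟩
  · exact ⟨.F, .G m, by simp [ramondBracket, Gen.eps, Gen.br]⟩

/-- The normal form on the enveloping algebra modulo the left ideal of a character. -/
theorem exists_normalForm_U {B : Set Gen} {χ : Gen → ℂ} (hχ : IsCharacter ramondBracket B χ) :
    ∃ T : U →ₗ[ℂ] (List Gen →₀ ℂ),
      (∀ w, ramondBracket.Normal w → (∀ x ∈ w, x ∉ B) → T (wd toU w) = Finsupp.single w 1) ∧
      ∀ u, ∀ x ∈ B, T (u * (toU x - algebraMap ℂ U (χ x))) = 0 := by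
  obtain ⟨NF, h1, h2, h3⟩ := exists_pbw_normalForm hχ
  obtain ⟨T, hT⟩ := exists_factor_ringQuot Rel NF fun p q hpq a b => by
    obtain ⟨x, y, hxy⟩ := rel_eq_commutator hpq
    rw [hxy]
    exact linearMap_mul_eq_zero NF _ (fun a b => h1 a x y b) a b
  refine ⟨T, ?_, ?_⟩
  · intro w hw hB
    rw [← map_wd, ← h3 w hw hB]
    exact hT _
  · intro u x hx
    obtain ⟨a, rfl⟩ := RingQuot.mkAlgHom_surjective ℂ Rel u
    have h5 : ∀ a, NF (a * (FreeAlgebra.ι ℂ x - algebraMap ℂ _ (χ x))) = 0 := by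
      intro a
      have : NF ∘ₗ LinearMap.mulRight ℂ (FreeAlgebra.ι ℂ x - algebraMap ℂ _ (χ x)) = 0 :=
        (wordBasis Gen).ext fun a => by
          simp only [LinearMap.comp_apply, LinearMap.mulRight_apply, wordBasis_apply, mul_sub,
            map_sub, h2 a x hx, ← Algebra.commutes (χ x), ← Algebra.smul_def, map_smul, sub_self,
            LinearMap.zero_apply]
      exact LinearMap.congr_fun this a
    rw [← h5 a, ← hT]
    simp [toU]

/-! ### Highest weights -/

/-- The generators acting by scalars on a highest weight vector; the modes `G_m` act by scalars
for `m ≥ e`. -/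
def hwSet (e : ℤ) : Set Gen := {x | match x with
  | .L m => 0 ≤ m
  | .G m => e ≤ m
  | .C => True
  | .F => True}

/-- The eigenvalues of the generators on a highest weight vector. -/
def weight (c Δ : ℂ) : Gen → ℂ
  | .L m => if m = 0 then Δ else 0
  | .G _ => 0
  | .C => c
  | .F => 1

/-- The only delicate value is on $\{G_0,G_0\}=2L_0-C/12$, which must be $2\Delta-c/12=0$. It arises
only for `e = 0`, and there $\Delta=c/24$. -/
theorem isCharacter_weight {c Δ : ℂ} {e : ℤ} (he : e = 1 ∨ e = 0 ∧ Δ = c / 24) :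
    IsCharacter ramondBracket (hwSet e) (weight c Δ) := by
  have he' : 0 ≤ e ∧ e ≤ 1 := by omega
  refine ⟨?_, ?_, ?_⟩
  · intro x hx y hxy
    by_contra hy
    refine absurd hxy (not_le.mpr (Gen.lt_iff.mpr ?_))
    rcases x with m | m | _ | _ <;> rcases y with n | n | _ | _ <;>
      simp only [hwSet, Set.mem_ofPred_eq, not_true_eq_false] at hx hy <;>
      simp only [Gen.key] <;> split_ifs <;> simp <;> omega
  · classical
    intro x hx y hy s hs
    rcases x with m | m | _ | _ <;> rcases y with n | n | _ | _ <;>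
      simp only [ramondBracket, Gen.br] at hs
    all_goals first
      | simp at hs; done
      | rcases Finset.mem_union.mp (Finsupp.support_add hs) with h | h <;>
        have := Finsupp.support_single_subset h <;> simp only [Finset.mem_singleton] at this <;>
        subst this <;> simp only [hwSet, Set.mem_ofPred_eq] at * <;> omega
      | have := Finsupp.support_single_subset hs
        simp only [Finset.mem_singleton] at this
        subst this; simp only [hwSet, Set.mem_ofPred_eq] at *; omega
  · intro x hx y hy
    rcases x with m | m | _ | _ <;> rcases y with n | n | _ | _ <;>
      simp only [ramondBracket, Gen.br, Gen.eps, map_add, Finsupp.linearCombination_single, weight,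
        smul_eq_mul, mul_zero, zero_mul, sub_self, map_zero]
    · simp only [hwSet, Set.mem_ofPred_eq] at hx hy
      by_cases h : m + n = 0
      · obtain rfl : m = 0 := by omega
        obtain rfl : n = 0 := by omega
        simp
      · simp [h]
    · simp only [hwSet, Set.mem_ofPred_eq] at hx hy
      by_cases h : m + n = 0
      · obtain rfl : m = 0 := by omega
        obtain rfl : n = 0 := by omega
        obtain ⟨-, rfl⟩ : e = 0 ∧ Δ = c / 24 := by
          rcases he with h | h
          · omega
          · exact h
        simp
        ring
      · simp [h]

/-! ### Standard monomials as normal words -/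

namespace Mono

/-- The part of the word of a monomial with letters of index at most `-2`. -/
def headWord (ls gs : List ℕ) : List Gen :=
  ls.reverse.map (fun m : ℕ => Gen.L (-(m : ℤ))) ++ gs.reverse.map (fun k : ℕ => Gen.G (-(k : ℤ)))

/-- The part of the word of a monomial with letters of index at least `-1`. -/
def tailWord (n : ℕ) (r₁ r₂ : Fin 2) : List Gen :=
  List.replicate n (Gen.L (-1)) ++ List.replicate r₁ (Gen.G (-1)) ++ List.replicate r₂ (Gen.G 0)

/-- The word of a monomial. -/
def word (X : Mono) : List Gen := headWord X.ls X.gs ++ tailWord X.n X.r₁ X.r₂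

theorem wd_word (X : Mono) : wd Ramond.toU X.word = X.toU := by
  simp only [word, headWord, tailWord, wd, Mono.toU, List.map_append, List.prod_append,
    List.map_replicate, List.prod_replicate, List.map_map, mul_assoc, List.bind_eq_flatMap,
    List.pure_def, ← List.map_eq_flatMap]
  rfl

end Mono

/-- The generators of index at most `-2`. -/
def lowSet : Set Gen := {x | match x with
  | .L m => m ≤ -2
  | .G m => m ≤ -2
  | .C => False
  | .F => False}

theorem Gen.good_cls {x y : Gen} (h : ramondBracket.Good x y) :
    (ofLex x.key).1 ≤ (ofLex y.key).1 := by
  rcases h with h | ⟨rfl, -⟩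
  · rcases Gen.lt_iff.mp h with h | h
    · exact h.le
    · exact h.1.le
  · exact le_rfl

theorem Gen.cls_of_mem_lowSet {x : Gen} (h : x ∈ lowSet) : (ofLex x.key).1 ≤ 1 := by
  rcases x with m | m | _ | _ <;> simp only [lowSet, Set.mem_ofPred_eq] at h <;>
    simp only [Gen.key, if_pos h] <;> simp

theorem Gen.key_L {a : ℕ} (ha : 2 ≤ a) : (Gen.L (-(a : ℤ))).key = toLex (0, -(a : ℤ)) := by
  rw [Gen.key, if_pos (by omega)]

theorem Gen.key_G {a : ℕ} (ha : 2 ≤ a) : (Gen.G (-(a : ℤ))).key = toLex (1, -(a : ℤ)) := by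
  rw [Gen.key, if_pos (by omega)]

theorem Gen.good_L_L {a b : ℕ} (ha : 2 ≤ a) (hb : 2 ≤ b) :
    ramondBracket.Good (.L (-(a : ℤ))) (.L (-(b : ℤ))) ↔ b ≤ a := by
  simp only [Good, Gen.lt_iff, Gen.key_L ha, Gen.key_L hb, ramondBracket, Gen.eps,
    Gen.L.injEq, ofLex_toLex, and_true, true_and, lt_self_iff_false, false_or]
  omega

theorem Gen.good_G_G {a b : ℕ} (ha : 2 ≤ a) (hb : 2 ≤ b) :
    ramondBracket.Good (.G (-(a : ℤ))) (.G (-(b : ℤ))) ↔ b < a := by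
  simp only [Good, Gen.lt_iff, Gen.key_G ha, Gen.key_G hb, ramondBracket, Gen.eps,
    Gen.G.injEq, ofLex_toLex]
  norm_num

theorem Gen.good_L_G {a b : ℕ} (ha : 2 ≤ a) (hb : 2 ≤ b) :
    ramondBracket.Good (.L (-(a : ℤ))) (.G (-(b : ℤ))) := by
  left
  simp [Gen.lt_iff, Gen.key_L ha, Gen.key_G hb]

theorem Gen.not_good_G_L {a b : ℕ} (ha : 2 ≤ a) (hb : 2 ≤ b) :
    ¬ ramondBracket.Good (.G (-(a : ℤ))) (.L (-(b : ℤ))) := by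
  intro h
  have := Gen.good_cls h
  simp [Gen.key_G ha, Gen.key_L hb] at this

/-- Among low letters no $G$ may precede an $L$. A repeated $L$ is admissible and a repeated $G$ is
not, which gives the weak and the strict inequalities of a standard monomial. -/
theorem exists_eq_headWord (u : List Gen) (hu : ramondBracket.Normal u) (hK : ∀ x ∈ u, x ∈ lowSet) :
    ∃ X : Mono, X.n = 0 ∧ X.r₁ = 0 ∧ X.r₂ = 0 ∧ u = Mono.headWord X.ls X.gs := by
  induction u with
  | nil => exact ⟨Mono.pure 0 0 0, rfl, rfl, rfl, rfl⟩
  | cons x u ih =>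
    rw [ColourBracket.Normal, List.pairwise_cons] at hu
    obtain ⟨X, h1, h2, h3, rfl⟩ := ih hu.2 fun y hy => hK y (by simp [hy])
    have hx := hK x (by simp)
    rcases x with m | m | _ | _ <;> simp only [lowSet, Set.mem_ofPred_eq] at hx
    · obtain ⟨a, rfl⟩ : ∃ a : ℕ, m = -(a : ℤ) := ⟨m.natAbs, by omega⟩
      have ha : 2 ≤ a := by omega
      refine ⟨⟨X.ls ++ [a], X.gs, X.n, X.r₁, X.r₂, ?_, ?_, X.gs_sorted, X.gs_two_le⟩, h1, h2, h3, ?_⟩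
      · rw [List.pairwise_append]
        refine ⟨X.ls_sorted, List.pairwise_singleton _ _, fun b hb c hc => ?_⟩
        rw [List.mem_singleton.mp hc]
        refine (Gen.good_L_L ha (X.ls_two_le b hb)).mp (hu.1 _ ?_)
        exact List.mem_append_left _ (List.mem_map.mpr ⟨b, by simpa using hb, rfl⟩)
      · simp only [List.mem_append, List.mem_singleton]
        rintro b (hb | rfl)
        · exact X.ls_two_le b hb
        · exact ha
      · simp [Mono.headWord]
    · obtain ⟨a, rfl⟩ : ∃ a : ℕ, m = -(a : ℤ) := ⟨m.natAbs, by omega⟩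
      have ha : 2 ≤ a := by omega
      have hls : X.ls = [] := by
        refine List.eq_nil_iff_forall_not_mem.mpr fun b hb => ?_
        refine Gen.not_good_G_L ha (X.ls_two_le b hb) (hu.1 _ ?_)
        exact List.mem_append_left _ (List.mem_map.mpr ⟨b, by simpa using hb, rfl⟩)
      refine ⟨⟨[], X.gs ++ [a], X.n, X.r₁, X.r₂, by simp, by simp, ?_, ?_⟩, h1, h2, h3, ?_⟩
      · rw [List.pairwise_append]
        refine ⟨X.gs_sorted, List.pairwise_singleton _ _, fun b hb c hc => ?_⟩
        rw [List.mem_singleton.mp hc]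
        refine (Gen.good_G_G ha (X.gs_two_le b hb)).mp (hu.1 _ ?_)
        exact List.mem_append_right _ (List.mem_map.mpr ⟨b, by simpa using hb, rfl⟩)
      · simp only [List.mem_append, List.mem_singleton]
        rintro b (hb | rfl)
        · exact X.gs_two_le b hb
        · exact ha
      · simp [Mono.headWord, hls]

theorem exists_eq_append_tailWord (w : List Gen) (hw : ramondBracket.Normal w)
    (hB : ∀ x ∈ w, x ∉ hwSet 1) :
    ∃ u n r₁ r₂, w = u ++ Mono.tailWord n r₁ r₂ ∧ ∀ x ∈ u, x ∈ lowSet := by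
  induction w with
  | nil => exact ⟨[], 0, 0, 0, rfl, by simp⟩
  | cons x w ih =>
    rw [ColourBracket.Normal, List.pairwise_cons] at hw
    obtain ⟨u, n, r₁, r₂, rfl, hu⟩ := ih hw.2 fun y hy => hB y (by simp [hy])
    have hx := hB x (by simp)
    by_cases hxl : x ∈ lowSet
    · refine ⟨x :: u, n, r₁, r₂, rfl, ?_⟩
      simp only [List.mem_cons]
      rintro y (rfl | hy)
      · exact hxl
      · exact hu y hy
    -- A letter that is neither low nor in `hwSet 1` is $L_{-1}$, $G_{-1}$ or $G_0$. It belongs to a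
    -- later class than any low letter, so no low letter may follow it.
    have hx1 : 1 < (ofLex x.key).1 := by
      rcases x with m | m | _ | _ <;> simp only [lowSet, Set.mem_ofPred_eq] at hxl <;>
        simp only [Gen.key] <;> (try split_ifs) <;> simp_all
    have hu0 : u = [] := by
      refine List.eq_nil_iff_forall_not_mem.mpr fun y hy => ?_
      have h1 := Gen.good_cls (hw.1 y (by simp [hy]))
      have h2 := Gen.cls_of_mem_lowSet (hu y hy)
      omega
    subst hu0
    have hgood : ∀ y ∈ Mono.tailWord n r₁ r₂, ramondBracket.Good x y := by simpa using hw.1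
    have hn : x = .G (-1) ∨ x = .G 0 → n = 0 := by
      intro h
      by_contra hn
      have := Gen.good_cls (hgood (.L (-1)) (by simp [Mono.tailWord, hn]))
      rcases h with rfl | rfl <;> simp [Gen.key] at this
    have hr₁ : x = .G (-1) ∨ x = .G 0 → r₁ = 0 := by
      intro h
      by_contra hn
      have hr : (r₁ : ℕ) ≠ 0 := fun h => hn (Fin.ext h)
      have := hgood (.G (-1)) (by simp [Mono.tailWord, hr])
      rcases h with rfl | rfl
      · rcases this with h | ⟨-, h⟩
        · exact absurd h (lt_irrefl _)
        · norm_num [ramondBracket, Gen.eps] at h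
      · have := Gen.good_cls this
        simp [Gen.key] at this
    have hr₂ : x = .G 0 → r₂ = 0 := by
      rintro rfl
      by_contra hn
      have hr : (r₂ : ℕ) ≠ 0 := fun h => hn (Fin.ext h)
      rcases hgood (.G 0) (by simp [Mono.tailWord, hr]) with h | ⟨-, h⟩
      · exact absurd h (lt_irrefl _)
      · norm_num [ramondBracket, Gen.eps] at h
    rcases x with m | m | _ | _ <;>
      simp only [lowSet, hwSet, Set.mem_ofPred_eq, not_true_eq_false] at hx hxl
    · obtain rfl : m = -1 := by omega
      exact ⟨[], n + 1, r₁, r₂, by simp [Mono.tailWord, List.replicate_succ], by simp⟩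
    · obtain rfl | rfl : m = -1 ∨ m = 0 := by omega
      · rw [hn (by simp), hr₁ (by simp)]
        exact ⟨[], 0, 1, r₂, by simp [Mono.tailWord], by simp⟩
      · rw [hn (by simp), hr₁ (by simp), hr₂ rfl]
        exact ⟨[], 0, 0, 1, by simp [Mono.tailWord], by simp⟩

theorem exists_word_eq (w : List Gen) (hw : ramondBracket.Normal w)
    (hB : ∀ x ∈ w, x ∉ hwSet 1) : ∃ X : Mono, X.word = w := by
  obtain ⟨u, n, r₁, r₂, rfl, hu⟩ := exists_eq_append_tailWord w hw hB
  obtain ⟨X, -, -, -, rfl⟩ := exists_eq_headWord u (List.pairwise_append.mp hw).1 hu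
  exact ⟨⟨X.ls, X.gs, n, r₁, r₂, X.ls_sorted, X.ls_two_le, X.gs_sorted, X.gs_two_le⟩, rfl⟩

namespace Mono

theorem mem_headWord {X : Mono} {x : Gen} (h : x ∈ headWord X.ls X.gs) : x ∈ lowSet := by
  simp only [headWord, List.mem_append, List.mem_map, List.mem_reverse] at h
  rcases h with ⟨a, ha, rfl⟩ | ⟨a, ha, rfl⟩
  · have := X.ls_two_le a ha
    simp only [lowSet, Set.mem_ofPred_eq]
    omega
  · have := X.gs_two_le a ha
    simp only [lowSet, Set.mem_ofPred_eq]
    omega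

theorem mem_tailWord {n : ℕ} {r₁ r₂ : Fin 2} {x : Gen} (h : x ∈ tailWord n r₁ r₂) :
    x = .L (-1) ∨ x = .G (-1) ∨ (x = .G 0 ∧ r₂ = 1) := by
  simp only [tailWord, List.mem_append, List.mem_replicate] at h
  rcases h with (h | h) | h
  · exact Or.inl h.2
  · exact Or.inr (Or.inl h.2)
  · exact Or.inr (Or.inr ⟨h.2, by omega⟩)

theorem normal_word (X : Mono) : ramondBracket.Normal X.word := by
  have lt : ∀ x y : Gen, (ofLex x.key).1 < (ofLex y.key).1 → ramondBracket.Good x y :=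
    fun x y h => Or.inl (Gen.lt_iff.mpr (Or.inl h))
  have G1 : ∀ (r : Fin 2) x, (List.replicate r x).Pairwise ramondBracket.Good := by
    intro r x
    fin_cases r <;> simp
  rw [ColourBracket.Normal, word, List.pairwise_append]
  refine ⟨?_, ?_, ?_⟩
  · rw [headWord, List.pairwise_append]
    refine ⟨?_, ?_, ?_⟩
    · rw [List.pairwise_map, List.pairwise_reverse]
      exact X.ls_sorted.imp_of_mem fun ha hb h =>
        (Gen.good_L_L (X.ls_two_le _ hb) (X.ls_two_le _ ha)).mpr h
    · rw [List.pairwise_map, List.pairwise_reverse]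
      exact X.gs_sorted.imp_of_mem fun ha hb h =>
        (Gen.good_G_G (X.gs_two_le _ hb) (X.gs_two_le _ ha)).mpr h
    · simp only [List.mem_map, List.mem_reverse]
      rintro _ ⟨a, ha, rfl⟩ _ ⟨b, hb, rfl⟩
      exact Gen.good_L_G (X.ls_two_le _ ha) (X.gs_two_le _ hb)
  · rw [tailWord, List.pairwise_append, List.pairwise_append]
    refine ⟨⟨?_, G1 _ _, ?_⟩, G1 _ _, ?_⟩
    · rw [List.pairwise_replicate]
      exact Or.inr (Or.inr ⟨rfl, rfl⟩)
    · simp only [List.mem_replicate]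
      rintro _ ⟨-, rfl⟩ _ ⟨-, rfl⟩
      exact lt _ _ (by simp [Gen.key])
    · simp only [List.mem_append, List.mem_replicate]
      rintro _ (⟨-, rfl⟩ | ⟨-, rfl⟩) _ ⟨-, rfl⟩ <;> exact lt _ _ (by simp [Gen.key])
  · intro x hx y hy
    have := Gen.cls_of_mem_lowSet (mem_headWord hx)
    refine lt _ _ (this.trans_lt ?_)
    rcases mem_tailWord hy with rfl | rfl | ⟨rfl, -⟩ <;> simp [Gen.key]

theorem notMem_hwSet (X : Mono) {e : ℤ} (he : e = 1 ∨ e = 0 ∧ X.r₂ = 0) :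
    ∀ x ∈ X.word, x ∉ hwSet e := by
  intro x hx
  rcases List.mem_append.mp hx with h | h
  · have := mem_headWord h
    rcases x with m | m | _ | _ <;> simp only [lowSet, hwSet, Set.mem_ofPred_eq] at * <;> omega
  · rcases mem_tailWord h with rfl | rfl | ⟨rfl, h⟩ <;> simp only [hwSet, Set.mem_ofPred_eq] <;>
      omega

theorem filterMap_word_L (X : Mono) : X.word.filterMap (fun x => match x with
    | .L m => if m ≤ -2 then some m.natAbs else none
    | _ => none) = X.ls.reverse := by
  have h : ∀ l : List ℕ, (∀ a ∈ l, 2 ≤ a) → l.filterMap (fun a : ℕ =>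
      if -(a : ℤ) ≤ -2 then some (-(a : ℤ)).natAbs else none) = l := by
    intro l hl
    induction l with
    | nil => rfl
    | cons a l ih =>
      rw [List.filterMap_cons, if_pos (by have := hl a (by simp); omega),
        ih fun b hb => hl b (by simp [hb])]
      simp
  simp only [word, headWord, tailWord, List.filterMap_append, List.filterMap_map,
    List.filterMap_replicate, Function.comp_def]
  rw [h _ fun a ha => X.ls_two_le a (by simpa using ha)]
  simp

theorem filterMap_word_G (X : Mono) : X.word.filterMap (fun x => match x with
    | .G m => if m ≤ -2 then some m.natAbs else none
    | _ => none) = X.gs.reverse := by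
  have h : ∀ l : List ℕ, (∀ a ∈ l, 2 ≤ a) → l.filterMap (fun a : ℕ =>
      if -(a : ℤ) ≤ -2 then some (-(a : ℤ)).natAbs else none) = l := by
    intro l hl
    induction l with
    | nil => rfl
    | cons a l ih =>
      rw [List.filterMap_cons, if_pos (by have := hl a (by simp); omega),
        ih fun b hb => hl b (by simp [hb])]
      simp
  simp only [word, headWord, tailWord, List.filterMap_append, List.filterMap_map,
    List.filterMap_replicate, Function.comp_def]
  rw [h _ fun a ha => X.gs_two_le a (by simpa using ha)]
  simp

/-- The two index lists are read back by filtering the word, and the exponents by counting letters.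
-/
theorem word_injective : Function.Injective word := by
  intro X Y h
  have hls : X.ls = Y.ls := by
    rw [← List.reverse_inj, ← filterMap_word_L, ← filterMap_word_L, h]
  have hgs : X.gs = Y.gs := by
    rw [← List.reverse_inj, ← filterMap_word_G, ← filterMap_word_G, h]
  have ht : tailWord X.n X.r₁ X.r₂ = tailWord Y.n Y.r₁ Y.r₂ := by
    rw [word, word, hls, hgs] at h
    exact List.append_cancel_left h
  have hn := congrArg (List.count (Gen.L (-1))) ht
  have hr₁ := congrArg (List.count (Gen.G (-1))) ht
  have hr₂ := congrArg (List.count (Gen.G 0)) ht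
  simp [tailWord, List.count_replicate, Fin.val_inj] at hn hr₁ hr₂
  exact Mono.ext hls hgs hn hr₁ hr₂

end Mono

/-! ### Verma modules as induced modules and their standard bases -/

/-- The left ideal of relations of a highest weight vector. -/
noncomputable def hwIdeal (c Δ : ℂ) (e : ℤ) : Submodule U U :=
  Submodule.span U {z | ∃ x ∈ hwSet e, z = toU x - algebraMap ℂ U (weight c Δ x)}

theorem toU_sub_weight_mem (c Δ : ℂ) {e : ℤ} {x : Gen} (h : x ∈ hwSet e) :
    toU x - algebraMap ℂ U (weight c Δ x) ∈ hwIdeal c Δ e :=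
  Submodule.subset_span ⟨x, h, rfl⟩

theorem mem_of_mem_positive (I : Submodule U U) (h : ∀ m : ℤ, 1 ≤ m → L m ∈ I ∧ G m ∈ I) {z : U}
    (hz : z ∈ positive) : z ∈ I := by
  have : positive ≤ I.restrictScalars ℂ := by
    rw [positive, Submodule.span_le]
    rintro _ ⟨m, hm, rfl | rfl⟩
    · exact (h m hm).1
    · exact (h m hm).2
  exact this hz

theorem L_mem_hwIdeal (c Δ : ℂ) (e m : ℤ) (hm : 1 ≤ m) : L m ∈ hwIdeal c Δ e := by
  have := toU_sub_weight_mem c Δ (e := e) (x := .L m) (by simp only [hwSet, Set.mem_ofPred_eq]; omega)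
  simpa [weight, L, show m ≠ 0 by omega] using this

theorem G_mem_hwIdeal (c Δ : ℂ) (e m : ℤ) (hm : e ≤ m) : G m ∈ hwIdeal c Δ e := by
  have := toU_sub_weight_mem c Δ (e := e) (x := .G m) hm
  simpa [weight, G] using this

theorem vermaIdeal_eq (c Δ : ℂ) : vermaIdeal c Δ = hwIdeal c Δ 1 := by
  apply le_antisymm
  · rw [vermaIdeal, Submodule.span_le]
    rintro z (hz | rfl | rfl | rfl)
    · exact mem_of_mem_positive _ (fun m hm => ⟨L_mem_hwIdeal _ _ _ m hm, G_mem_hwIdeal _ _ _ m hm⟩) hz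
    · simpa [weight, L] using toU_sub_weight_mem c Δ (e := 1) (x := .L 0) (le_refl (0 : ℤ))
    · exact toU_sub_weight_mem c Δ (e := 1) (x := .C) trivial
    · simpa [weight, F] using toU_sub_weight_mem c Δ (e := 1) (x := .F) trivial
  · rw [hwIdeal, Submodule.span_le]
    have hp : ∀ z ∈ positive, z ∈ vermaIdeal c Δ := fun z hz => Submodule.subset_span (Or.inl hz)
    rintro _ ⟨m | m | _ | _, h, rfl⟩
    · rcases eq_or_ne m 0 with rfl | hm
      · refine Submodule.subset_span (Or.inr (Or.inl ?_))
        simp [weight, L]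
      · have : 0 ≤ m := h
        simp only [weight, if_neg hm, map_zero, sub_zero]
        exact hp _ (Submodule.subset_span ⟨m, by omega, Or.inl rfl⟩)
    · simp only [weight, map_zero, sub_zero]
      exact hp _ (Submodule.subset_span ⟨m, h, Or.inr rfl⟩)
    · exact Submodule.subset_span (Or.inr (Or.inr (Or.inl rfl)))
    · refine Submodule.subset_span (Or.inr (Or.inr (Or.inr ?_)))
      simp [weight, F]

theorem vermaIdealG_eq (c : ℂ) : vermaIdealG c = hwIdeal c (c / 24) 0 := by
  apply le_antisymm
  · rw [vermaIdealG, Submodule.span_le]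
    rintro z (hz | rfl | rfl | rfl)
    · have : positiveG ≤ (hwIdeal c (c / 24) 0).restrictScalars ℂ := by
        refine sup_le (fun z hz => ?_) ?_
        · exact mem_of_mem_positive _ (fun m hm =>
            ⟨L_mem_hwIdeal _ _ _ m hm, G_mem_hwIdeal _ _ _ m (by omega)⟩) hz
        · rw [Submodule.span_singleton_le_iff_mem]
          exact G_mem_hwIdeal _ _ _ 0 le_rfl
      exact this hz
    · simpa [weight, L] using toU_sub_weight_mem c (c / 24) (e := 0) (x := .L 0) (le_refl (0 : ℤ))
    · exact toU_sub_weight_mem c (c / 24) (e := 0) (x := .C) trivial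
    · simpa [weight, F] using toU_sub_weight_mem c (c / 24) (e := 0) (x := .F) trivial
  · rw [hwIdeal, Submodule.span_le]
    have hp : ∀ z ∈ positiveG, z ∈ vermaIdealG c := fun z hz => Submodule.subset_span (Or.inl hz)
    have hp' : ∀ z ∈ positive, z ∈ vermaIdealG c := fun z hz => hp z (Submodule.mem_sup_left hz)
    rintro _ ⟨m | m | _ | _, h, rfl⟩
    · rcases eq_or_ne m 0 with rfl | hm
      · refine Submodule.subset_span (Or.inr (Or.inl ?_))
        simp [weight, L]
      · have : 0 ≤ m := h
        simp only [weight, if_neg hm, map_zero, sub_zero]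
        exact hp' _ (Submodule.subset_span ⟨m, by omega, Or.inl rfl⟩)
    · simp only [weight, map_zero, sub_zero]
      have h' : 0 ≤ m := h
      rcases eq_or_ne m 0 with rfl | hm
      · exact hp _ (Submodule.mem_sup_right (Submodule.mem_span_singleton_self _))
      · exact hp' _ (Submodule.subset_span ⟨m, by omega, Or.inr rfl⟩)
    · exact Submodule.subset_span (Or.inr (Or.inr (Or.inl rfl)))
    · refine Submodule.subset_span (Or.inr (Or.inr (Or.inr ?_)))
      simp [weight, F]

theorem span_range_wd_toU : Submodule.span ℂ (Set.range (wd toU)) = ⊤ := by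
  rw [eq_top_iff]
  intro u _
  obtain ⟨a, rfl⟩ := RingQuot.mkAlgHom_surjective ℂ Rel u
  have h : ⊤ ≤ (Submodule.span ℂ (Set.range (wd toU))).comap
      (RingQuot.mkAlgHom ℂ Rel).toLinearMap := by
    rw [← (wordBasis Gen).span_eq, Submodule.span_le]
    rintro _ ⟨w, rfl⟩
    rw [wordBasis_apply]
    refine Submodule.subset_span ⟨w, (map_wd w).symm⟩
  exact h trivial

/-- The normal form kills the left ideal, hence descends to the module, where it sends the standard
vectors to distinct basis elements of a free module. -/
theorem linearIndependent_mono {c Δ : ℂ} {e : ℤ} (he : e = 1 ∨ e = 0 ∧ Δ = c / 24)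
    {I : Submodule U U} (hI : I = hwIdeal c Δ e) {κ : Type} (f : κ → Mono)
    (hf : Function.Injective f) (hr : ∀ i, e = 1 ∨ e = 0 ∧ (f i).r₂ = 0) :
    LinearIndependent ℂ fun i => (f i).toU • (Submodule.Quotient.mk 1 : U ⧸ I) := by
  obtain ⟨T, h1, h2⟩ := exists_normalForm_U (isCharacter_weight he)
  have hT : ∀ z ∈ I, T z = 0 := by
    intro z hz
    have : ∀ u, T (u * z) = 0 := by
      rw [hI, hwIdeal] at hz
      induction hz using Submodule.span_induction with
      | mem z hz =>
        obtain ⟨x, hx, rfl⟩ := hz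
        exact fun u => h2 u x hx
      | zero => simp
      | add z z' _ _ h h' => intro u; rw [mul_add, map_add, h, h', add_zero]
      | smul r z _ h => intro u; rw [smul_eq_mul, ← mul_assoc]; exact h _
    simpa using this 1
  obtain ⟨t, ht⟩ := exists_factor (I.mkQ.restrictScalars ℂ) I.mkQ_surjective T
    (fun x hx => hT x ((Submodule.Quotient.mk_eq_zero I).mp hx))
  refine LinearIndependent.of_comp t ?_
  have e1 : (t ∘ fun i => (f i).toU • (Submodule.Quotient.mk 1 : U ⧸ I)) =
      fun i => Finsupp.single (f i).word (1 : ℂ) := by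
    funext i
    have := ht (f i).toU
    rw [← Mono.wd_word, h1 _ (f i).normal_word ((f i).notMem_hwSet (hr i))] at this
    rw [← this, Function.comp_apply, ← Submodule.Quotient.mk_smul, smul_eq_mul, mul_one,
      ← Mono.wd_word]
    rfl
  rw [e1]
  exact (Finsupp.basisSingleOne (R := ℂ) (ι := List Gen)).linearIndependent.comp _
    (Mono.word_injective.comp hf) |> fun h => by simpa [Function.comp_def] using h

/-- Rewriting in `U` reduces everything to normal words. If the last letter is in `hwSet e`, it acts
by a scalar and can be dropped; otherwise no letter is in this upper set and the word is that of a
standard monomial. -/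
theorem span_mono {c Δ : ℂ} {e : ℤ} (he : e = 1 ∨ e = 0)
    {I : Submodule U U} (hI : I = hwIdeal c Δ e) {κ : Type} (f : κ → Mono)
    (hr : ∀ X, e = 1 ∨ X.r₂ = 0 → X ∈ Set.range f) :
    ⊤ ≤ Submodule.span ℂ
      (Set.range fun i => (f i).toU • (Submodule.Quotient.mk 1 : U ⧸ I)) := by
  set E := Submodule.span ℂ (Set.range fun i => (f i).toU • (Submodule.Quotient.mk 1 : U ⧸ I))
    with hE
  have hnormal : ∀ w, ramondBracket.Normal w →
      wd toU w • (Submodule.Quotient.mk 1 : U ⧸ I) ∈ E := by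
    intro w
    induction w using List.reverseRecOn with
    | nil =>
      intro _
      obtain ⟨i, hi⟩ := hr (Mono.pure 0 0 0) (Or.inr rfl)
      refine Submodule.subset_span ⟨i, ?_⟩
      simp only [hi, ← Mono.wd_word]
      rfl
    | append_singleton w x ih =>
      intro hw
      by_cases hx : x ∈ hwSet e
      · have h1 : toU x • (Submodule.Quotient.mk 1 : U ⧸ I) =
            weight c Δ x • (Submodule.Quotient.mk 1 : U ⧸ I) := by
          rw [← Submodule.Quotient.mk_smul, ← Submodule.Quotient.mk_smul, Submodule.Quotient.eq, hI,
            smul_eq_mul, mul_one, ← Algebra.algebraMap_eq_smul_one]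
          exact toU_sub_weight_mem c Δ hx
        rw [wd_append, wd_cons, wd_nil, mul_one, mul_smul, h1, smul_comm]
        exact Submodule.smul_mem _ _ (ih (List.pairwise_append.mp hw).1)
      · have hupper : ∀ y ∈ w ++ [x], y ∉ hwSet e := by
          intro y hy hye
          rcases List.mem_append.mp hy with hy | hy
          · have hyx : y ≤ x := by
              rcases (List.pairwise_append.mp hw).2.2 y hy x (by simp) with h | ⟨rfl, -⟩
              · exact h.le
              · exact le_rfl
            -- Only the upper-set property is used, which does not involve the weights; the choice
            -- $c=\Delta=0$ meets $\Delta=c/24$.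
            exact hx ((isCharacter_weight (c := 0) (Δ := 0) (by simpa using he)).upper y hye x hyx)
          · rw [List.mem_singleton.mp hy] at hye
            exact hx hye
        obtain ⟨X, hX⟩ := exists_word_eq (w ++ [x]) hw (by
          intro y hy hye
          refine hupper y hy ?_
          rcases y with m | m | _ | _ <;> simp only [hwSet, Set.mem_ofPred_eq] at * <;> omega)
        obtain ⟨i, hi⟩ := hr X (by
          by_contra! h
          refine hupper (.G 0) ?_ (by simp only [hwSet, Set.mem_ofPred_eq]; omega)
          have : (X.r₂ : ℕ) ≠ 0 := fun h' => h.2 (Fin.ext h')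
          simp [← hX, Mono.word, Mono.tailWord, this])
        refine Submodule.subset_span ⟨i, ?_⟩
        simp only [hi, ← Mono.wd_word, hX]
  intro z _
  obtain ⟨u, rfl⟩ := Submodule.Quotient.mk_surjective I z
  have hu : u ∈ Submodule.span ℂ (Set.range (wd toU)) := by rw [span_range_wd_toU]; trivial
  have : (Submodule.Quotient.mk u : U ⧸ I) = u • Submodule.Quotient.mk 1 := by
    rw [← Submodule.Quotient.mk_smul, smul_eq_mul, mul_one]
  rw [this]
  clear this
  induction hu using Submodule.span_induction with
  | mem u hu =>
    obtain ⟨w, rfl⟩ := hu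
    have hw := respects_toU.wd_mem_span (K := Set.univ) (fun _ _ _ _ _ _ => trivial) w
      (fun _ _ => trivial)
    generalize wd toU w = z at hw ⊢
    induction hw using Submodule.span_induction with
    | mem u hu =>
      obtain ⟨w, hw, rfl⟩ := hu
      exact hnormal w hw.1
    | zero => rw [zero_smul]; exact zero_mem _
    | add u u' _ _ h h' => rw [add_smul]; exact add_mem h h'
    | smul a u _ h => rw [smul_assoc]; exact Submodule.smul_mem _ _ h
  | zero => rw [zero_smul]; exact zero_mem _
  | add u u' _ _ h h' => rw [add_smul]; exact add_mem (h trivial) (h' trivial)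
  | smul a u _ h => rw [smul_assoc]; exact Submodule.smul_mem _ _ (h trivial)

/-- The standard basis of a highest weight module. -/
theorem exists_standard_basis {c Δ : ℂ} {e : ℤ} (he : e = 1 ∨ e = 0 ∧ Δ = c / 24)
    {I : Submodule U U} (hI : I = hwIdeal c Δ e) {κ : Type} (f : κ → Mono)
    (hf : Function.Injective f) (hr : ∀ X, (e = 1 ∨ X.r₂ = 0) ↔ X ∈ Set.range f) :
    ∃ b : Module.Basis κ ℂ (U ⧸ I), ∀ i, b i = (f i).toU • Submodule.Quotient.mk 1 := by
  refine ⟨Module.Basis.mk (linearIndependent_mono he hI f hf fun i => ?_)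
    (span_mono (he.imp_right And.left) hI f fun X => (hr X).mp), fun i => Module.Basis.mk_apply _ _ i⟩
  rcases he with h | h
  · exact Or.inl h
  · rcases (hr (f i)).mpr ⟨i, rfl⟩ with h' | h'
    · omega
    · exact Or.inr ⟨h.1, h'⟩

/-! ### Highest weight vectors -/

section HighestWeight

set_option linter.unusedSectionVars false

variable {M : Type} [AddCommGroup M] [Module ℂ M] [Module U M] [IsScalarTower ℂ U M]

/-- `v` is a highest weight vector of weight `Δ` in a module of central charge `c`. -/
structure IsHighestWeight (c Δ : ℂ) (v : M) : Prop where
  L_smul : ∀ m : ℤ, 1 ≤ m → L m • v = 0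
  G_smul : ∀ m : ℤ, 1 ≤ m → G m • v = 0
  L_zero_smul : L 0 • v = Δ • v
  C_smul : ∀ x : M, C • x = c • x

theorem smul_smul_comm' (u : U) (a : ℂ) (x : M) : u • a • x = a • u • x := smul_comm u a x

theorem commutator_smul (x y : Gen) (z : M) : toU x • toU y • z = Gen.eps x y • toU y • toU x • z +
    (Finsupp.linearCombination ℂ toU (Gen.br x y)) • z := by
  have h : toU x * toU y - Gen.eps x y • (toU y * toU x) =
    Finsupp.linearCombination ℂ toU (Gen.br x y) := respects_toU x y
  rw [← h, sub_smul, smul_assoc, mul_smul, mul_smul]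
  abel

variable {c Δ : ℂ} {v : M} (hv : IsHighestWeight c Δ v)

include hv

theorem IsHighestWeight.LL (m n : ℤ) (x : M) : L m • L n • x = L n • L m • x +
    ((m : ℂ) - n) • L (m + n) • x +
    ((if m + n = 0 then ((m : ℂ) ^ 3 - m) / 12 else 0) * c) • x := by
  have := commutator_smul (.L m) (.L n) x
  simpa only [L, G, Gen.eps, Gen.br, map_add, Finsupp.linearCombination_single, add_smul, smul_assoc,
    one_smul, show toU .C • x = c • x from hv.C_smul x, mul_smul, add_assoc] using this

theorem IsHighestWeight.LG (m n : ℤ) (x : M) : L m • G n • x = G n • L m • x +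
    ((m : ℂ) / 2 - n) • G (m + n) • x := by
  have := commutator_smul (.L m) (.G n) x
  simpa only [L, G, Gen.eps, Gen.br, Finsupp.linearCombination_single, smul_assoc, one_smul] using this

theorem IsHighestWeight.GL (m n : ℤ) (x : M) : G m • L n • x = L n • G m • x +
    ((m : ℂ) - n / 2) • G (n + m) • x := by
  have := commutator_smul (.G m) (.L n) x
  simpa only [L, G, Gen.eps, Gen.br, Finsupp.linearCombination_single, smul_assoc, one_smul] using this

theorem IsHighestWeight.GG (m n : ℤ) (x : M) : G m • G n • x = - G n • G m • x +
    (2 : ℂ) • L (m + n) • x +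
    ((if m + n = 0 then ((m : ℂ) ^ 2 - 1 / 4) / 3 else 0) * c) • x := by
  have := commutator_smul (.G m) (.G n) x
  simpa only [L, G, Gen.eps, Gen.br, map_add, Finsupp.linearCombination_single, add_smul, smul_assoc,
    neg_smul, one_smul, show toU .C • x = c • x from hv.C_smul x, mul_smul, add_assoc] using this

omit hv

/-! ### Filtration by the powers of $L_{-1}$ and $G_{-1}$ -/

variable (v)

/-- The vectors `L_{-1}^n G_{-1}^{r₁} G_0^{r₂} v`. -/
noncomputable def tailVec (n : ℕ) (r₁ r₂ : Fin 2) : M :=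
  wd toU (Mono.tailWord n r₁ r₂) • v

/-- The span of the standard vectors whose powers of `L_{-1}` and `G_{-1}` satisfy a predicate. -/
noncomputable def tailSpan (P : ℕ → Fin 2 → Prop) : Submodule ℂ M :=
  Submodule.span ℂ {z | ∃ X : Mono, P X.n X.r₁ ∧ z = X.toU • v}

theorem tailVec_succ (n : ℕ) (r₁ r₂ : Fin 2) :
    tailVec v (n + 1) r₁ r₂ = L (-1) • tailVec v n r₁ r₂ := by
  simp only [tailVec, Mono.tailWord, List.replicate_succ, List.cons_append, wd_cons, mul_smul]
  rfl

theorem tailVec_zero_zero_zero : tailVec v 0 0 0 = v := by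
  simp [tailVec, Mono.tailWord]

theorem tailVec_zero_zero_one : tailVec v 0 0 1 = G 0 • v := by
  simp [tailVec, Mono.tailWord, G]

theorem tailVec_zero_one (r₂ : Fin 2) : tailVec v 0 1 r₂ = G (-1) • tailVec v 0 0 r₂ := by
  simp [tailVec, Mono.tailWord, G, mul_smul]

theorem toU_smul_eq (X : Mono) :
    X.toU • v = wd toU (Mono.headWord X.ls X.gs) • tailVec v X.n X.r₁ X.r₂ := by
  rw [← Mono.wd_word, Mono.word, wd_append, mul_smul, tailVec]

variable {v}

theorem tailSpan_mono {P Q : ℕ → Fin 2 → Prop} (h : ∀ n r, P n r → Q n r) :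
    tailSpan v P ≤ tailSpan v Q := by
  refine Submodule.span_mono ?_
  rintro _ ⟨X, hX, rfl⟩
  exact ⟨X, h _ _ hX, rfl⟩

/-- Sums of two indices at most $-2$ are at most $-4$, so no central term appears. -/
theorem br_lowSet : ∀ x ∈ lowSet, ∀ y ∈ lowSet, ∀ s ∈ (ramondBracket.br x y).support,
    s ∈ lowSet := by
  classical
  intro x hx y hy s hs
  rcases x with m | m | _ | _ <;> rcases y with n | n | _ | _ <;>
    simp only [lowSet, Set.mem_ofPred_eq] at hx hy <;>
    simp only [ramondBracket, Gen.br] at hs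
  · rw [if_neg (by omega), Finsupp.single_zero, add_zero] at hs
    have := Finsupp.support_single_subset hs
    simp only [Finset.mem_singleton] at this
    subst this
    simp only [lowSet, Set.mem_ofPred_eq]
    omega
  · have := Finsupp.support_single_subset hs
    simp only [Finset.mem_singleton] at this
    subst this
    simp only [lowSet, Set.mem_ofPred_eq]
    omega
  · have := Finsupp.support_single_subset hs
    simp only [Finset.mem_singleton] at this
    subst this
    simp only [lowSet, Set.mem_ofPred_eq]
    omega
  · rw [if_neg (by omega), Finsupp.single_zero, add_zero] at hs
    have := Finsupp.support_single_subset hs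
    simp only [Finset.mem_singleton] at this
    subst this
    simp only [lowSet, Set.mem_ofPred_eq]
    omega

/-- Sorting low letters creates only low letters, so the tail is untouched. Hence their order can be
ignored as long as only the exponents in the tail are recorded. -/
theorem wd_smul_tailVec_mem {P : ℕ → Fin 2 → Prop} {n : ℕ} {r₁ r₂ : Fin 2} (h : P n r₁)
    (u : List Gen) (hu : ∀ x ∈ u, x ∈ lowSet) : wd toU u • tailVec v n r₁ r₂ ∈ tailSpan v P := by
  have hw := respects_toU.wd_mem_span br_lowSet u hu
  generalize wd toU u = z at hw ⊢
  induction hw using Submodule.span_induction with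
  | mem u hu =>
    obtain ⟨w, ⟨hw, hK⟩, rfl⟩ := hu
    obtain ⟨X, -, -, -, rfl⟩ := exists_eq_headWord w hw hK
    refine Submodule.subset_span
      ⟨⟨X.ls, X.gs, n, r₁, r₂, X.ls_sorted, X.ls_two_le, X.gs_sorted, X.gs_two_le⟩, h, ?_⟩
    rw [toU_smul_eq]
  | zero => rw [zero_smul]; exact zero_mem _
  | add u u' _ _ h h' => rw [add_smul]; exact add_mem h h'
  | smul a u _ h => rw [smul_assoc]; exact Submodule.smul_mem _ _ h

theorem tailVec_mem {P : ℕ → Fin 2 → Prop} {n : ℕ} {r₁ r₂ : Fin 2} (h : P n r₁) :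
    tailVec v n r₁ r₂ ∈ tailSpan v P := by
  simpa using wd_smul_tailVec_mem (r₂ := r₂) (v := v) h [] (by simp)

/-- Induction principle for the spans `tailSpan`. -/
theorem tailSpan_induction {P : ℕ → Fin 2 → Prop} (S : Submodule ℂ M)
    (h : ∀ u n r₁ r₂, (∀ x ∈ u, x ∈ lowSet) → P n r₁ → wd toU u • tailVec v n r₁ r₂ ∈ S) :
    tailSpan v P ≤ S := by
  rw [tailSpan, Submodule.span_le]
  rintro _ ⟨X, hX, rfl⟩
  rw [SetLike.mem_coe, toU_smul_eq]
  exact h _ _ _ _ (fun x => Mono.mem_headWord) hX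

theorem low_smul_mem {P : ℕ → Fin 2 → Prop} {x : Gen} (hx : x ∈ lowSet) {z : M}
    (hz : z ∈ tailSpan v P) : toU x • z ∈ tailSpan v P := by
  have : tailSpan v P ≤ (tailSpan v P).comap (Algebra.lsmul ℂ ℂ M (toU x)) := by
    refine tailSpan_induction _ fun u n r₁ r₂ hu h => ?_
    have := wd_smul_tailVec_mem (r₂ := r₂) (v := v) h (x :: u) (by
      simp only [List.mem_cons]
      rintro y (rfl | hy)
      · exact hx
      · exact hu y hy)
    rwa [wd_cons, mul_smul] at this
  exact this hz

theorem L_low_smul_mem {P : ℕ → Fin 2 → Prop} {m : ℤ} (hm : m ≤ -2) {z : M}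
    (hz : z ∈ tailSpan v P) : L m • z ∈ tailSpan v P := low_smul_mem (x := .L m) hm hz

theorem G_low_smul_mem {P : ℕ → Fin 2 → Prop} {m : ℤ} (hm : m ≤ -2) {z : M}
    (hz : z ∈ tailSpan v P) : G m • z ∈ tailSpan v P := low_smul_mem (x := .G m) hm hz

include hv

/-- Commuting $L_{-1}$ with a low letter gives a low letter, so modulo vectors with the old
exponents $L_{-1}$ can be moved straight to the tail. -/
theorem IsHighestWeight.L_neg_one_smul_sub_mem {P : ℕ → Fin 2 → Prop} {n : ℕ} {r₁ r₂ : Fin 2}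
    (h : P n r₁) (u : List Gen) (hu : ∀ x ∈ u, x ∈ lowSet) :
    L (-1) • wd toU u • tailVec v n r₁ r₂ - wd toU u • tailVec v (n + 1) r₁ r₂ ∈
      tailSpan v P := by
  induction u with
  | nil => simp [tailVec_succ]
  | cons x u ih =>
    have hu' : ∀ y ∈ u, y ∈ lowSet := fun y hy => hu y (by simp [hy])
    have hx := hu x (by simp)
    have hz := wd_smul_tailVec_mem (r₂ := r₂) (v := v) h u hu'
    have h1 := low_smul_mem hx (ih hu')
    rw [smul_sub] at h1
    simp only [wd_cons, mul_smul]
    rcases x with m | m | _ | _ <;> simp only [lowSet, Set.mem_ofPred_eq] at hx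
    · have e := hv.LL (-1) m (wd toU u • tailVec v n r₁ r₂)
      rw [if_neg (by omega), zero_mul, zero_smul, add_zero] at e
      change L (-1) • L m • wd toU u • tailVec v n r₁ r₂ -
        L m • wd toU u • tailVec v (n + 1) r₁ r₂ ∈ tailSpan v P
      rw [e, add_sub_right_comm]
      exact add_mem h1 (Submodule.smul_mem _ _ (L_low_smul_mem (by omega) hz))
    · change L (-1) • G m • wd toU u • tailVec v n r₁ r₂ -
        G m • wd toU u • tailVec v (n + 1) r₁ r₂ ∈ tailSpan v P
      rw [hv.LG, add_sub_right_comm]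
      exact add_mem h1 (Submodule.smul_mem _ _ (G_low_smul_mem (by omega) hz))

theorem IsHighestWeight.L_neg_one_smul_mem {P Q : ℕ → Fin 2 → Prop}
    (h : ∀ n r, P n r → Q n r ∧ Q (n + 1) r) {z : M} (hz : z ∈ tailSpan v P) :
    L (-1) • z ∈ tailSpan v Q := by
  have : tailSpan v P ≤ (tailSpan v Q).comap (Algebra.lsmul ℂ ℂ M (L (-1))) := by
    refine tailSpan_induction _ fun u n r₁ r₂ hu hP => ?_
    change L (-1) • wd toU u • tailVec v n r₁ r₂ ∈ tailSpan v Q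
    rw [← sub_add_cancel (L (-1) • wd toU u • tailVec v n r₁ r₂)
      (wd toU u • tailVec v (n + 1) r₁ r₂)]
    exact add_mem (hv.L_neg_one_smul_sub_mem (h n r₁ hP).1 u hu)
      (wd_smul_tailVec_mem (h n r₁ hP).2 u hu)
  exact this hz

theorem IsHighestWeight.G_zero_smul_smul : G 0 • G 0 • v = (Δ - c / 24) • v := by
  have h := hv.GG 0 0 v
  rw [if_pos (by norm_num), neg_smul, add_zero, hv.L_zero_smul] at h
  have h2 : (2 : ℂ) • G 0 • G 0 • v = (2 : ℂ) • (Δ - c / 24) • v := by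
    generalize G 0 • G 0 • v = w at h ⊢
    rw [two_smul]
    nth_rewrite 1 [h]
    push_cast
    module
  exact smul_right_injective M (two_ne_zero) h2

theorem IsHighestWeight.L_pos_smul_tailVec (r₂ : Fin 2) (j : ℤ) (hj : 1 ≤ j) :
    L j • tailVec v 0 0 r₂ = 0 := by
  fin_cases r₂
  · simp only [Fin.zero_eta, tailVec_zero_zero_zero]
    exact hv.L_smul j hj
  · simp only [Fin.mk_one, tailVec_zero_zero_one]
    rw [hv.LG, hv.L_smul j hj, add_zero, hv.G_smul j hj, smul_zero, smul_zero, add_zero]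

theorem IsHighestWeight.G_pos_smul_tailVec (r₂ : Fin 2) (j : ℤ) (hj : 1 ≤ j) :
    G j • tailVec v 0 0 r₂ = 0 := by
  fin_cases r₂
  · simp only [Fin.zero_eta, tailVec_zero_zero_zero]
    exact hv.G_smul j hj
  · simp only [Fin.mk_one, tailVec_zero_zero_one]
    rw [hv.GG, if_neg (by omega), add_zero, hv.L_smul j hj, hv.G_smul j hj]
    simp

theorem IsHighestWeight.L_zero_smul_tailVec (r₂ : Fin 2) :
    L 0 • tailVec v 0 0 r₂ = Δ • tailVec v 0 0 r₂ := by
  fin_cases r₂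
  · simp only [Fin.zero_eta, tailVec_zero_zero_zero]
    exact hv.L_zero_smul
  · simp only [Fin.mk_one, tailVec_zero_zero_one]
    rw [hv.LG, hv.L_zero_smul, smul_smul_comm']
    simp

theorem IsHighestWeight.G_zero_smul_tailVec (r₂ : Fin 2) :
    ∃ a b : ℂ, G 0 • tailVec v 0 0 r₂ = a • tailVec v 0 0 0 + b • tailVec v 0 0 1 := by
  fin_cases r₂
  · exact ⟨0, 1, by simp [tailVec_zero_zero_one, tailVec_zero_zero_zero]⟩
  · refine ⟨Δ - c / 24, 0, ?_⟩
    simp only [Fin.mk_one, tailVec_zero_zero_one, tailVec_zero_zero_zero]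
    rw [hv.G_zero_smul_smul]
    simp

/-- Each commutator of $L_j$ with $L_{-1}$ uses up an $L_{-1}$, and can at best give it back, when
$j=0$. Past $G_{-1}$ it leaves $G_{j-1}$, which creates no $L_{-1}$. -/
theorem IsHighestWeight.L_smul_tailVec_mem (j : ℤ) (hj : j ≠ -1) (n : ℕ) (r₁ r₂ : Fin 2) :
    L j • tailVec v n r₁ r₂ ∈ tailSpan v (fun n' _ => n' ≤ n) := by
  induction n generalizing j with
  | zero =>
    rcases le_or_gt j (-2) with hj2 | hj2
    · exact L_low_smul_mem hj2 (tailVec_mem le_rfl)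
    have hj0 : 0 ≤ j := by omega
    fin_cases r₁
    · simp only [Fin.zero_eta]
      rcases hj0.eq_or_lt with rfl | hj0
      · rw [hv.L_zero_smul_tailVec]
        exact Submodule.smul_mem _ _ (tailVec_mem le_rfl)
      · rw [hv.L_pos_smul_tailVec _ _ hj0]
        exact zero_mem _
    · simp only [Fin.mk_one]
      rw [tailVec_zero_one, hv.LG]
      refine add_mem ?_ (Submodule.smul_mem _ _ ?_)
      · rcases hj0.eq_or_lt with rfl | hj0
        · rw [hv.L_zero_smul_tailVec, smul_smul_comm', ← tailVec_zero_one]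
          exact Submodule.smul_mem _ _ (tailVec_mem le_rfl)
        · rw [hv.L_pos_smul_tailVec _ _ hj0, smul_zero]
          exact zero_mem _
      · obtain rfl | rfl | hj1 : j = 0 ∨ j = 1 ∨ 1 ≤ j + -1 := by omega
        · rw [zero_add (-1 : ℤ), ← tailVec_zero_one]
          exact tailVec_mem le_rfl
        · obtain ⟨a, b, h⟩ := hv.G_zero_smul_tailVec r₂
          rw [show (1 + -1 : ℤ) = 0 by norm_num, h]
          exact add_mem (Submodule.smul_mem _ _ (tailVec_mem le_rfl))
            (Submodule.smul_mem _ _ (tailVec_mem le_rfl))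
        · rw [hv.G_pos_smul_tailVec _ _ hj1]
          exact zero_mem _
  | succ n ih =>
    have hmono : ∀ {z : M}, z ∈ tailSpan v (fun n' _ => n' ≤ n) →
        z ∈ tailSpan v (fun n' _ => n' ≤ n + 1) := fun hz =>
      tailSpan_mono (fun n' _ h => Nat.le_succ_of_le h) hz
    rw [tailVec_succ, hv.LL]
    refine add_mem (add_mem (hv.L_neg_one_smul_mem ?_ (ih j hj)) (Submodule.smul_mem _ _ ?_))
      (Submodule.smul_mem _ _ (hmono (tailVec_mem le_rfl)))
    · intro n' _ h
      constructor <;> omega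
    -- The bracket $[L_0,L_{-1}]$ restores the factor that was split off; every other commutator
    -- falls under the induction hypothesis.
    · by_cases h : j = 0
      · rw [h, zero_add, ← tailVec_succ]
        exact tailVec_mem le_rfl
      · exact hmono (ih _ (by omega))

/-- The powers of `L_{-1}` and `G_{-1}` in the image under a mode `G_j`. -/
def GTail (n : ℕ) (r : Fin 2) (n' : ℕ) (r' : Fin 2) : Prop :=
  n' ≤ n ∨ (n' = n + 1 ∧ r = 1 ∧ r' = 0)

/-- A further $L_{-1}$ can arise only from $\{G_0,G_{-1}\}=2L_{-1}$, which consumes the factor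
$G_{-1}$. -/
theorem IsHighestWeight.G_smul_tailVec_mem (j : ℤ) (n : ℕ) (r₁ r₂ : Fin 2) :
    G j • tailVec v n r₁ r₂ ∈ tailSpan v (GTail n r₁) := by
  induction n generalizing j with
  | zero =>
    rcases le_or_gt j (-2) with hj2 | hj2
    · exact G_low_smul_mem hj2 (tailVec_mem (Or.inl le_rfl))
    obtain rfl | hj0 : j = -1 ∨ 0 ≤ j := by omega
    · fin_cases r₁
      · simp only [Fin.zero_eta]
        rw [← tailVec_zero_one]
        exact tailVec_mem (Or.inl le_rfl)
      · simp only [Fin.mk_one]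
        have h := hv.GG (-1) (-1) (tailVec v 0 0 r₂)
        rw [if_neg (by norm_num), zero_mul, zero_smul, add_zero, neg_smul] at h
        -- This is $G_{-1}^2=L_{-2}$, a low letter.
        have h2 : (2 : ℂ) • G (-1) • G (-1) • tailVec v 0 0 r₂ =
            (2 : ℂ) • L (-1 + -1) • tailVec v 0 0 r₂ := by
          rw [two_smul]
          nth_rewrite 1 [h]
          abel
        rw [tailVec_zero_one, smul_right_injective M two_ne_zero h2]
        exact L_low_smul_mem (by norm_num) (tailVec_mem (Or.inl le_rfl))
    · have h0 : ∀ r₁, G j • tailVec v 0 0 r₂ ∈ tailSpan v (GTail 0 r₁) ∧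
          G (-1) • G j • tailVec v 0 0 r₂ ∈ tailSpan v (GTail 0 r₁) := by
        intro r₁
        rcases hj0.eq_or_lt with rfl | hj0
        · obtain ⟨a, b, h⟩ := hv.G_zero_smul_tailVec r₂
          rw [h, smul_add, smul_smul_comm', smul_smul_comm', ← tailVec_zero_one, ← tailVec_zero_one]
          constructor <;> exact add_mem (Submodule.smul_mem _ _ (tailVec_mem (Or.inl le_rfl)))
            (Submodule.smul_mem _ _ (tailVec_mem (Or.inl le_rfl)))
        · rw [hv.G_pos_smul_tailVec _ _ hj0, smul_zero]
          exact ⟨zero_mem _, zero_mem _⟩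
      fin_cases r₁
      · exact (h0 0).1
      · simp only [Fin.mk_one]
        rw [tailVec_zero_one, hv.GG, neg_smul]
        refine add_mem (add_mem (neg_mem (h0 1).2) (Submodule.smul_mem _ _ ?_))
          (Submodule.smul_mem _ _ (tailVec_mem (Or.inl le_rfl)))
        obtain rfl | rfl | hj1 : j = 0 ∨ j = 1 ∨ 1 ≤ j + -1 := by omega
        · rw [zero_add (-1 : ℤ), ← tailVec_succ]
          exact tailVec_mem (Or.inr ⟨rfl, rfl, rfl⟩)
        · rw [show (1 + -1 : ℤ) = 0 by norm_num, hv.L_zero_smul_tailVec]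
          exact Submodule.smul_mem _ _ (tailVec_mem (Or.inl le_rfl))
        · rw [hv.L_pos_smul_tailVec _ _ hj1]
          exact zero_mem _
  | succ n ih =>
    rw [tailVec_succ, hv.GL]
    refine add_mem (hv.L_neg_one_smul_mem ?_ (ih j)) (Submodule.smul_mem _ _
      (tailSpan_mono ?_ (ih _)))
    · rintro n' r' (h | ⟨h, h', h''⟩)
      · exact ⟨Or.inl (by omega), Or.inl (by omega)⟩
      · exact ⟨Or.inl (by omega), Or.inr ⟨by omega, h', h''⟩⟩
    · rintro n' r' (h | ⟨h, h', h''⟩) <;> exact Or.inl (by omega)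

end HighestWeight

/-! ### Leading terms of the action of single modes -/

section Leading

set_option linter.unusedSectionVars false

variable {M : Type} [AddCommGroup M] [Module ℂ M] [Module U M] [IsScalarTower ℂ U M]
  {c Δ : ℂ} {v : M} (hv : IsHighestWeight c Δ v)

/-- The powers of `L_{-1}` and `G_{-1}` in the image under an arbitrary mode. -/
def Gain (n : ℕ) (r : Fin 2) (n' : ℕ) (r' : Fin 2) : Prop :=
  n' ≤ n ∨ (n' = n + 1 ∧ r' ≤ r)

theorem ne_F_of_mem_support_br {x y s : Gen} (hs : s ∈ (Gen.br x y).support) : s ≠ .F := by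
  classical
  rintro rfl
  rcases x with m | m | _ | _ <;> rcases y with n | n | _ | _ <;> simp [Gen.br] at hs

theorem mem_of_forall_mem_cons {x : Gen} {u : List Gen} (hu : ∀ y ∈ x :: u, y ∈ lowSet) :
    x ∈ lowSet ∧ ∀ y ∈ u, y ∈ lowSet :=
  ⟨hu x (by simp), fun y hy => hu y (by simp [hy])⟩

include hv

/-- Commuting a generator to the right through low letters leaves combinations of single generators,
never $F$. So only one generator ever reaches the tail, and it gains at most one $L_{-1}$. -/
theorem IsHighestWeight.toU_smul_mem {x : Gen} (hx : x ≠ .F) (u : List Gen)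
    (hu : ∀ y ∈ u, y ∈ lowSet) (n : ℕ) (r₁ r₂ : Fin 2) :
    toU x • wd toU u • tailVec v n r₁ r₂ ∈ tailSpan v (Gain n r₁) := by
  induction u generalizing x with
  | nil =>
    rw [wd_nil, one_smul]
    rcases x with m | m | _ | _
    · change L m • tailVec v n r₁ r₂ ∈ _
      by_cases h : m = -1
      · rw [h, ← tailVec_succ]
        exact tailVec_mem (Or.inr ⟨rfl, le_rfl⟩)
      · exact tailSpan_mono (fun _ _ => Or.inl) (hv.L_smul_tailVec_mem m h n r₁ r₂)
    · refine tailSpan_mono ?_ (hv.G_smul_tailVec_mem m n r₁ r₂)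
      rintro n' r' (h | ⟨h, -, rfl⟩)
      · exact Or.inl h
      · exact Or.inr ⟨h, Fin.zero_le _⟩
    · change C • tailVec v n r₁ r₂ ∈ _
      rw [hv.C_smul]
      exact Submodule.smul_mem _ _ (tailVec_mem (Or.inl le_rfl))
    · exact absurd rfl hx
  | cons y u ih =>
    replace hu := mem_of_forall_mem_cons hu
    obtain ⟨hy, hu⟩ := hu
    rw [wd_cons, mul_smul, commutator_smul]
    refine add_mem (Submodule.smul_mem _ _ (low_smul_mem hy (ih hx hu))) ?_
    rw [Finsupp.linearCombination_apply, Finsupp.sum, Finset.sum_smul]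
    refine Submodule.sum_mem _ fun s hs => ?_
    rw [smul_assoc]
    exact Submodule.smul_mem _ _ (ih (ne_F_of_mem_support_br hs) hu)

theorem IsHighestWeight.L_smul_mem (j : ℤ) (X : Mono) :
    L j • X.toU • v ∈ tailSpan v (Gain X.n X.r₁) := by
  rw [toU_smul_eq]
  exact hv.toU_smul_mem (x := .L j) (by simp) _ (fun _ => Mono.mem_headWord) _ _ _

theorem IsHighestWeight.G_smul_mem (j : ℤ) (X : Mono) :
    G j • X.toU • v ∈ tailSpan v (Gain X.n X.r₁) := by
  rw [toU_smul_eq]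
  exact hv.toU_smul_mem (x := .G j) (by simp) _ (fun _ => Mono.mem_headWord) _ _ _

/-- An anticommutator with a $G$ of the word has index at most $-2$, and commutators with low $L$'s
only lower $j$. So no $L_{-1}$ is created before the tail is reached. -/
theorem IsHighestWeight.G_smul_low_mem {k j : ℤ} (hj : j + 2 ≤ k) (u : List Gen)
    (hu : ∀ y ∈ u, y ∈ lowSet) (hG : ∀ m, Gen.G m ∈ u → m ≤ -k) (n : ℕ) (r₁ r₂ : Fin 2) :
    G j • wd toU u • tailVec v n r₁ r₂ ∈ tailSpan v (GTail n r₁) := by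
  induction u generalizing j with
  | nil =>
    rw [wd_nil, one_smul]
    exact hv.G_smul_tailVec_mem j n r₁ r₂
  | cons y u ih =>
    replace hu := mem_of_forall_mem_cons hu
    obtain ⟨hy, hu⟩ := hu
    have hG' : ∀ m, Gen.G m ∈ u → m ≤ -k := fun m hm => hG m (by simp [hm])
    have hz := wd_smul_tailVec_mem (P := GTail n r₁) (r₁ := r₁) (r₂ := r₂) (v := v) (Or.inl le_rfl) u hu
    rw [wd_cons, mul_smul]
    rcases y with m | m | _ | _ <;> simp only [lowSet, Set.mem_ofPred_eq] at hy
    · change G j • L m • wd toU u • tailVec v n r₁ r₂ ∈ _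
      rw [hv.GL]
      exact add_mem (L_low_smul_mem hy (ih hj hu hG'))
        (Submodule.smul_mem _ _ (ih (by omega) hu hG'))
    · have hm := hG m (by simp)
      change G j • G m • wd toU u • tailVec v n r₁ r₂ ∈ _
      rw [hv.GG, neg_smul]
      exact add_mem (add_mem (neg_mem (G_low_smul_mem hy (ih hj hu hG')))
        (Submodule.smul_mem _ _ (L_low_smul_mem (by omega) hz))) (Submodule.smul_mem _ _ hz)

/-- Only the meeting of $G_{k-1}$ with the rightmost $G_{-k}$ gives $L_{-1}$. The $G$-word is
strictly ordered, so the other $G$'s have index at most $-k-1$ and give low $L$'s. -/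
theorem IsHighestWeight.G_smul_leading {k : ℤ} (hk : 2 ≤ k) (u : List Gen)
    (hu : ∀ y ∈ u, y ∈ lowSet) (hG : ∀ m, Gen.G m ∈ u → m ≤ -k - 1) (n : ℕ) (r₁ r₂ : Fin 2) :
    ∃ s : ℂ, s ≠ 0 ∧ G (k - 1) • wd toU u • G (-k) • tailVec v n r₁ r₂ -
      s • wd toU u • tailVec v (n + 1) r₁ r₂ ∈ tailSpan v (GTail n r₁) := by
  have ht : tailVec v n r₁ r₂ ∈ tailSpan v (GTail n r₁) := tailVec_mem (Or.inl le_rfl)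
  induction u with
  | nil =>
    refine ⟨2, two_ne_zero, ?_⟩
    rw [wd_nil, one_smul, one_smul, hv.GG, neg_smul, show k - 1 + -k = -1 by ring, tailVec_succ,
      add_sub_right_comm, add_sub_cancel_right]
    exact add_mem (neg_mem (G_low_smul_mem (by omega) (hv.G_smul_tailVec_mem _ _ _ _)))
      (Submodule.smul_mem _ _ ht)
  | cons y u ih =>
    replace hu := mem_of_forall_mem_cons hu
    obtain ⟨hy, hu⟩ := hu
    obtain ⟨s, hs, h⟩ := ih hu fun m hm => hG m (by simp [hm])
    have hu' : ∀ y ∈ u ++ [.G (-k)], y ∈ lowSet := by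
      simp only [List.mem_append, List.mem_singleton]
      rintro y (hy | rfl)
      · exact hu y hy
      · simp only [lowSet, Set.mem_ofPred_eq]
        omega
    have hz : wd toU u • G (-k) • tailVec v n r₁ r₂ =
        wd toU (u ++ [.G (-k)]) • tailVec v n r₁ r₂ := by
      rw [wd_append, wd_cons, wd_nil, mul_one, mul_smul]
      rfl
    have hz' := wd_smul_tailVec_mem (P := GTail n r₁) (r₁ := r₁) (r₂ := r₂) (v := v) (Or.inl le_rfl) _ hu'
    rcases y with m | m | _ | _ <;> simp only [lowSet, Set.mem_ofPred_eq] at hy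
    · refine ⟨s, hs, ?_⟩
      simp only [wd_cons, mul_smul]
      change G (k - 1) • L m • wd toU u • G (-k) • tailVec v n r₁ r₂ -
        s • L m • wd toU u • tailVec v (n + 1) r₁ r₂ ∈ _
      rw [hv.GL, add_sub_right_comm, ← smul_smul_comm', ← smul_sub]
      refine add_mem (L_low_smul_mem hy h) (Submodule.smul_mem _ _ ?_)
      rw [hz]
      refine hv.G_smul_low_mem (k := k) (by omega) _ hu' ?_ n r₁ r₂
      simp only [List.mem_append, List.mem_singleton, Gen.G.injEq]
      rintro m' (h' | rfl)
      · have := hG m' (by simp [h'])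
        omega
      · exact le_rfl
    -- Each $G$ passed on the way changes the sign, so the coefficient is $\pm2$.
    · refine ⟨-s, neg_ne_zero.mpr hs, ?_⟩
      have hm := hG m (by simp)
      simp only [wd_cons, mul_smul]
      change G (k - 1) • G m • wd toU u • G (-k) • tailVec v n r₁ r₂ -
        (-s) • G m • wd toU u • tailVec v (n + 1) r₁ r₂ ∈ _
      have h1 := neg_mem (G_low_smul_mem hy h)
      rw [smul_sub, smul_smul_comm' _ s] at h1
      rw [← hz] at hz'
      rw [hv.GG, add_sub_right_comm, add_sub_right_comm]
      refine add_mem (add_mem ?_ (Submodule.smul_mem _ _ (L_low_smul_mem (by omega) hz')))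
        (Submodule.smul_mem _ _ hz')
      convert h1 using 1
      rw [neg_smul, neg_smul]
      abel

theorem IsHighestWeight.L_smul_low_mem {m : ℤ} (hm : 2 ≤ m) (ms : List ℤ)
    (hms : ∀ a ∈ ms, a ≤ -m - 1) (n : ℕ) (r₁ r₂ : Fin 2) :
    L (m - 1) • wd toU (ms.map Gen.L) • tailVec v n r₁ r₂ ∈
      tailSpan v (fun n' _ => n' ≤ n) := by
  induction ms with
  | nil =>
    rw [List.map_nil, wd_nil, one_smul]
    exact hv.L_smul_tailVec_mem _ (by omega) n r₁ r₂
  | cons a ms ih =>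
    have ha := hms a (by simp)
    have hms' : ∀ a ∈ ms, a ≤ -m - 1 := fun b hb => hms b (by simp [hb])
    have hz := wd_smul_tailVec_mem (P := fun n' _ => n' ≤ n) (r₁ := r₁) (r₂ := r₂) (v := v) le_rfl
      (ms.map Gen.L) (by
        simp only [List.mem_map]
        rintro _ ⟨b, hb, rfl⟩
        have := hms' b hb
        simp only [lowSet, Set.mem_ofPred_eq]
        omega)
    rw [List.map_cons, wd_cons, mul_smul]
    change L (m - 1) • L a • wd toU (ms.map Gen.L) • tailVec v n r₁ r₂ ∈ _
    rw [hv.LL]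
    exact add_mem (add_mem (L_low_smul_mem (by omega) (ih hms'))
      (Submodule.smul_mem _ _ (L_low_smul_mem (by omega) hz))) (Submodule.smul_mem _ _ hz)

/-- Every copy of $L_{-m}$ contributes $[L_{m-1},L_{-m}]=(2m-1)L_{-1}$ and leaves the same monomial.
The contributions add up with equal sign, so repetition causes no cancellation. -/
theorem IsHighestWeight.L_smul_leading {m : ℤ} (hm : 2 ≤ m) (ms : List ℤ)
    (hms : ∀ a ∈ ms, a ≤ -m) (hsort : ms.Pairwise (· ≤ ·)) (n : ℕ) (r₁ r₂ : Fin 2) :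
    ∃ N : ℕ, N ≠ 0 ∧ L (m - 1) • wd toU (ms.map Gen.L) • L (-m) • tailVec v n r₁ r₂ -
      (N * (2 * m - 1) : ℂ) • wd toU (ms.map Gen.L) • tailVec v (n + 1) r₁ r₂ ∈
      tailSpan v (fun n' _ => n' ≤ n) := by
  have ht : tailVec v n r₁ r₂ ∈ tailSpan v (fun n' _ => n' ≤ n) := tailVec_mem le_rfl
  induction ms with
  | nil =>
    refine ⟨1, one_ne_zero, ?_⟩
    rw [List.map_nil, wd_nil, one_smul, one_smul, hv.LL, show m - 1 + -m = -1 by ring, tailVec_succ]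
    have h1 := L_low_smul_mem (m := -m) (by omega)
      (hv.L_smul_tailVec_mem (m - 1) (by omega) n r₁ r₂)
    rw [if_neg (by norm_num), zero_mul, zero_smul, add_zero]
    convert h1 using 1
    generalize L (-1) • tailVec v n r₁ r₂ = z
    generalize L (-m) • L (m - 1) • tailVec v n r₁ r₂ = z'
    push_cast
    module
  | cons a ms ih =>
    rw [List.pairwise_cons] at hsort
    have ha := hms a (by simp)
    have hms' : ∀ a ∈ ms, a ≤ -m := fun b hb => hms b (by simp [hb])
    obtain ⟨N, hN, h⟩ := ih hms' hsort.2
    have hu : ∀ y ∈ ms.map Gen.L ++ [.L (-m)], y ∈ lowSet := by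
      simp only [List.mem_append, List.mem_map, List.mem_singleton]
      rintro _ (⟨b, hb, rfl⟩ | rfl)
      · have := hms' b hb
        simp only [lowSet, Set.mem_ofPred_eq]
        omega
      · simp only [lowSet, Set.mem_ofPred_eq]
        omega
    have hz : ∀ n, wd toU (ms.map Gen.L) • L (-m) • tailVec v n r₁ r₂ =
        wd toU (ms.map Gen.L ++ [.L (-m)]) • tailVec v n r₁ r₂ := by
      intro n
      rw [wd_append, wd_cons, wd_nil, mul_one, mul_smul]
      rfl
    have hz' := wd_smul_tailVec_mem (P := fun n' _ => n' ≤ n) (r₁ := r₁) (r₂ := r₂) (v := v) le_rfl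
      _ hu
    have h1 := L_low_smul_mem (m := a) (by omega) h
    rw [smul_sub, smul_smul_comm' _ (_ * _ : ℂ)] at h1
    simp only [List.map_cons, wd_cons, mul_smul (toU (Gen.L a))]
    rcases ha.eq_or_lt with rfl | ha
    · refine ⟨N + 1, by omega, ?_⟩
      -- The word is sorted, so once its leftmost index is $-m$ all its letters are $L_{-m}$;
      -- removing any one of them leaves the same word.
      have hrep : ms = List.replicate ms.length (-m) :=
        List.eq_replicate_iff.mpr ⟨rfl, fun b hb => le_antisymm (hms' b hb) (hsort.1 b hb)⟩
      have hcomm : ms.map Gen.L ++ [.L (-m)] = .L (-m) :: ms.map Gen.L := by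
        rw [hrep, List.map_replicate, ← List.replicate_succ, ← List.replicate_succ']
      have h2 := hv.L_neg_one_smul_sub_mem (P := fun n' _ => n' ≤ n) (r₁ := r₁) (r₂ := r₂) le_rfl _ hu
      rw [← hz] at h2
      rw [hcomm, wd_cons, mul_smul] at h2
      change L (m - 1) • L (-m) • wd toU (ms.map Gen.L) • L (-m) • tailVec v n r₁ r₂ -
        ((N + 1 : ℕ) * (2 * m - 1) : ℂ) • L (-m) • wd toU (ms.map Gen.L) •
          tailVec v (n + 1) r₁ r₂ ∈ _
      replace h2 : L (-1) • wd toU (ms.map Gen.L) • L (-m) • tailVec v n r₁ r₂ -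
          L (-m) • wd toU (ms.map Gen.L) • tailVec v (n + 1) r₁ r₂ ∈
          tailSpan v (fun n' _ => n' ≤ n) := h2
      rw [hv.LL, if_neg (by omega), zero_mul, zero_smul, add_zero, show m - 1 + -m = -1 by ring]
      convert add_mem h1 (Submodule.smul_mem _ (2 * m - 1 : ℂ) h2) using 1
      generalize L (-1) • wd toU (ms.map Gen.L) • L (-m) • tailVec v n r₁ r₂ = z1
      generalize L (-m) • wd toU (ms.map Gen.L) • tailVec v (n + 1) r₁ r₂ = z2
      generalize L (-m) • L (m - 1) • wd toU (ms.map Gen.L) • L (-m) • tailVec v n r₁ r₂ = z3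
      push_cast
      module
    · refine ⟨N, hN, ?_⟩
      change L (m - 1) • L a • wd toU (ms.map Gen.L) • L (-m) • tailVec v n r₁ r₂ -
        (N * (2 * m - 1) : ℂ) • L a • wd toU (ms.map Gen.L) • tailVec v (n + 1) r₁ r₂ ∈ _
      rw [← hz] at hz'
      rw [hv.LL, add_sub_right_comm, add_sub_right_comm]
      exact add_mem (add_mem h1 (Submodule.smul_mem _ _ (L_low_smul_mem (by omega) hz')))
        (Submodule.smul_mem _ _ hz')

/-- The term comes from $\{G_0,G_{-1}\}=2L_{-1}$; commuting $G_0$ past an $L_{-1}$ first costs that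
factor, so nothing else reaches the power $n+1$. -/
theorem IsHighestWeight.G_zero_smul_leading (n : ℕ) (r₂ : Fin 2) :
    G 0 • tailVec v n 1 r₂ - (2 : ℂ) • tailVec v (n + 1) 0 r₂ ∈
      tailSpan v (fun n' _ => n' ≤ n) := by
  induction n with
  | zero =>
    obtain ⟨a, b, h⟩ := hv.G_zero_smul_tailVec r₂
    rw [tailVec_zero_one, hv.GG, h, tailVec_succ, zero_add (-1 : ℤ), if_neg (by norm_num), zero_mul,
      zero_smul, add_zero, add_sub_cancel_right, neg_smul, smul_add, smul_smul_comm',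
      smul_smul_comm', ← tailVec_zero_one, ← tailVec_zero_one]
    exact neg_mem (add_mem (Submodule.smul_mem _ _ (tailVec_mem le_rfl))
      (Submodule.smul_mem _ _ (tailVec_mem le_rfl)))
  | succ n ih =>
    have h1 := hv.L_neg_one_smul_mem (Q := fun n' _ => n' ≤ n + 1)
      (fun n' _ h => ⟨by omega, by omega⟩) ih
    rw [smul_sub, smul_smul_comm', ← tailVec_succ] at h1
    rw [tailVec_succ, hv.GL, add_sub_right_comm]
    refine add_mem h1 (Submodule.smul_mem _ _ (tailSpan_mono ?_ (hv.G_smul_tailVec_mem _ n 1 r₂)))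
    rintro n' r' (h | ⟨h, -, -⟩) <;> omega

end Leading

/-! ### The ordering of the monomials -/

theorem wordLT_irrefl : ∀ s : List ℕ, ¬ wordLT s s
  | [] => by simp [wordLT]
  | a :: s => by simp [wordLT, wordLT_irrefl s]

theorem wordLT_trans : ∀ {s t u : List ℕ}, wordLT s t → wordLT t u → wordLT s u
  | [], _, _ => by simp [wordLT]
  | _ :: _, [], _ => by simp [wordLT]
  | _ :: _, _ :: _, [] => by simp [wordLT]
  | a :: s, b :: t, d :: u => by
    simp only [wordLT]
    rintro (h | ⟨rfl, h⟩) (h' | ⟨rfl, h'⟩)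
    · exact Or.inl (h.trans h')
    · exact Or.inl h
    · exact Or.inl h'
    · exact Or.inr ⟨rfl, wordLT_trans h h'⟩

theorem wordLT_trichotomy : ∀ s t : List ℕ, wordLT s t ∨ s = t ∨ wordLT t s
  | [], [] => by simp
  | [], _ :: _ => by simp [wordLT]
  | _ :: _, [] => by simp [wordLT]
  | a :: s, b :: t => by
    simp only [wordLT, List.cons.injEq]
    rcases lt_trichotomy a b with h | rfl | h
    · exact Or.inl (Or.inl h)
    · rcases wordLT_trichotomy s t with h | h | h <;> simp [h]
    · exact Or.inr (Or.inr (Or.inl h))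

theorem monoLT_irrefl (X : Mono) : ¬ monoLT X X := by
  simp [monoLT, wordLT_irrefl]

theorem monoLT_trans {X Y Z : Mono} (h : monoLT X Y) (h' : monoLT Y Z) : monoLT X Z := by
  rcases h with h | ⟨e, h | ⟨e₁, h | ⟨e₂, h⟩⟩⟩ <;> rcases h' with h' | ⟨e', h' | ⟨e₁', h' | ⟨e₂', h'⟩⟩⟩
  all_goals simp only [monoLT, gt_iff_lt] at *
  all_goals first
    | exact Or.inl (by omega)
    | skip
  all_goals refine Or.inr ⟨by omega, ?_⟩
  all_goals first
    | exact Or.inl (by omega)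
    | skip
  all_goals refine Or.inr ⟨by omega, ?_⟩
  · exact Or.inl (wordLT_trans h h')
  · exact Or.inl (e₂' ▸ h)
  · exact Or.inl (e₂ ▸ h')
  · exact Or.inr ⟨e₂.trans e₂', wordLT_trans h h'⟩

theorem monoLT_trichotomy (X Y : Mono) : monoLT X Y ∨
    (X.n = Y.n ∧ X.r₁ = Y.r₁ ∧ X.gs = Y.gs ∧ X.ls = Y.ls) ∨ monoLT Y X := by
  simp only [monoLT, gt_iff_lt]
  rcases lt_trichotomy X.n Y.n with h | h | h
  · exact Or.inr (Or.inr (Or.inl h))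
  · rcases lt_trichotomy X.r₁ Y.r₁ with h₁ | h₁ | h₁
    · simp [h, h₁]
    · rcases wordLT_trichotomy X.gs Y.gs with h₂ | h₂ | h₂
      · simp [h, h₁, h₂]
      · rcases wordLT_trichotomy X.ls Y.ls with h₃ | h₃ | h₃ <;> simp [h, h₁, h₂, h₃]
      · simp [h, h₁, h₂]
    · simp [h, h₁]
  · exact Or.inl (Or.inl h)

/-- The ordering does not look at $r_2$; fixing the parity is what makes it total. -/
theorem Mono.r₂_eq_of_parity_eq {X Y : Mono} (h : X.parity = Y.parity) (h₁ : X.r₁ = Y.r₁)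
    (h₂ : X.gs = Y.gs) : X.r₂ = Y.r₂ := by
  rw [parity, parity, h₁, h₂, pow_add _ _ (X.r₂ : ℕ), pow_add _ _ (Y.r₂ : ℕ), mul_right_inj] at h
  generalize X.r₂ = a at *
  generalize Y.r₂ = b at *
  fin_cases a <;> fin_cases b <;> simp at h ⊢

theorem isTotalOrderOn_of_forall_parity {κ : Type} {f : κ → Mono} (hf : f.Injective) {p : ℤˣ}
    {S : Set κ} (hS : ∀ X ∈ S, (f X).parity = p) :
    IsTotalOrderOn (fun X Y => monoLE (f X) (f Y)) S := by
  refine ⟨fun X _ => Or.inl rfl, ?_, ?_, ?_⟩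
  · rintro X - Y - (h | h) (h' | h')
    · exact hf h
    · exact hf h
    · exact hf h'.symm
    · exact absurd (monoLT_trans h h') (monoLT_irrefl _)
  · rintro X - Y - Z - (h | h) (h' | h')
    · exact Or.inl (h.trans h')
    · exact Or.inr (h ▸ h')
    · exact Or.inr (h' ▸ h)
    · exact Or.inr (monoLT_trans h h')
  · intro X hX Y hY
    rcases monoLT_trichotomy (f X) (f Y) with h | ⟨h₀, h₁, h₂, h₃⟩ | h
    · exact Or.inl (Or.inr h)
    · exact Or.inl (Or.inl (Mono.ext h₃ h₂ h₀ h₁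
        (Mono.r₂_eq_of_parity_eq ((hS X hX).trans (hS Y hY).symm) h₁ h₂)))
    · exact Or.inr (Or.inr h)

/-! ### Operators that detect a monomial among the larger ones -/

namespace Mono

/-- The monomial with the rightmost `G_{-k}`, `k ≥ 2`, replaced by a factor `L_{-1}`. -/
def tailG (X : Mono) : Mono where
  ls := X.ls
  gs := X.gs.tail
  n := X.n + 1
  r₁ := X.r₁
  r₂ := X.r₂
  ls_sorted := X.ls_sorted
  ls_two_le := X.ls_two_le
  gs_sorted := X.gs_sorted.tail
  gs_two_le _ h := X.gs_two_le _ (List.mem_of_mem_tail h)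

/-- The monomial with the rightmost `L_{-m}`, `m ≥ 2`, replaced by a factor `L_{-1}`. -/
def tailL (X : Mono) : Mono where
  ls := X.ls.tail
  gs := X.gs
  n := X.n + 1
  r₁ := X.r₁
  r₂ := X.r₂
  ls_sorted := X.ls_sorted.tail
  ls_two_le _ h := X.ls_two_le _ (List.mem_of_mem_tail h)
  gs_sorted := X.gs_sorted
  gs_two_le := X.gs_two_le

end Mono

section Avoid

set_option linter.unusedSectionVars false

variable {M : Type} [AddCommGroup M] [Module ℂ M] [Module U M] [IsScalarTower ℂ U M]
  {c Δ : ℂ} {v : M}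

/-- The span of the standard vectors other than a given one. -/
noncomputable def avoid (v : M) (Z : Mono) : Submodule ℂ M :=
  Submodule.span ℂ {z | ∃ W : Mono, W ≠ Z ∧ z = W.toU • v}

theorem toU_smul_mem_avoid {W Z : Mono} (h : W ≠ Z) : W.toU • v ∈ avoid v Z :=
  Submodule.subset_span ⟨W, h, rfl⟩

theorem tailSpan_le_avoid {P : ℕ → Fin 2 → Prop} {Z : Mono} (h : ¬ P Z.n Z.r₁) :
    tailSpan v P ≤ avoid v Z := by
  refine Submodule.span_mono ?_
  rintro _ ⟨X, hX, rfl⟩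
  exact ⟨X, fun e => h (e ▸ hX), rfl⟩

theorem not_GTail {n : ℕ} {r : Fin 2} : ¬ GTail n r (n + 1) r := by
  rintro (h | ⟨-, h, h'⟩) <;> omega

theorem wd_headWord_cons (ls gs : List ℕ) (k : ℕ) (z : M) :
    wd toU (Mono.headWord ls (k :: gs)) • z = wd toU (Mono.headWord ls gs) • G (-(k : ℤ)) • z := by
  simp [Mono.headWord, mul_smul, G]

theorem wd_headWord_nil (ls : List ℕ) (z : M) :
    wd toU (Mono.headWord ls []) • z =
      wd toU ((ls.reverse.map fun m : ℕ => -(m : ℤ)).map Gen.L) • z := by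
  simp [Mono.headWord, Function.comp_def]

theorem mem_avoid_of_sub_mem {W Z : Mono} (h : W ≠ Z) {s : ℂ} {x : M}
    (hx : x - s • W.toU • v ∈ avoid v Z) : x ∈ avoid v Z := by
  rw [← sub_add_cancel x (s • W.toU • v)]
  exact add_mem hx (Submodule.smul_mem _ _ (toU_smul_mem_avoid h))

variable (hv : IsHighestWeight c Δ v)

include hv

theorem IsHighestWeight.L_smul_mem_avoid (j : ℤ) {X Z : Mono}
    (h : X.n < Z.n ∨ X.n = Z.n ∧ Z.r₁ > X.r₁) : L j • X.toU • v ∈ avoid v Z.tailL := by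
  refine tailSpan_le_avoid ?_ (hv.L_smul_mem j X)
  simp only [Gain, Mono.tailL]
  omega

theorem IsHighestWeight.G_smul_mem_avoid (j : ℤ) {X Z : Mono}
    (h : X.n < Z.n ∨ X.n = Z.n ∧ Z.r₁ > X.r₁) : G j • X.toU • v ∈ avoid v Z.tailG := by
  refine tailSpan_le_avoid ?_ (hv.G_smul_mem j X)
  simp only [Gain, Mono.tailG]
  omega

theorem IsHighestWeight.G_smul_tailG {X : Mono} {k : ℕ} {t : List ℕ} (h : X.gs = k :: t) :
    ∃ s : ℂ, s ≠ 0 ∧ G ((k : ℤ) - 1) • X.toU • v - s • X.tailG.toU • v ∈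
      tailSpan v (GTail X.n X.r₁) := by
  have hs := X.gs_sorted
  have h2 := X.gs_two_le
  rw [h] at hs h2
  have hk := h2 k (by simp)
  rw [List.pairwise_cons] at hs
  obtain ⟨s, hs, H⟩ := hv.G_smul_leading (k := k) (by omega) (Mono.headWord X.ls t)
    (fun x hx => Mono.mem_headWord (X := X.tailG) (by simpa [Mono.tailG, h] using hx)) (by
      intro m hm
      simp only [Mono.headWord, List.mem_append, List.mem_map, List.mem_reverse, reduceCtorEq,
        and_false, exists_false, false_or, Gen.G.injEq] at hm
      obtain ⟨a, ha, rfl⟩ := hm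
      have := hs.1 a ha
      omega) X.n X.r₁ X.r₂
  refine ⟨s, hs, ?_⟩
  rw [toU_smul_eq, h, wd_headWord_cons, toU_smul_eq]
  simpa [Mono.tailG, h] using H

theorem IsHighestWeight.L_smul_tailL {X : Mono} {m : ℕ} {t : List ℕ} (hg : X.gs = [])
    (h : X.ls = m :: t) :
    ∃ s : ℂ, s ≠ 0 ∧ L ((m : ℤ) - 1) • X.toU • v - s • X.tailL.toU • v ∈
      tailSpan v (fun n' _ => n' ≤ X.n) := by
  have hs := X.ls_sorted
  have h2 := X.ls_two_le
  rw [h] at hs h2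
  have hm := h2 m (by simp)
  rw [List.pairwise_cons] at hs
  obtain ⟨N, hN, H⟩ := hv.L_smul_leading (m := m) (by omega)
    (t.reverse.map fun m : ℕ => -(m : ℤ)) (by
      simp only [List.mem_map, List.mem_reverse]
      rintro _ ⟨a, ha, rfl⟩
      have := hs.1 a ha
      omega) (by
      rw [List.pairwise_map, List.pairwise_reverse]
      exact hs.2.imp fun h => by omega) X.n X.r₁ X.r₂
  refine ⟨N * (2 * (m : ℤ) - 1), mul_ne_zero (Nat.cast_ne_zero.mpr hN) ?_, ?_⟩
  · have : (2 * (m : ℤ) - 1 : ℤ) ≠ 0 := by omega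
    exact_mod_cast this
  · rw [toU_smul_eq, h, hg, wd_headWord_nil, toU_smul_eq]
    simp only [Mono.tailL, h, hg, List.tail_cons]
    rw [wd_headWord_nil]
    simpa [wd_append, mul_smul, L] using H

/-- If `Y` has smaller $n$ or $r_1$, the exponents of `Z.tailG` are out of reach. Otherwise its
$G$-word either has only indices above $k$ and gives no new $L_{-1}$ at the same $r_1$, or also
begins with $k$; then its leading term `Y.tailG` differs from `Z.tailG` because `Y` and `Z` differ
in a word. -/
theorem IsHighestWeight.G_smul_mem_avoid_of_monoLT {Z Y : Mono} {k : ℕ} {t : List ℕ}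
    (h : Z.gs = k :: t) (hY : monoLT Z Y) : G ((k : ℤ) - 1) • Y.toU • v ∈ avoid v Z.tailG := by
  rcases hY with hn | ⟨hn, hr | ⟨hr, hY⟩⟩
  · exact hv.G_smul_mem_avoid _ (Or.inl hn)
  · exact hv.G_smul_mem_avoid _ (Or.inr ⟨hn.symm, hr⟩)
  have hle : tailSpan v (GTail Y.n Y.r₁) ≤ avoid v Z.tailG := by
    rw [← hn, ← hr]
    exact tailSpan_le_avoid not_GTail
  have hlow (hb : ∀ b ∈ Y.gs, k < b) : G ((k : ℤ) - 1) • Y.toU • v ∈ avoid v Z.tailG := by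
    rw [toU_smul_eq]
    refine hle (hv.G_smul_low_mem (k := k + 1) (by omega) _ (fun _ => Mono.mem_headWord) ?_ _ _ _)
    intro m hm
    simp only [Mono.headWord, List.mem_append, List.mem_map, List.mem_reverse, reduceCtorEq,
        and_false, exists_false, false_or, Gen.G.injEq] at hm
    obtain ⟨b, hb', rfl⟩ := hm
    have := hb b hb'
    omega
  have heq {t' : List ℕ} (hg : Y.gs = k :: t') : G ((k : ℤ) - 1) • Y.toU • v ∈ avoid v Z.tailG := by
    obtain ⟨s, -, H⟩ := hv.G_smul_tailG hg
    refine mem_avoid_of_sub_mem ?_ (hle H)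
    intro e
    have e₁ : Y.gs.tail = Z.gs.tail := congrArg Mono.gs e
    have e₂ : Y.tailG.ls = Z.tailG.ls := congrArg Mono.ls e
    replace e₂ : Y.ls = Z.ls := e₂
    rw [hg, h, List.tail_cons, List.tail_cons] at e₁
    rw [hg, h, e₁, e₂] at hY
    simp [wordLT_irrefl] at hY
  rcases hY with hY | ⟨hY, -⟩
  · have hs := Y.gs_sorted
    rcases hg : Y.gs with _ | ⟨b, t'⟩
    -- The empty word is larger than every nonempty one and has no letter that could meet $G_{k-1}$.
    · exact hlow (by simp [hg])
    · rw [h, hg] at hY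
      rw [hg, List.pairwise_cons] at hs
      rcases hY with hb | ⟨rfl, -⟩
      · refine hlow ?_
        simp only [hg, List.mem_cons, forall_eq_or_imp]
        exact ⟨hb, fun a ha => hb.trans (hs.1 a ha)⟩
      · exact heq hg
  · exact heq (hY ▸ h)

theorem IsHighestWeight.L_smul_mem_avoid_of_monoLT {Z Y : Mono} {m : ℕ} {t : List ℕ}
    (hg : Z.gs = []) (h : Z.ls = m :: t) (hY : monoLT Z Y) :
    L ((m : ℤ) - 1) • Y.toU • v ∈ avoid v Z.tailL := by
  rcases hY with hn | ⟨hn, hr | ⟨hr, hY⟩⟩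
  · exact hv.L_smul_mem_avoid _ (Or.inl hn)
  · exact hv.L_smul_mem_avoid _ (Or.inr ⟨hn.symm, hr⟩)
  have hle : tailSpan v (fun n' _ => n' ≤ Y.n) ≤ avoid v Z.tailL := by
    rw [← hn]
    exact tailSpan_le_avoid (by simp [Mono.tailL])
  rw [hg] at hY
  obtain hY | ⟨hg', hY⟩ := hY
  -- Nothing is larger than the empty $G$-word, so `Y` has no $G$ of index at most $-2$ either, and
  -- $L_{m-1}$ meets only $L$'s before the tail.
  · simp [wordLT] at hY
  have hs := Y.ls_sorted
  have h2 := Z.ls_two_le m (by simp [h])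
  have hlow (hb : ∀ b ∈ Y.ls, m < b) : L ((m : ℤ) - 1) • Y.toU • v ∈ avoid v Z.tailL := by
    rw [toU_smul_eq, ← hg', wd_headWord_nil]
    refine hle (hv.L_smul_low_mem (by omega) _ ?_ _ _ _)
    simp only [List.mem_map, List.mem_reverse]
    rintro _ ⟨b, hb', rfl⟩
    have := hb b hb'
    omega
  rcases hl : Y.ls with _ | ⟨b, t'⟩
  · exact hlow (by simp [hl])
  · rw [h, hl] at hY
    rw [hl, List.pairwise_cons] at hs
    rcases hY with hb | ⟨rfl, hY⟩
    · refine hlow ?_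
      simp only [hl, List.mem_cons, forall_eq_or_imp]
      exact ⟨hb, fun a ha => hb.trans_le (hs.1 a ha)⟩
    · obtain ⟨s, -, H⟩ := hv.L_smul_tailL hg'.symm hl
      refine mem_avoid_of_sub_mem ?_ (hle H)
      intro e
      have e₁ : Y.ls.tail = Z.ls.tail := congrArg Mono.ls e
      rw [hl, h, List.tail_cons, List.tail_cons] at e₁
      exact wordLT_irrefl _ (e₁ ▸ hY)

/-- A monomial which is not a product of `L_{-1}`, `G_{-1}` and `G_0` has under some positive
operator a term that does not occur for larger monomials. -/
theorem IsHighestWeight.exists_leading (Z : Mono) (h : Z.gs ≠ [] ∨ Z.ls ≠ []) :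
    ∃ Γ ∈ positive, ∃ Z' : Mono, Z'.r₂ = Z.r₂ ∧
      (∃ s : ℂ, s ≠ 0 ∧ Γ • Z.toU • v - s • Z'.toU • v ∈ avoid v Z') ∧
      ∀ Y, monoLT Z Y → Γ • Y.toU • v ∈ avoid v Z' := by
  rcases hg : Z.gs with _ | ⟨k, t⟩
  · rcases hl : Z.ls with _ | ⟨m, t⟩
    · simp [hg, hl] at h
    · have h2 := Z.ls_two_le m (by simp [hl])
      refine ⟨L ((m : ℤ) - 1), Submodule.subset_span ⟨_, by omega, Or.inl rfl⟩, Z.tailL, rfl, ?_,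
        fun Y hY => hv.L_smul_mem_avoid_of_monoLT hg hl hY⟩
      obtain ⟨s, hs, H⟩ := hv.L_smul_tailL hg hl
      exact ⟨s, hs, tailSpan_le_avoid (by simp [Mono.tailL]) H⟩
  · have h2 := Z.gs_two_le k (by simp [hg])
    refine ⟨G ((k : ℤ) - 1), Submodule.subset_span ⟨_, by omega, Or.inr rfl⟩, Z.tailG, rfl, ?_,
      fun Y hY => hv.G_smul_mem_avoid_of_monoLT hg hY⟩
    obtain ⟨s, hs, H⟩ := hv.G_smul_tailG hg
    exact ⟨s, hs, tailSpan_le_avoid not_GTail H⟩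

/-- The operator `G_0` maps `L_{-1}^n G_{-1} G_0^{r₂}` to a vector with a term
`L_{-1}^{n+1} G_0^{r₂}`, which does not occur for monomials with fewer factors `L_{-1}`. -/
theorem IsHighestWeight.exists_leading_pure (n : ℕ) (r₂ : Fin 2) :
    ∃ Γ ∈ positiveG, ∃ Z' : Mono,
      (∃ s : ℂ, s ≠ 0 ∧ Γ • (Mono.pure n 1 r₂).toU • v - s • Z'.toU • v ∈ avoid v Z') ∧
      ∀ Y : Mono, Y.n < n → Γ • Y.toU • v ∈ avoid v Z' := by
  refine ⟨G 0, Submodule.mem_sup_right (Submodule.mem_span_singleton_self _),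
    Mono.pure (n + 1) 0 r₂, ⟨2, two_ne_zero, ?_⟩, fun Y hY => ?_⟩
  · refine tailSpan_le_avoid ?_ (P := fun n' _ => n' ≤ n) ?_
    · simp [Mono.pure]
    · rw [toU_smul_eq, toU_smul_eq]
      simpa [Mono.pure, Mono.headWord] using hv.G_zero_smul_leading n r₂
  · refine tailSpan_le_avoid ?_ (hv.G_smul_mem 0 Y)
    simp only [Gain, Mono.pure]
    omega

end Avoid

/-! ### From leading terms to ordering kernels -/

section Adapted

variable {κ M : Type} [AddCommGroup M] [Module ℂ M] [Module U M] {v : M}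

/-- The hypothesis `h0` serves the $G$-closed module, where monomials with $G_0$ are not basis
labels but give the zero vector. -/
theorem repr_eq_zero_of_mem_avoid {b : Module.Basis κ ℂ M} {f : κ → Mono}
    (hb : ∀ i, b i = (f i).toU • v) (h0 : ∀ W ∉ Set.range f, W.toU • v = 0) {i : κ} {z : M}
    (hz : z ∈ avoid v (f i)) : b.repr z i = 0 := by
  have : avoid v (f i) ≤ LinearMap.ker (b.coord i) := by
    refine Submodule.span_le.mpr ?_
    rintro _ ⟨W, hW, rfl⟩
    by_cases hr : W ∈ Set.range f
    · obtain ⟨j, rfl⟩ := hr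
      have hji : j ≠ i := fun h => hW (by rw [h])
      simp [← hb, hji]
    · simp [h0 W hr]
  exact this hz

/-- The adapted set is taken to be all of `S \ N`; the label `i` witnesses the new term. -/
theorem isOrderingKernel_of_leading {b : Module.Basis κ ℂ M} {f : κ → Mono} (hf : f.Injective)
    (hb : ∀ i, b i = (f i).toU • v) (h0 : ∀ W ∉ Set.range f, W.toU • v = 0)
    {p : ℤˣ} {S : Set κ} (hS : ∀ X ∈ S, (f X).parity = p) {K : Submodule ℂ U} {N : Set κ}
    (hN : N ⊆ S)
    (H : ∀ X ∈ S, X ∉ N → ∃ Γ ∈ K, ∃ i,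
      (∃ s : ℂ, s ≠ 0 ∧ Γ • (f X).toU • v - s • (f i).toU • v ∈ avoid v (f i)) ∧
      ∀ Y ∈ S, monoLT (f X) (f Y) → Γ • (f Y).toU • v ∈ avoid v (f i)) :
    IsOrderingKernel b (fun X Y => monoLE (f X) (f Y)) S K N := by
  refine ⟨S \ N, ⟨isTotalOrderOn_of_forall_parity hf hS, Set.sdiff_subset, ?_⟩,
    (Set.sdiff_sdiff_cancel_left hN).symm⟩
  rintro X ⟨hX, hXN⟩
  obtain ⟨Γ, hΓ, i, ⟨s, hs, h₁⟩, h₂⟩ := H X hX hXN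
  refine ⟨Γ, hΓ, fun hsub => ?_⟩
  have hi : i ∈ terms b (Γ • b X) := by
    have := repr_eq_zero_of_mem_avoid hb h0 h₁
    rw [← hb, ← hb, map_sub, map_smul b.repr s, Finsupp.sub_apply, Finsupp.smul_apply, b.repr_self,
      Finsupp.single_eq_same, smul_eq_mul, mul_one, sub_eq_zero] at this
    simpa only [terms, Set.mem_ofPred_eq, this] using hs
  obtain ⟨Y, ⟨hY, hle, hne⟩, hYi⟩ := Set.mem_iUnion₂.mp (hsub hi)
  have hlt : monoLT (f X) (f Y) := hle.resolve_left fun h => hne (hf h).symm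
  exact hYi (by rw [hb]; exact repr_eq_zero_of_mem_avoid hb h0 (h₂ Y hY hlt))

end Adapted

namespace Mono

theorem eq_pure {X : Mono} (hg : X.gs = []) (hl : X.ls = []) : X = pure X.n X.r₁ X.r₂ :=
  Mono.ext hl hg rfl rfl rfl

@[simp]
theorem level_pure (n : ℕ) (r₁ r₂ : Fin 2) : (pure n r₁ r₂).level = n + r₁ := by
  simp [level, pure]

@[simp]
theorem parity_pure (n : ℕ) (r₁ r₂ : Fin 2) :
    (pure n r₁ r₂).parity = (-1) ^ ((r₁ : ℕ) + (r₂ : ℕ)) := by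
  simp [parity, pure]

theorem eq_nil_or_two_le_sum {s : List ℕ} (h : ∀ m ∈ s, 2 ≤ m) : s = [] ∨ 2 ≤ s.sum := by
  cases s with
  | nil => exact Or.inl rfl
  | cons a s =>
    have := h a (by simp)
    exact Or.inr (by rw [List.sum_cons]; omega)

/-- With the same $n$ and $r_1=0$, the remaining level would be $1$, while any further letter has
level at least $2$. With $r_1=1$ as well, the two words would have to be larger than empty ones. -/
theorem n_lt_of_monoLT_pure {n : ℕ} {r₂ : Fin 2} {Y : Mono} (hl : Y.level = n + 1)
    (h : monoLT (pure n 1 r₂) Y) : Y.n < n := by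
  have h₁ := eq_nil_or_two_le_sum Y.ls_two_le
  have h₂ := eq_nil_or_two_le_sum Y.gs_two_le
  rw [level] at hl
  rcases h with h | ⟨h, h' | ⟨h', h'' | ⟨-, h''⟩⟩⟩
  · exact h
  · simp only [pure] at h h'
    have : (Y.r₁ : ℕ) = 0 := by omega
    rcases h₁ with h₁ | h₁ <;> rcases h₂ with h₂ | h₂ <;> simp_all
    all_goals omega
  · simp [pure, wordLT] at h''
  · simp [pure, wordLT] at h''

end Mono

/-! ### The Verma modules as highest weight modules -/

theorem C_mul_comm (u : U) : C * u = u * C := by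
  have hu : u ∈ Submodule.span ℂ (Set.range (wd toU)) := by
    rw [span_range_wd_toU]
    trivial
  have hx (x : Gen) : C * toU x = toU x * C := by
    have h := commutator_smul (M := U) .C x 1
    rcases x with m | m | _ | _ <;> simp [Gen.eps, Gen.br, C] at h ⊢ <;> exact h
  induction hu using Submodule.span_induction with
  | mem u hu =>
    obtain ⟨w, rfl⟩ := hu
    induction w with
    | nil => simp
    | cons x w ih => rw [wd_cons, ← mul_assoc, hx, mul_assoc, ih, mul_assoc]
  | zero => simp
  | add u u' _ _ h h' => rw [mul_add, add_mul, h, h']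
  | smul a u _ h => rw [mul_smul_comm, smul_mul_assoc, h]

theorem isHighestWeight_mk {c Δ : ℂ} {e : ℤ} (he : e ≤ 1) {I : Submodule U U}
    (hI : I = hwIdeal c Δ e) : IsHighestWeight c Δ (Submodule.Quotient.mk 1 : U ⧸ I) := by
  subst hI
  have hmk (u : U) : u • (Submodule.Quotient.mk 1 : U ⧸ hwIdeal c Δ e) =
      Submodule.Quotient.mk u := by
    rw [← Submodule.Quotient.mk_smul, smul_eq_mul, mul_one]
  have hmem {x : Gen} (hx : x ∈ hwSet e) :
      toU x • (Submodule.Quotient.mk 1 : U ⧸ hwIdeal c Δ e) =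
        weight c Δ x • Submodule.Quotient.mk 1 := by
    rw [hmk, ← Submodule.Quotient.mk_smul, ← Algebra.algebraMap_eq_smul_one]
    exact (Submodule.Quotient.eq _).mpr (toU_sub_weight_mem c Δ hx)
  refine ⟨fun m hm => ?_, fun m hm => ?_, ?_, fun x => ?_⟩
  · rw [hmk]
    exact (Submodule.Quotient.mk_eq_zero _).mpr (L_mem_hwIdeal c Δ e m hm)
  · rw [hmk]
    exact (Submodule.Quotient.mk_eq_zero _).mpr (G_mem_hwIdeal c Δ e m (by omega))
  · exact hmem (x := .L 0) (by simp [hwSet])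
  · obtain ⟨u, rfl⟩ := Submodule.Quotient.mk_surjective _ x
    rw [← hmk, ← mul_smul, C_mul_comm, mul_smul, ← smul_comm u c]
    exact congrArg _ (hmem (x := .C) (by simp [hwSet]))

theorem G_zero_smul_mk {c Δ : ℂ} {I : Submodule U U} (hI : I = hwIdeal c Δ 0) :
    G 0 • (Submodule.Quotient.mk 1 : U ⧸ I) = 0 := by
  rw [← Submodule.Quotient.mk_smul, smul_eq_mul, mul_one, hI]
  exact (Submodule.Quotient.mk_eq_zero _).mpr (G_mem_hwIdeal c Δ 0 0 le_rfl)

/-! ### The ordering kernels -/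

section Kernel

variable {κ M : Type} [AddCommGroup M] [Module ℂ M] [Module U M] [IsScalarTower ℂ U M]
  {c Δ : ℂ} {v : M} (hv : IsHighestWeight c Δ v) {b : Module.Basis κ ℂ M} {f : κ → Mono}
  (hf : f.Injective) (hb : ∀ i, b i = (f i).toU • v) (h0 : ∀ W ∉ Set.range f, W.toU • v = 0)
  (hr : ∀ X i, X.r₂ = (f i).r₂ → X ∈ Set.range f) {p : ℤˣ} {l : ℕ} {N : Set κ}
  (hN : ∀ X ∈ N, (f X).level = l ∧ (f X).parity = p)

include hv hf hb h0 hN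

-- The witnessing monomial has the same $r_2$ as the original, so by `hr` it is a basis label also
-- in the $G$-closed module.
include hr in
theorem isOrderingKernel_positive
    (H : ∀ X n r₁ r₂, f X = .pure n r₁ r₂ → (f X).level = l → (f X).parity = p → X ∈ N) :
    IsOrderingKernel b (fun X Y => monoLE (f X) (f Y))
      {X | (f X).level = l ∧ (f X).parity = p} positive N := by
  refine isOrderingKernel_of_leading hf hb h0 (fun X hX => hX.2) hN fun X hX hXN => ?_
  obtain ⟨Γ, hΓ, Z', hZ', h₁, h₂⟩ := hv.exists_leading (f X) (by
    by_contra! h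
    exact hXN (H X _ _ _ (Mono.eq_pure h.1 h.2) hX.1 hX.2))
  obtain ⟨i, rfl⟩ := hr Z' X hZ'
  exact ⟨Γ, hΓ, i, h₁, fun Y _ => h₂ (f Y)⟩

/-- Compared with the positive operators alone, $G_0$ also detects $L_{-1}^{l-1}G_{-1}G_0^{r_2}$: at
fixed level all larger monomials have fewer than $l-1$ factors $L_{-1}$. -/
theorem isOrderingKernel_positiveG (hs : f.Surjective)
    (H : ∀ X n r₂, f X = .pure n 0 r₂ → (f X).level = l → (f X).parity = p → X ∈ N) :
    IsOrderingKernel b (fun X Y => monoLE (f X) (f Y))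
      {X | (f X).level = l ∧ (f X).parity = p} positiveG N := by
  refine isOrderingKernel_of_leading hf hb h0 (fun X hX => hX.2) hN fun X hX hXN => ?_
  by_cases h : (f X).gs ≠ [] ∨ (f X).ls ≠ []
  · obtain ⟨Γ, hΓ, Z', -, h₁, h₂⟩ := hv.exists_leading (f X) h
    obtain ⟨i, rfl⟩ := hs Z'
    exact ⟨Γ, Submodule.mem_sup_left hΓ, i, h₁, fun Y _ => h₂ (f Y)⟩
  · push Not at h
    have hX' := Mono.eq_pure h.1 h.2
    have hr₁ : (f X).r₁ = 1 := by
      by_contra hne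
      have hr₀ : (f X).r₁ = 0 := by omega
      exact hXN (H X _ _ (hr₀ ▸ hX') hX.1 hX.2)
    rw [hr₁] at hX'
    have hl := hX.1
    rw [hX', Mono.level_pure] at hl
    obtain ⟨Γ, hΓ, Z', h₁, h₂⟩ := hv.exists_leading_pure (f X).n (f X).r₂
    obtain ⟨i, rfl⟩ := hs Z'
    rw [← hX'] at h₁
    refine ⟨Γ, hΓ, i, h₁, fun Y hY hlt => h₂ (f Y) ?_⟩
    rw [hX'] at hlt
    exact Mono.n_lt_of_monoLT_pure (hY.1.trans hl.symm) hlt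

end Kernel

end Ramond

/-! ### Level and parity pin down the monomials in $L_{-1}$, $G_{-1}$, $G_0$ -/

theorem mainTheorem1 (c : ℂ) :
    (∀ Δ : ℂ, ∃ b : Module.Basis Ramond.Mono ℂ (Ramond.Verma c Δ),
      (∀ X, b X = X.toU • Ramond.hwv c Δ) ∧
      ∀ l : ℕ, 1 ≤ l →
        Ramond.IsOrderingKernel b Ramond.monoLE (Ramond.cset 1 l) Ramond.positive
          {Ramond.Mono.pure l 0 0, Ramond.Mono.pure (l - 1) 1 1} ∧
        Ramond.IsOrderingKernel b Ramond.monoLE (Ramond.cset (-1) l) Ramond.positive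
          {Ramond.Mono.pure l 0 1, Ramond.Mono.pure (l - 1) 1 0} ∧
        Ramond.IsOrderingKernel b Ramond.monoLE (Ramond.cset 1 l) Ramond.positiveG
          {Ramond.Mono.pure l 0 0} ∧
        Ramond.IsOrderingKernel b Ramond.monoLE (Ramond.cset (-1) l) Ramond.positiveG
          {Ramond.Mono.pure l 0 1}) ∧
    ∃ b : Module.Basis Ramond.MonoG ℂ (Ramond.VermaG c),
      (∀ X, b X = X.1.toU • Ramond.hwvG c) ∧
      ∀ l : ℕ, 1 ≤ l →
        Ramond.IsOrderingKernel b Ramond.monoLEG (Ramond.csetG 1 l) Ramond.positive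
          {Ramond.MonoG.pure l 0} ∧
        Ramond.IsOrderingKernel b Ramond.monoLEG (Ramond.csetG (-1) l) Ramond.positive
          {Ramond.MonoG.pure (l - 1) 1} := by
  open Ramond in
  constructor
  · intro Δ
    obtain ⟨b, hb⟩ := exists_standard_basis (Or.inl rfl) (vermaIdeal_eq c Δ) id
      Function.injective_id (by simp)
    have hv := isHighestWeight_mk le_rfl (vermaIdeal_eq c Δ)
    refine ⟨b, hb, fun l hl => ⟨?_, ?_, ?_, ?_⟩⟩
    · refine isOrderingKernel_positive hv Function.injective_id hb (by simp) (by simp) ?_ ?_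
      -- Positivity of `l` makes `l - 1` a genuine subtraction, so the second monomial has level
      -- `l`.
      · rintro X (rfl | rfl) <;> simp [hl]
      · intro X n r₁ r₂ h h₁ h₂
        simp only [id_eq] at h h₁ h₂
        subst h
        rw [Mono.level_pure] at h₁
        rw [Mono.parity_pure] at h₂
        fin_cases r₁ <;> fin_cases r₂ <;> simp_all
        simp [← h₁]
    · refine isOrderingKernel_positive hv Function.injective_id hb (by simp) (by simp) ?_ ?_
      · rintro X (rfl | rfl) <;> simp [hl]
      · intro X n r₁ r₂ h h₁ h₂
        simp only [id_eq] at h h₁ h₂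
        subst h
        rw [Mono.level_pure] at h₁
        rw [Mono.parity_pure] at h₂
        fin_cases r₁ <;> fin_cases r₂ <;> simp_all
        simp [← h₁]
    · refine isOrderingKernel_positiveG hv Function.injective_id hb (by simp) ?_
        Function.surjective_id ?_
      · rintro X rfl
        simp
      · intro X n r₂ h h₁ h₂
        simp only [id_eq] at h h₁ h₂
        subst h
        rw [Mono.level_pure] at h₁
        rw [Mono.parity_pure] at h₂
        fin_cases r₂ <;> simp_all
    · refine isOrderingKernel_positiveG hv Function.injective_id hb (by simp) ?_
        Function.surjective_id ?_
      · rintro X rfl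
        simp
      · intro X n r₂ h h₁ h₂
        simp only [id_eq] at h h₁ h₂
        subst h
        rw [Mono.level_pure] at h₁
        rw [Mono.parity_pure] at h₂
        fin_cases r₂ <;> simp_all
  · obtain ⟨b, hb⟩ := exists_standard_basis (Or.inr ⟨rfl, rfl⟩) (vermaIdealG_eq c)
      (Subtype.val : MonoG → Mono) Subtype.val_injective (by simp)
    have hv := isHighestWeight_mk zero_le_one (vermaIdealG_eq c)
    -- A monomial that is not a label ends in $G_0$, which kills the highest weight vector here.
    have h0 : ∀ W ∉ Set.range (Subtype.val : MonoG → Mono),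
        W.toU • (Submodule.Quotient.mk 1 : VermaG c) = 0 := by
      intro W hW
      have h₂ : W.r₂ = 1 := by
        have : W.r₂ ≠ 0 := by simpa using hW
        omega
      rw [Mono.toU, h₂, Fin.val_one, pow_one, mul_smul, G_zero_smul_mk (vermaIdealG_eq c),
        smul_zero]
    have hr : ∀ (X : Mono) (i : MonoG), X.r₂ = i.1.r₂ →
        X ∈ Set.range (Subtype.val : MonoG → Mono) := fun X i h => ⟨⟨X, h.trans i.2⟩, rfl⟩
    refine ⟨b, hb, fun l hl => ⟨?_, ?_⟩⟩
    · refine isOrderingKernel_positive hv Subtype.val_injective hb h0 hr ?_ ?_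
      · rintro X rfl
        simp [MonoG.pure]
      · rintro ⟨X, hX⟩ n r₁ r₂ h h₁ h₂
        change X = _ at h
        subst h
        rw [Mono.level_pure] at h₁
        rw [Mono.parity_pure] at h₂
        replace hX : r₂ = 0 := hX
        subst hX
        fin_cases r₁ <;> simp_all [MonoG.pure]
    · refine isOrderingKernel_positive hv Subtype.val_injective hb h0 hr ?_ ?_
      · rintro X rfl
        simp [MonoG.pure, hl]
      · rintro ⟨X, hX⟩ n r₁ r₂ h h₁ h₂
        change X = _ at h
        subst h
        rw [Mono.level_pure] at h₁
        rw [Mono.parity_pure] at h₂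
        replace hX : r₂ = 0 := hX
        subst hX
        fin_cases r₁ <;> simp_all [MonoG.pure]
        simp [← h₁]
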